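/- Let $E/F$ be either a cyclic extension of $p$-adic fields of degree $l$ or the extension $\mathbb C/\mathbb R$, let $\sigma$ be a generator of $\mathrm{Gal}(E/F)$, and let $n\ge 1$. Fix a non-trivial continuous additive character $\psi$ of $F$ and put $\psi_E=\psi\circ\mathrm{tr}_{E/F}$. Representations are complex smooth ones in the $p$-adic case, and admissible Hilbert space representations, considered through their $(\mathfrak g,K)$-modules of $K$-finite vectors, in the Archimedean case. Let $|\cdot|_F,|\cdot|_E$ be the normalised absolute values. *Norm.* For $g\in GL_n(E)$ put $Ng=g\,\sigma(g)\cdots\sigma^{l-1}(g)$, and let $\mathcal N g$ be the conjugacy class in $GL_n(F)$ of the elements of $GL_n(F)$ that are conjugate to $Ng$ in $GL_n(E)$. The element $g$ is $\sigma$-regular if the characteristic polynomial of $\mathcal N g$ is separable. The same definitions are used for standard (block diagonal) Levi subgroups. *Normalised operator.* For an irreducible $\sigma$-stable generic $\Pi$, $I_\Pi$ is the isomorphism $\Pi\to\Pi^\sigma$, $\Pi^\sigma(g)=\Pi(\sigma(g))$, that induces the identity on the line of Whittaker functionals with respect to $\psi_E$. For a general irreducible $\sigma$-stable $\Pi$,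 write $\Pi$ as the Langlands quotient of the parabolically induced representation $\mathrm{ind}\,\tau$, $\tau$ an essentially tempered representation, in standard order, of a standard Levi subgroup; then $I_\Pi$ is the operator induced on the quotient $\Pi$ by $f\mapsto I_\tau\circ f\circ\sigma^{-1}$. *Shintani lift.* Irreducible representations $\pi$ of $GL_n(F)$ and $\Pi$ of $GL_n(E)$ verify the Shintani relation if $\Pi$ is $\sigma$-stable and $\chi_{\Pi,\sigma}(g)=\chi_\pi(\mathcal N g)$ for all $\sigma$-regular $g\in GL_n(E)$, where $\chi_\pi$ is the function representing $f\mapsto \mathrm{tr}\,\pi(f)$ and $\chi_{\Pi,\sigma}$ the one representing $f\mapsto\mathrm{tr}(\Pi(f)\circ I_\Pi)$. $\Pi$ is the base change of $\pi$ if they are the Langlands quotients attached to essentially tempered representations $\nu^\alpha\tau$ and $\nu^\alpha\tau'$ of the same standard Levi subgroup over $F$ and over $E$, with the same exponents $\alpha$, where the tempered representations $\tau$ and $\tau'$ verify the Shintani relation for that Levi subgroup. $\Pi$ is a Shintani lift of $\pi$ if it is the base change of $\pi$ and the two verify the Shintani relation. **Proposition.** (a) For every smooth character $\chi$ of $GL_n(F)$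 the formula $\chi_E(g)=\chi(\mathcal N g)$ defines a smooth character $\chi_E$ of $GL_n(E)$, which is a Shintani lift of $\chi$, and the normalised operator $I_{\chi_E}$ is the identity. (b) If $F$ is non-Archimedean, then for every $z\in\mathbb C$ the unramified character $|\det|_F^z$ has the Shintani lift $|\det|_E^z$, and $\chi\mapsto\chi_E$ is a surjective group homomorphism from the group $X^0(GL_n(F))$ of unramified characters of $GL_n(F)$ onto $X^0(GL_n(E))$. (c) If $\chi$ is a smooth character of $GL_n(F)$ and $\pi$ is an irreducible representation of $GL_n(F)$ with Shintani lift $\Pi$, then $\chi_E\Pi$ is a Shintani lift of $\chi\pi$. -/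

import Mathlib

open MeasureTheory Filter Topology
open scoped ComplexOrder

noncomputable section

namespace Shintani

/-! ### Groups: `GL_n`, standard Levi subgroups, normalised absolute value

A standard Levi subgroup is given by a monotone map `b : Fin n → Fin n`; the blocks are the fibres
of `b` (values that are not attained are empty blocks and play no role).
The map `0` gives `GL_n` itself, the identity map gives the diagonal torus. -/

/-- `GL_n(F)` -/
abbrev G (n : ℕ) (F : Type*) [Field F] := Matrix.GeneralLinearGroup (Fin n) F

section Groups

variable {n : ℕ}

/-- The subgroup of block diagonal matrices attached to `b`. -/
def levi (F : Type*) [Field F] (b : Fin n → Fin n) : Subgroup (G n F) where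
  carrier := {g | ∀ i j, b i ≠ b j → (g : Matrix (Fin n) (Fin n) F) i j = 0 ∧
    ((g⁻¹ : G n F) : Matrix (Fin n) (Fin n) F) i j = 0}
  one_mem' := by
    intro i j hij
    have : i ≠ j := fun h => hij (by rw [h])
    simp [Matrix.one_apply_ne this]
  mul_mem' := by
    intro x y hx hy i j hij
    rw [mul_inv_rev]
    simp only [Units.val_mul, Matrix.mul_apply]
    refine ⟨Finset.sum_eq_zero fun k _ => ?_, Finset.sum_eq_zero fun k _ => ?_⟩
    · by_cases h : b i = b k
      · rw [(hy k j (h ▸ hij)).1, mul_zero]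
      · rw [(hx i k h).1, zero_mul]
    · by_cases h : b i = b k
      · rw [(hx k j (h ▸ hij)).2, mul_zero]
      · rw [(hy i k h).2, zero_mul]
  inv_mem' := by
    intro x hx i j hij
    rw [inv_inv]
    exact ⟨(hx i j hij).2, (hx i j hij).1⟩

/-- `b` is the block map of a standard Levi subgroup, `c` that of a standard Levi subgroup
contained in it. -/
def Refines (c b : Fin n → Fin n) : Prop :=
  Monotone c ∧ Monotone b ∧ ∀ i j, c i = c j → b i = b j

variable {F : Type*} [Field F]

/-- `g` lies in the unipotent radical of the standard (upper triangular) parabolic subgroup with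
Levi subgroup `levi F c`. For `c = id` this is the group of upper unitriangular matrices. -/
def IsUnip (c : Fin n → Fin n) (g : G n F) : Prop :=
  ∀ i j, c j ≤ c i → (g : Matrix (Fin n) (Fin n) F) i j = if i = j then 1 else 0

/-- The determinant of the `k`-th diagonal block. -/
def blockDet (c : Fin n → Fin n) (k : Fin n) (g : G n F) : F :=
  ((g : Matrix (Fin n) (Fin n) F).toSquareBlock c k).det

/-- The size of the `k`-th block. -/
def blockSize (c : Fin n → Fin n) (k : Fin n) : ℕ := Fintype.card {i // c i = k}

/-- Regular semisimple elements of a Levi subgroup: the characteristic polynomial of each block is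
separable. For `b = 0` these are the regular semisimple elements of `GL_n(F)`. -/
def IsRegular (b : Fin n → Fin n) (y : G n F) : Prop :=
  ∀ k, ((y : Matrix (Fin n) (Fin n) F).toSquareBlock b k).charpoly.Separable

/-- A ring homomorphism applied to the entries of an element of a Levi subgroup. -/
def leviMap {E : Type*} [Field E] (φ : F →+* E) (b : Fin n → Fin n) : levi F b →* levi E b :=
  ((Matrix.GeneralLinearGroup.map (n := Fin n) φ).comp (levi F b).subtype).codRestrict (levi E b)
    (by
      intro g i j hij
      obtain ⟨h1, h2⟩ := g.2 i j hij
      constructor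
      · simpa using congrArg φ h1
      · rw [← map_inv]
        show φ (((g : G n F)⁻¹ : G n F).val i j) = 0
        rw [h2, map_zero])

open Classical in
/-- The normalised absolute value of a locally compact field: the factor by which multiplication
by `x` scales additive Haar measures. On a `p`-adic field it takes the value `q⁻¹` on a uniformiser
(`q` the cardinality of the residue field), on `ℝ` it is the usual absolute value and on `ℂ` it is
the square of the modulus. -/
def normAbs {F : Type*} [NontriviallyNormedField F] [LocallyCompactSpace F] (x : F) : ℝ :=
  if h : x = 0 then 0 else (distribHaarChar F (Units.mk0 x h) : ℝ)

open Classical in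
/-- The function `m ↦ δ(m)^{1/2} ∏ₖ |det mₖ|^{αₖ}` on the Levi subgroup attached to `c`, where `δ`
is the modulus character of the standard parabolic subgroup of `levi F b` with Levi subgroup
`levi F c`, namely `δ(m) = ∏_{k<l} |det mₖ|^{nₗ} |det mₗ|^{-nₖ}`, the product being over
pairs of blocks of `c` that are contained in the same block of `b`. -/
def indWeight {F : Type*} [NontriviallyNormedField F] [LocallyCompactSpace F]
    (b c : Fin n → Fin n) (α : Fin n → ℝ) (g : G n F) : ℝ :=
  (∏ k, ∏ l, if k < l ∧ ∃ i j, c i = k ∧ c j = l ∧ b i = b j then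
      normAbs (blockDet c k g) ^ ((blockSize c l : ℝ) / 2) *
      normAbs (blockDet c l g) ^ (-(blockSize c k : ℝ) / 2) else 1) *
  ∏ k, normAbs (blockDet c k g) ^ (α k)

/-- The exponents `α` are strictly decreasing along the blocks of `b`. -/
def StrictlyDecreasing (b : Fin n → Fin n) (α : Fin n → ℝ) : Prop :=
  ∀ i j, b i < b j → α (b j) < α (b i)

end Groups

/-! ### The norm map -/

section Norm

variable {n : ℕ} {F E : Type*} [Field F] [Field E] [Algebra F E]

/-- The entrywise action of an element of the Galois group on `GL_n(E)`. -/
def galGL (s : E ≃ₐ[F] E) : G n E →* G n E :=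
  Matrix.GeneralLinearGroup.map (n := Fin n) (s : E →+* E)

/-- `N g = g g^σ ⋯ g^{σ^{l-1}}` with `l = [E : F]`. -/
def galNorm (σ : E ≃ₐ[F] E) (g : G n E) : G n E :=
  ((List.range (Module.finrank F E)).map fun i => galGL (σ ^ i) g).prod

/-- `y` belongs to the conjugacy class `𝒩 g`; here `g` and `y` are elements of the Levi subgroups
attached to `b` over `E` and over `F` (`b = 0` for `GL_n`), and `y` is conjugate to `N g` in that
Levi subgroup over `E`. -/
def IsNorm (σ : E ≃ₐ[F] E) (b : Fin n → Fin n) (g : G n E) (y : G n F) : Prop :=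
  ∃ x ∈ levi E b, x⁻¹ * galNorm σ g * x =
    Matrix.GeneralLinearGroup.map (n := Fin n) (algebraMap F E) y

/-- The Galois automorphism on a Levi subgroup. -/
def galLevi (σ : E ≃ₐ[F] E) (b : Fin n → Fin n) : levi E b →* levi E b :=
  leviMap (σ : E →+* E) b

/-- The `σ`-regular semisimple elements of a Levi subgroup. -/
def sigmaRegular (σ : E ≃ₐ[F] E) (b : Fin n → Fin n) : Set (levi E b) :=
  {g | ∃ y : levi F b, IsNorm σ b g y ∧ IsRegular b (y : G n F)}

end Norm

/-! ### Generalities on representations -/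

section Rep

variable {H : Type*} [Group H] {V W : Type*} [AddCommGroup V] [Module ℂ V]
  [AddCommGroup W] [Module ℂ W]

/-- The twist `χρ`. -/
def twist (χ : H →* ℂˣ) (ρ : Representation ℂ H V) : Representation ℂ H V where
  toFun g := (χ g : ℂ) • ρ g
  map_one' := by simp
  map_mul' g h := by
    ext v
    simp [mul_smul, smul_comm (χ g : ℂ)]

/-- A character as a representation on `ℂ`. -/
def charRep (χ : H →* ℂˣ) : Representation ℂ H ℂ :=
  twist χ (Representation.trivial ℂ H ℂ)

/-- The action of `H` by right translation on functions `H → W`. -/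
def rightReg (H W : Type*) [Group H] [AddCommGroup W] [Module ℂ W] :
    Representation ℂ H (H → W) where
  toFun g :=
    { toFun := fun f x => f (x * g)
      map_add' := fun _ _ => rfl
      map_smul' := fun _ _ => rfl }
  map_one' := by ext f x; simp
  map_mul' g h := by ext f x; simp [mul_assoc]

/-- The trace of an operator of finite rank. -/
def finTrace (T : V →ₗ[ℂ] V) : ℂ :=
  LinearMap.trace ℂ (LinearMap.range T) (T.rangeRestrict ∘ₗ (LinearMap.range T).subtype)

/-- Restriction of a representation of `GL_n(F)` to a Levi subgroup; for `b = 0` this merely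
regards it as a representation of the Levi subgroup `GL_n(F)`. -/
def resLevi {n : ℕ} {F : Type*} [Field F] (b : Fin n → Fin n) (π : Representation ℂ (G n F) V) :
    Representation ℂ (levi F b) V := π.comp (levi F b).subtype

/-- Functions `f : levi F b → W` such that `f(mug) = δ(m)^{1/2} ν^α(m) τ(m) f(g)` for `m` in
`levi F c` and `u` in the unipotent radical of the standard parabolic subgroup of `levi F b`
with Levi subgroup `levi F c`. -/
def covFns {n : ℕ} {F : Type*} [NontriviallyNormedField F] [LocallyCompactSpace F]
    (b c : Fin n → Fin n) (α : Fin n → ℝ) (τ : Representation ℂ (levi F c) W) :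
    Submodule ℂ (levi F b → W) where
  carrier := {f | (∀ (m g : levi F b) (hm : (m : G n F) ∈ levi F c),
      f (m * g) = (indWeight b c α (m : G n F) : ℂ) • τ ⟨m, hm⟩ (f g)) ∧
    ∀ u g : levi F b, IsUnip c (u : G n F) → f (u * g) = f g}
  zero_mem' := ⟨by simp, by simp⟩
  add_mem' := by
    intro f f' hf hf'
    refine ⟨fun m g hm => ?_, fun u g hu => ?_⟩
    · simp [hf.1 m g hm, hf'.1 m g hm]
    · simp [hf.2 u g hu, hf'.2 u g hu]
  smul_mem' := by
    intro a f hf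
    refine ⟨fun m g hm => ?_, fun u g hu => ?_⟩
    · simp [hf.1 m g hm, smul_comm a]
    · simp [hf.2 u g hu]

/-- The character `Θ_ψ(u) = ψ(∑ u_{i,i+1})` attached to an additive character of `E`. -/
def thetaChar {n : ℕ} {E : Type*} [Field E] (ψ : AddChar E Circle) (u : G n E) : ℂ :=
  ψ (∑ i : Fin n, if h : (i : ℕ) + 1 < n then
    (u : Matrix (Fin n) (Fin n) E) i ⟨i + 1, h⟩ else 0)

/-- `ψ_E = ψ ∘ tr_{E/F}`. -/
def psiE {F : Type*} (E : Type*) [Field F] [Field E] [Algebra F E] (ψ : AddChar F Circle) :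
    AddChar E Circle :=
  ψ.compAddMonoidHom (Algebra.trace F E).toAddMonoidHom

end Rep

/-! ### Characters of `GL_n` -/

section Characters

variable {n : ℕ} [NeZero n]

/-- `χ_E(g) = χ(𝒩 g)`: the conjugacy class `𝒩 g` is non-empty and `χ` takes on it the
constant value `χ_E(g)`. -/
def IsNormComp {F E : Type*} [NontriviallyNormedField F] [NontriviallyNormedField E] [Algebra F E]
    (σ : E ≃ₐ[F] E) (χ : G n F →ₜ* ℂˣ) (χE : G n E →ₜ* ℂˣ) : Prop :=
  ∀ g : G n E, (∃ y : G n F, IsNorm σ 0 g y) ∧ ∀ y : G n F, IsNorm σ 0 g y → χE g = χ y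

/-- The unramified characters of `GL_n(F)`: those trivial on `{g | |det g| = 1}`. -/
def unramified (n : ℕ) (F : Type*) [NontriviallyNormedField F] [LocallyCompactSpace F] :
    Subgroup (G n F →ₜ* ℂˣ) where
  carrier := {χ | ∀ g : G n F, normAbs (g : Matrix (Fin n) (Fin n) F).det = 1 → χ g = 1}
  one_mem' := fun _ _ => rfl
  mul_mem' := by
    intro χ χ' h h' g hg
    rw [ContinuousMonoidHom.mul_apply, h g hg, h' g hg, one_mul]
  inv_mem' := by
    intro χ h g hg
    show (χ g)⁻¹ = 1
    rw [h g hg, inv_one]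

end Characters

/-- A function on a group whose absolute value descends to a square integrable function modulo the
centre, for a Haar measure on the quotient. -/
def SqIntModCenter {H : Type*} [Group H] [TopologicalSpace H] (f : H → ℂ) : Prop :=
  ∃ (_ : MeasurableSpace (H ⧸ Subgroup.center H)) (_ : BorelSpace (H ⧸ Subgroup.center H))
    (μ : Measure (H ⧸ Subgroup.center H)) (φ : H ⧸ Subgroup.center H → ℝ),
    μ.IsHaarMeasure ∧ (∀ g : H, φ (g : H ⧸ Subgroup.center H) = ‖f g‖ ^ 2) ∧ Integrable φ μ

/-! ### The `p`-adic case -/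

namespace Padic

section Smooth

variable {H : Type*} [Group H] [TopologicalSpace H] {V : Type*} [AddCommGroup V] [Module ℂ V]

/-- The smooth vectors: those fixed by an open subgroup. -/
def smoothPart (ρ : Representation ℂ H V) : Submodule ℂ V where
  carrier := {v | ∃ U : Subgroup H, IsOpen (U : Set H) ∧ ∀ u ∈ U, ρ u v = v}
  zero_mem' := ⟨⊤, isOpen_univ, by simp⟩
  add_mem' := by
    rintro v w ⟨U, hU, h⟩ ⟨U', hU', h'⟩
    exact ⟨U ⊓ U', hU.inter hU', fun u hu => by rw [map_add, h u hu.1, h' u hu.2]⟩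
  smul_mem' := by
    rintro a v ⟨U, hU, h⟩
    exact ⟨U, hU, fun u hu => by rw [map_smul, h u hu]⟩

/-- Smooth irreducible representations. -/
def IsSmoothIrred (ρ : Representation ℂ H V) : Prop :=
  smoothPart ρ = ⊤ ∧ ρ.IsIrreducible

/-- Square integrable representations: smooth, irreducible, unitary, and with a non-zero matrix
coefficient that is square integrable modulo the centre. -/
def IsSquareIntegrable (ρ : Representation ℂ H V) : Prop :=
  IsSmoothIrred ρ ∧
  (∃ ip : InnerProductSpace.Core ℂ V, ∀ g v w, ip.inner (ρ g v) (ρ g w) = ip.inner v w) ∧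
  ∃ (v : V) (ℓ : Module.Dual ℂ V),
    (∃ U : Subgroup H, IsOpen (U : Set H) ∧ ∀ u ∈ U, ∀ w, ℓ (ρ u w) = ℓ w) ∧
    (∃ g, ℓ (ρ g v) ≠ 0) ∧ SqIntModCenter fun g => ℓ (ρ g v)

/-- The function `Θ` is locally integrable, locally constant on `reg`, and represents the
distribution `f ↦ tr(ρ(f) ∘ A)` on the Hecke algebra of locally constant functions with compact
support. The operator `T = ρ(f) = ∫ f(g) ρ(g) dg` is characterised by its pairings with linear
functionals. (The condition does not depend on the normalisation of the Haar measure.) -/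
def IsCharFn (ρ : Representation ℂ H V) (A : V →ₗ[ℂ] V) (reg : Set H) (Θ : H → ℂ) : Prop :=
  ∃ (_ : MeasurableSpace H) (_ : BorelSpace H) (μ : Measure H), μ.IsHaarMeasure ∧
    LocallyIntegrable Θ μ ∧ (∀ x ∈ reg, ∀ᶠ y in 𝓝 x, Θ y = Θ x) ∧
    ∀ f : H → ℂ, IsLocallyConstant f → HasCompactSupport f →
      ∃ T : V →ₗ[ℂ] V, (∀ (v : V) (ℓ : Module.Dual ℂ V), ℓ (T v) = ∫ g, f g * ℓ (ρ g v) ∂μ) ∧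
        FiniteDimensional ℂ (LinearMap.range T) ∧ finTrace (T ∘ₗ A) = ∫ g, Θ g * f g ∂μ

end Smooth

section Field

variable {n : ℕ} {F : Type*} [NontriviallyNormedField F] [LocallyCompactSpace F]
  {V : Type*} [AddCommGroup V] [Module ℂ V] {W : Type*} [AddCommGroup W] [Module ℂ W]

/-- The space of the normalised parabolic induction of `ν^α τ` from `levi F c` to `levi F b`;
the group acts by right translation. -/
def ind (b c : Fin n → Fin n) (α : Fin n → ℝ) (τ : Representation ℂ (levi F c) W) :
    Submodule ℂ (levi F b → W) :=
  covFns b c α τ ⊓ smoothPart (rightReg (levi F b) W)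

/-- Tempered representations of `levi F b`: irreducible, of the form `ind δ` with `δ` a square
integrable representation of a standard Levi subgroup. -/
def IsTempered (b : Fin n → Fin n) (τ : Representation ℂ (levi F b) V) : Prop :=
  IsSmoothIrred τ ∧ ∃ c, Refines c b ∧
    ∃ (W : Type) (_ : AddCommGroup W) (_ : Module ℂ W) (δ : Representation ℂ (levi F c) W),
      IsSquareIntegrable δ ∧ ∃ e : V ≃ₗ[ℂ] ind b c 0 δ,
        ∀ g v x, (e (τ g v) : levi F b → W) x = (e v : levi F b → W) (x * g)

variable [NeZero n]

/-- `p` exhibits `π` as a quotient of the representation of `GL_n(F)` parabolically induced from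
`ν^α τ`. If `τ` is tempered, `α` is strictly decreasing and `π` is irreducible, this says that
`π` is the Langlands quotient. -/
def IsQuotientMap (b : Fin n → Fin n) (α : Fin n → ℝ) (τ : Representation ℂ (levi F b) W)
    (π : Representation ℂ (G n F) V) (p : ind 0 b α τ →ₗ[ℂ] V) : Prop :=
  Function.Surjective p ∧ ∀ (g : levi F (0 : Fin n → Fin n)) (f f' : ind 0 b α τ),
    (∀ x, f'.1 x = f.1 (x * g)) → p f' = π g (p f)

end Field

section Ext

variable {n : ℕ} {F E : Type*} [NontriviallyNormedField F] [LocallyCompactSpace F]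
  [NontriviallyNormedField E] [LocallyCompactSpace E] [Algebra F E]
  {V : Type*} [AddCommGroup V] [Module ℂ V] {W : Type*} [AddCommGroup W] [Module ℂ W]

/-- Whittaker functionals on a representation of a Levi subgroup. -/
def IsWhittaker (b : Fin n → Fin n) (ψ : AddChar E Circle) (τ : Representation ℂ (levi E b) W)
    (ℓ : Module.Dual ℂ W) : Prop :=
  ∀ u : levi E b, IsUnip id (u : G n E) → ∀ w, ℓ (τ u w) = thetaChar ψ (u : G n E) * ℓ w

/-- `τ` is generic, and `I` is the isomorphism `τ ≃ τ^σ` inducing the identity on the line of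
Whittaker functionals. (Twisting `τ` by a real power of the absolute value of the determinants of
the blocks changes neither the Whittaker functionals nor `I`.) -/
def IsGenericOp (σ : E ≃ₐ[F] E) (ψ : AddChar F Circle) (b : Fin n → Fin n)
    (τ : Representation ℂ (levi E b) W) (I : W →ₗ[ℂ] W) : Prop :=
  (∃ ℓ, ℓ ≠ 0 ∧ IsWhittaker b (psiE E ψ) τ ℓ ∧
    ∀ ℓ', IsWhittaker b (psiE E ψ) τ ℓ' → ∃ a : ℂ, ℓ' = a • ℓ) ∧
  Function.Bijective I ∧ (∀ g w, I (τ g w) = τ (galLevi σ b g) (I w)) ∧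
  ∀ ℓ, IsWhittaker b (psiE E ψ) τ ℓ → ∀ w, ℓ (I w) = ℓ w

/-- The character identity `χ_{P,σ}(g) = χ_π(𝒩 g)` for all `σ`-regular semisimple `g`, for
representations of Levi subgroups and the twisted character formed with the operator `I`. -/
def CharIdentity (σ : E ≃ₐ[F] E) (b : Fin n → Fin n) (π : Representation ℂ (levi F b) V)
    (P : Representation ℂ (levi E b) W) (I : W →ₗ[ℂ] W) : Prop :=
  ∃ (Θ : levi F b → ℂ) (Θ' : levi E b → ℂ),
    IsCharFn π LinearMap.id {y | IsRegular b (y : G n F)} Θ ∧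
    IsCharFn P I (sigmaRegular σ b) Θ' ∧
    ∀ (g : levi E b) (y : levi F b), IsNorm σ b g y → IsRegular b (y : G n F) → Θ' g = Θ y

variable [NeZero n]

/-- `J` is the normalised `σ`-intertwining operator of the irreducible representation `P` of
`GL_n(E)`: `P` is the Langlands quotient of the representation induced from `ν^α τ`, with `τ`
tempered and `σ`-stable, and `J` is induced on this quotient by the operator
`f ↦ I ∘ f ∘ σ⁻¹`, where `I` is the normalised operator of the generic representation `τ`. -/
def IsNormalizedOp (σ : E ≃ₐ[F] E) (ψ : AddChar F Circle) (P : Representation ℂ (G n E) V)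
    (J : V →ₗ[ℂ] V) : Prop :=
  IsSmoothIrred P ∧ ∃ (b : Fin n → Fin n) (α : Fin n → ℝ), Monotone b ∧ StrictlyDecreasing b α ∧
    ∃ (W : Type) (_ : AddCommGroup W) (_ : Module ℂ W) (τ : Representation ℂ (levi E b) W)
      (I : W →ₗ[ℂ] W), IsTempered b τ ∧ IsGenericOp σ ψ b τ I ∧
      ∃ p : ind 0 b α τ →ₗ[ℂ] V, IsQuotientMap b α τ P p ∧
        ∀ f : ind 0 b α τ, ∃ f' : ind 0 b α τ,
          (∀ x, f'.1 (galLevi σ 0 x) = I (f.1 x)) ∧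
          p f' = J (p f)

/-- `P` and `π` verify the Shintani relation. -/
def ShintaniRelation (σ : E ≃ₐ[F] E) (ψ : AddChar F Circle) (π : Representation ℂ (G n F) V)
    (P : Representation ℂ (G n E) W) : Prop :=
  ∃ J : W →ₗ[ℂ] W, IsNormalizedOp σ ψ P J ∧ CharIdentity σ 0 (resLevi 0 π) (resLevi 0 P) J

/-- `P` is the base change of `π`: there are tempered representations `τ`, `τ'` of a standard Levi
subgroup over `F` and over `E`, with `τ'` `σ`-stable, that verify the Shintani relation, and
exponents `α` in standard order, such that `π` and `P` are the Langlands quotients attached to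
`ν^α τ` and `ν^α τ'`. -/
def IsBaseChange (σ : E ≃ₐ[F] E) (ψ : AddChar F Circle) (π : Representation ℂ (G n F) V)
    (P : Representation ℂ (G n E) W) : Prop :=
  IsSmoothIrred π ∧ IsSmoothIrred P ∧
  ∃ (b : Fin n → Fin n) (α : Fin n → ℝ), Monotone b ∧ StrictlyDecreasing b α ∧
    ∃ (U : Type) (_ : AddCommGroup U) (_ : Module ℂ U) (τ : Representation ℂ (levi F b) U)
      (U' : Type) (_ : AddCommGroup U') (_ : Module ℂ U') (τ' : Representation ℂ (levi E b) U'),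
      IsTempered b τ ∧ IsTempered b τ' ∧
      (∃ I : U' →ₗ[ℂ] U', IsGenericOp σ ψ b τ' I ∧ CharIdentity σ b τ τ' I) ∧
      (∃ p, IsQuotientMap b α τ π p) ∧ ∃ p, IsQuotientMap b α τ' P p

/-- `P` is a Shintani lift of `π`: it is the base change of `π`, and the Shintani relation
holds. -/
def IsShintaniLift (σ : E ≃ₐ[F] E) (ψ : AddChar F Circle) (π : Representation ℂ (G n F) V)
    (P : Representation ℂ (G n E) W) : Prop :=
  IsBaseChange σ ψ π P ∧ ShintaniRelation σ ψ π P

end Ext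

end Padic

/-! ### The Archimedean case

Representations are continuous admissible representations on Hilbert spaces, considered through
their `(𝔤, K)`-modules of `K`-finite vectors. The Lie algebra `𝔤` is the set of continuous
one-parameter subgroups `ℝ → H`. -/

namespace Arch

/-- Continuous one-parameter subgroups. -/
abbrev OnePar (H : Type*) [Group H] [TopologicalSpace H] := Multiplicative ℝ →ₜ* H

section Hilbert

variable {H : Type*} [Group H] [TopologicalSpace H]

/-- The `K`-finite vectors: the union of all finite-dimensional `K`-stable subspaces. -/
def kFin {V : Type*} [AddCommGroup V] [Module ℂ V] (K : Subgroup H) (ρ : Representation ℂ H V) :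
    Submodule ℂ V :=
  sSup {S | FiniteDimensional ℂ S ∧ ∀ k ∈ K, ∀ v ∈ S, ρ k v ∈ S}

variable {V : Type*} [NormedAddCommGroup V] [InnerProductSpace ℂ V]

/-- `w = dρ(X) v`, where `X` is the generator of `γ`. -/
def IsDeriv (ρ : Representation ℂ H V) (γ : OnePar H) (v w : V) : Prop :=
  HasDerivAt (fun t : ℝ => ρ (γ (Multiplicative.ofAdd t)) v) w 0

/-- `f'` is the derivative of the function `f` along the left invariant vector field attached
to `γ`. -/
def IsFunDeriv (γ : OnePar H) (f f' : H → V) : Prop :=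
  ∀ x, HasDerivAt (fun t : ℝ => f (x * γ (Multiplicative.ofAdd t))) (f' x) 0

/-- `w = dρ(X₁) ⋯ dρ(Xₘ) v` -/
def IsIterDeriv (ρ : Representation ℂ H V) : List (OnePar H) → V → V → Prop
  | [], v, w => w = v
  | γ :: L, v, w => ∃ u, IsIterDeriv ρ L v u ∧ IsDeriv ρ γ u w

theorem IsIterDeriv.zero (ρ : Representation ℂ H V) (L : List (OnePar H)) :
    IsIterDeriv ρ L 0 0 := by
  induction L with
  | nil => rfl
  | cons γ L ih =>
    refine ⟨0, ih, ?_⟩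
    simpa [IsDeriv] using hasDerivAt_const (0 : ℝ) (0 : V)

theorem IsIterDeriv.add {ρ : Representation ℂ H V} {L : List (OnePar H)} :
    ∀ {v w v' w' : V}, IsIterDeriv ρ L v w → IsIterDeriv ρ L v' w' →
      IsIterDeriv ρ L (v + v') (w + w') := by
  induction L with
  | nil =>
    intro v w v' w' h h'
    rw [IsIterDeriv] at *
    rw [h, h']
  | cons γ L ih =>
    rintro v w v' w' ⟨u, hu, h⟩ ⟨u', hu', h'⟩
    refine ⟨u + u', ih hu hu', ?_⟩
    simpa [IsDeriv] using HasDerivAt.fun_add h h'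

theorem IsIterDeriv.smul {ρ : Representation ℂ H V} {L : List (OnePar H)} (a : ℂ) :
    ∀ {v w : V}, IsIterDeriv ρ L v w → IsIterDeriv ρ L (a • v) (a • w) := by
  induction L with
  | nil =>
    intro v w h
    rw [IsIterDeriv] at *
    rw [h]
  | cons γ L ih =>
    rintro v w ⟨u, hu, h⟩
    refine ⟨a • u, ih hu, ?_⟩
    simpa [IsDeriv] using HasDerivAt.fun_const_smul a h

/-- The smooth vectors: those to which all products of elements of the Lie algebra can be
applied. -/
def smoothVec (ρ : Representation ℂ H V) : Submodule ℂ V where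
  carrier := {v | ∀ L, ∃ w, IsIterDeriv ρ L v w}
  zero_mem' := fun L => ⟨0, IsIterDeriv.zero ρ L⟩
  add_mem' := by
    intro v v' h h' L
    obtain ⟨w, hw⟩ := h L
    obtain ⟨w', hw'⟩ := h' L
    exact ⟨w + w', hw.add hw'⟩
  smul_mem' := by
    intro a v h L
    obtain ⟨w, hw⟩ := h L
    exact ⟨a • w, hw.smul a⟩

/-- Continuity for the Fréchet topology on the smooth vectors, given by the seminorms
`v ↦ ‖dρ(X₁) ⋯ dρ(Xₘ) v‖`. -/
def IsContFunctional (ρ : Representation ℂ H V) (ℓ : Module.Dual ℂ (smoothVec ρ)) : Prop :=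
  ∃ (S : Finset (List (OnePar H))) (C : ℝ), ∀ (v : smoothVec ρ) (w : List (OnePar H) → V),
    (∀ L ∈ S, IsIterDeriv ρ L v (w L)) → ‖ℓ v‖ ≤ C * ∑ L ∈ S, ‖w L‖

/-- Irreducible admissible continuous representations: no non-trivial closed invariant subspaces,
and every finite-dimensional representation of `K` occurs with finite multiplicity. -/
def IsIrredAdm (K : Subgroup H) (ρ : Representation ℂ H V) : Prop :=
  Continuous (fun x : H × V => ρ x.1 x.2) ∧ Nontrivial V ∧
  (∀ S : Submodule ℂ V, IsClosed (S : Set V) → (∀ g, ∀ v ∈ S, ρ g v ∈ S) → S = ⊥ ∨ S = ⊤) ∧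
  ∀ (m : ℕ) (κ : Representation ℂ K (Fin m → ℂ)),
    FiniteDimensional ℂ (Representation.linHom κ (ρ.comp K.subtype)).invariants

/-- The representation preserves the inner product. -/
def IsUnitary (ρ : Representation ℂ H V) : Prop :=
  ∀ g v w, inner ℂ (ρ g v) (ρ g w) = inner ℂ v w

/-- Square integrable representations. -/
def IsSquareIntegrable (K : Subgroup H) (ρ : Representation ℂ H V) : Prop :=
  IsIrredAdm K ρ ∧ IsUnitary ρ ∧
  ∃ v w : V, (∃ g, inner ℂ w (ρ g v) ≠ 0) ∧ SqIntModCenter fun g => inner ℂ w (ρ g v)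

/-- Smooth functions: all iterated derivatives along left invariant vector fields exist and are
continuous. -/
def IsSmoothFn (f : H → ℂ) : Prop :=
  ∃ S : Set (H → ℂ), f ∈ S ∧ ∀ h ∈ S, Continuous h ∧ ∀ γ : OnePar H, ∃ h' ∈ S, IsFunDeriv γ h h'

/-- Smooth functions with compact support that are `K`-finite on both sides. -/
def IsHecke (K : Subgroup H) (f : H → ℂ) : Prop :=
  IsSmoothFn f ∧ HasCompactSupport f ∧ f ∈ kFin K (rightReg H ℂ) ∧
    (fun x => f x⁻¹) ∈ kFin K (rightReg H ℂ)

/-- The function `Θ` is locally integrable, continuous on `reg`, and represents the distribution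
`f ↦ tr(ρ(f) ∘ A)` on smooth `K`-finite functions with compact support, the operators acting on
the space of `K`-finite vectors. -/
def IsCharFn (K : Subgroup H) (ρ : Representation ℂ H V) (A : kFin K ρ →ₗ[ℂ] kFin K ρ)
    (reg : Set H) (Θ : H → ℂ) : Prop :=
  ∃ (_ : MeasurableSpace H) (_ : BorelSpace H) (μ : Measure H), μ.IsHaarMeasure ∧
    LocallyIntegrable Θ μ ∧ ContinuousOn Θ reg ∧
    ∀ f : H → ℂ, IsHecke K f →
      ∃ T : kFin K ρ →ₗ[ℂ] kFin K ρ,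
        (∀ (v : kFin K ρ) (w : V),
          inner ℂ w (T v : V) = ∫ g, f g * inner ℂ w (ρ g (v : V)) ∂μ) ∧
        FiniteDimensional ℂ (LinearMap.range T) ∧ finTrace (T ∘ₗ A) = ∫ g, Θ g * f g ∂μ

/-- The continuous functions on `H` with values in `V`. -/
def contFns (H : Type*) [TopologicalSpace H] (V : Type*) [NormedAddCommGroup V]
    [InnerProductSpace ℂ V] : Submodule ℂ (H → V) where
  carrier := {f | Continuous f}
  zero_mem' := continuous_const
  add_mem' := fun h h' => Continuous.add h h'
  smul_mem' := fun a _ h => Continuous.const_smul h a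

end Hilbert

section Field

variable {n : ℕ} {F : Type*} [RCLike F]

/-- The maximal compact subgroup of a Levi subgroup: its orthogonal, respectively unitary,
matrices. -/
def maxCompact (F : Type*) [RCLike F] (b : Fin n → Fin n) : Subgroup (levi F b) where
  carrier := {g | ((g : G n F) : Matrix (Fin n) (Fin n) F) ∈ Matrix.unitaryGroup (Fin n) F}
  one_mem' := by simp [one_mem]
  mul_mem' := by
    intro x y hx hy
    simpa using mul_mem hx hy
  inv_mem' := by
    intro x hx
    have h : (((x⁻¹ : levi F b) : G n F) : Matrix (Fin n) (Fin n) F) =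
        star ((x : G n F) : Matrix (Fin n) (Fin n) F) := by
      rw [Subgroup.coe_inv]
      exact Units.inv_eq_of_mul_eq_one_left (Unitary.star_mul_self_of_mem hx)
    show (((x⁻¹ : levi F b) : G n F) : Matrix (Fin n) (Fin n) F) ∈ Matrix.unitaryGroup (Fin n) F
    rw [h]
    exact Unitary.star_mem hx

variable {V : Type*} [NormedAddCommGroup V] [InnerProductSpace ℂ V]
  {W : Type*} [NormedAddCommGroup W] [InnerProductSpace ℂ W]

/-- The `(𝔤, K)`-module of the normalised parabolic induction of `ν^α τ` from `levi F c` to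
`levi F b`: the continuous `K`-finite functions in the induced space. Both `K` and `𝔤` act by right
translation. -/
def ind (b c : Fin n → Fin n) (α : Fin n → ℝ) (τ : Representation ℂ (levi F c) W) :
    Submodule ℂ (levi F b → W) :=
  covFns b c α τ ⊓ contFns (levi F b) W ⊓ kFin (maxCompact F b) (rightReg (levi F b) W)

/-- Tempered representations of `levi F b`, realised unitarily: irreducible and infinitesimally
equivalent to `ind δ` with `δ` a square integrable representation of a standard Levi subgroup. -/
def IsTempered (b : Fin n → Fin n) (τ : Representation ℂ (levi F b) V) : Prop :=
  IsIrredAdm (maxCompact F b) τ ∧ IsUnitary τ ∧ ∃ c, Refines c b ∧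
    ∃ (W : Type) (_ : NormedAddCommGroup W) (_ : InnerProductSpace ℂ W) (_ : CompleteSpace W)
      (δ : Representation ℂ (levi F c) W),
      IsSquareIntegrable (maxCompact F c) δ ∧
      ∃ e : kFin (maxCompact F b) τ ≃ₗ[ℂ] ind b c 0 δ,
        (∀ k ∈ maxCompact F b, ∀ v v' : kFin (maxCompact F b) τ, (v' : V) = τ k v →
          ∀ x, (e v' : levi F b → W) x = (e v : levi F b → W) (x * k)) ∧
        ∀ (γ : OnePar (levi F b)) (v v' : kFin (maxCompact F b) τ), IsDeriv τ γ (v : V) v' →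
          IsFunDeriv γ (e v : levi F b → W) (e v')

variable [NeZero n]

/-- The space of `K`-finite vectors of a representation of `GL_n(F)`. -/
abbrev kVec (π : Representation ℂ (G n F) V) : Submodule ℂ V :=
  kFin (maxCompact F (0 : Fin n → Fin n)) (resLevi 0 π)

/-- `p` exhibits the `(𝔤, K)`-module of `π` as a quotient of that parabolically induced from
`ν^α τ`. If `τ` is tempered, `α` is strictly decreasing and `π` is irreducible, this says that
`π` is the Langlands quotient. -/
def IsQuotientMap (b : Fin n → Fin n) (α : Fin n → ℝ) (τ : Representation ℂ (levi F b) W)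
    (π : Representation ℂ (G n F) V) (p : ind 0 b α τ →ₗ[ℂ] kVec π) : Prop :=
  Function.Surjective p ∧
  (∀ k ∈ maxCompact F (0 : Fin n → Fin n), ∀ f f' : ind 0 b α τ,
    (∀ x, f'.1 x = f.1 (x * k)) → (p f' : V) = π k (p f)) ∧
  ∀ (γ : OnePar (levi F (0 : Fin n → Fin n))) (f f' : ind 0 b α τ),
    IsFunDeriv γ f.1 f'.1 → IsDeriv (resLevi 0 π) γ (p f : V) (p f')

end Field

section Ext

variable {n : ℕ} {F E : Type*} [RCLike F] [RCLike E] [Algebra F E]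
  {V : Type*} [NormedAddCommGroup V] [InnerProductSpace ℂ V]
  {W : Type*} [NormedAddCommGroup W] [InnerProductSpace ℂ W]

/-- Whittaker functionals on the smooth vectors of a representation of a Levi subgroup. -/
def IsWhittaker (b : Fin n → Fin n) (ψ : AddChar E Circle) (τ : Representation ℂ (levi E b) W)
    (ℓ : Module.Dual ℂ (smoothVec τ)) : Prop :=
  IsContFunctional τ ℓ ∧ ∀ u : levi E b, IsUnip id (u : G n E) →
    ∀ w w' : smoothVec τ, (w' : W) = τ u w → ℓ w' = thetaChar ψ (u : G n E) * ℓ w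

/-- The unitary representation `τ` is generic, and `I` is the isomorphism `τ ≃ τ^σ` inducing the
identity on the line of Whittaker functionals. -/
def IsGenericOp (σ : E ≃ₐ[F] E) (ψ : AddChar F Circle) (b : Fin n → Fin n)
    (τ : Representation ℂ (levi E b) W) (I : W →L[ℂ] W) : Prop :=
  (∃ ℓ, ℓ ≠ 0 ∧ IsWhittaker b (psiE E ψ) τ ℓ ∧
    ∀ ℓ', IsWhittaker b (psiE E ψ) τ ℓ' → ∃ a : ℂ, ℓ' = a • ℓ) ∧
  Function.Bijective I ∧ (∀ g w, I (τ g w) = τ (galLevi σ b g) (I w)) ∧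
  ∀ ℓ, IsWhittaker b (psiE E ψ) τ ℓ → ∀ w w' : smoothVec τ, (w' : W) = I w → ℓ w' = ℓ w

/-- The character identity `χ_{P,σ}(g) = χ_π(𝒩 g)` for all `σ`-regular semisimple `g`, for
representations of Levi subgroups and the twisted character formed with the operator `J`. -/
def CharIdentity (σ : E ≃ₐ[F] E) (b : Fin n → Fin n) (π : Representation ℂ (levi F b) V)
    (P : Representation ℂ (levi E b) W)
    (J : kFin (maxCompact E b) P →ₗ[ℂ] kFin (maxCompact E b) P) : Prop :=
  ∃ (Θ : levi F b → ℂ) (Θ' : levi E b → ℂ),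
    IsCharFn (maxCompact F b) π LinearMap.id {y | IsRegular b (y : G n F)} Θ ∧
    IsCharFn (maxCompact E b) P J (sigmaRegular σ b) Θ' ∧
    ∀ (g : levi E b) (y : levi F b), IsNorm σ b g y → IsRegular b (y : G n F) → Θ' g = Θ y

variable [NeZero n]

/-- `J` is the normalised `σ`-intertwining operator (on `K`-finite vectors) of the irreducible
representation `P` of `GL_n(E)`: `P` is the Langlands quotient of the representation induced
from `ν^α τ`, with `τ` tempered and `σ`-stable, and `J` is induced on this quotient by the operator
`f ↦ I ∘ f ∘ σ⁻¹`, where `I` is the normalised operator of the generic representation `τ`. -/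
def IsNormalizedOp (σ : E ≃ₐ[F] E) (ψ : AddChar F Circle) (P : Representation ℂ (G n E) V)
    (J : kVec P →ₗ[ℂ] kVec P) : Prop :=
  IsIrredAdm (maxCompact E (0 : Fin n → Fin n)) (resLevi 0 P) ∧
  ∃ (b : Fin n → Fin n) (α : Fin n → ℝ), Monotone b ∧ StrictlyDecreasing b α ∧
    ∃ (W : Type) (_ : NormedAddCommGroup W) (_ : InnerProductSpace ℂ W) (_ : CompleteSpace W)
      (τ : Representation ℂ (levi E b) W) (I : W →L[ℂ] W),
      IsTempered b τ ∧ IsGenericOp σ ψ b τ I ∧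
      ∃ p : ind 0 b α τ →ₗ[ℂ] kVec P, IsQuotientMap b α τ P p ∧
        ∀ f : ind 0 b α τ, ∃ f' : ind 0 b α τ,
          (∀ x, f'.1 (galLevi σ 0 x) = I (f.1 x)) ∧
          p f' = J (p f)

/-- `P` and `π` verify the Shintani relation. -/
def ShintaniRelation (σ : E ≃ₐ[F] E) (ψ : AddChar F Circle) (π : Representation ℂ (G n F) V)
    (P : Representation ℂ (G n E) W) : Prop :=
  ∃ J : kVec P →ₗ[ℂ] kVec P, IsNormalizedOp σ ψ P J ∧
    CharIdentity σ 0 (resLevi 0 π) (resLevi 0 P) J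

/-- `P` is the base change of `π`: there are tempered representations `τ`, `τ'` of a standard Levi
subgroup over `F` and over `E`, with `τ'` `σ`-stable, that verify the Shintani relation, and
exponents `α` in standard order, such that `π` and `P` are the Langlands quotients attached to
`ν^α τ` and `ν^α τ'`. The operator `J` is the restriction of `I` to `K`-finite vectors. -/
def IsBaseChange (σ : E ≃ₐ[F] E) (ψ : AddChar F Circle) (π : Representation ℂ (G n F) V)
    (P : Representation ℂ (G n E) W) : Prop :=
  IsIrredAdm (maxCompact F (0 : Fin n → Fin n)) (resLevi 0 π) ∧
  IsIrredAdm (maxCompact E (0 : Fin n → Fin n)) (resLevi 0 P) ∧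
  ∃ (b : Fin n → Fin n) (α : Fin n → ℝ), Monotone b ∧ StrictlyDecreasing b α ∧
    ∃ (U : Type) (_ : NormedAddCommGroup U) (_ : InnerProductSpace ℂ U) (_ : CompleteSpace U)
      (τ : Representation ℂ (levi F b) U)
      (U' : Type) (_ : NormedAddCommGroup U') (_ : InnerProductSpace ℂ U') (_ : CompleteSpace U')
      (τ' : Representation ℂ (levi E b) U'),
      IsTempered b τ ∧ IsTempered b τ' ∧
      (∃ (I : U' →L[ℂ] U')
        (J : kFin (maxCompact E b) τ' →ₗ[ℂ] kFin (maxCompact E b) τ'),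
        IsGenericOp σ ψ b τ' I ∧ (∀ v, (J v : U') = I v) ∧ CharIdentity σ b τ τ' J) ∧
      (∃ p, IsQuotientMap b α τ π p) ∧ ∃ p, IsQuotientMap b α τ' P p

/-- `P` is a Shintani lift of `π`: it is the base change of `π`, and the Shintani relation
holds. -/
def IsShintaniLift (σ : E ≃ₐ[F] E) (ψ : AddChar F Circle) (π : Representation ℂ (G n F) V)
    (P : Representation ℂ (G n E) W) : Prop :=
  IsBaseChange σ ψ π P ∧ ShintaniRelation σ ψ π P

end Ext

end Arch

end Shintani

end

noncomputable section

namespace Shintani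

/-! ### Rational forms of semilinear-invariant endomorphisms -/

section RationalForm

open Polynomial

/-! Two facts carry the result: the trivial representation of `GL_n(E)` is a Shintani lift of that
of `GL_n(F)`, and Shintani lifts survive the twist by a pair `χ`, `χ_E`. A character is a twist of
the trivial representation, so (a) and (c) follow once `χ_E` is known to exist.

The character `χ_E`. A character of `GL_n` over an infinite field factors through the determinant
(`map_eq_map_dilation_det`), and an element `y` of the norm class of `g` satisfies `det y =
N_{E/F}(det g)` (`det_of_isNorm`). So `χ_E` is `χ` composed with a section of the determinant, the
field norm and the determinant. That the norm class is non-empty is a statement on rational forms: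
`v ↦ g σ(v)` is a semilinear bijection of `E^n` commuting with `Ng`, and an endomorphism commuting
with such a map has a matrix over `F` in some basis (`isRationalEnd_of_semilinear`), because its
primary components can be grouped along Galois orbits of irreducible polynomials, and the product
over an orbit has coefficients in `F`.

Twisting. Write `χ = |det|^s χ₀` with `χ₀` unitary. Multiplication of functions by `χ` identifies
the twist of the representation induced from `ν^α τ` with the one induced from `ν^{α+s} χ₀τ`; here
`χ₀τ` is again tempered and the exponents keep their order. Over `E` the same `s` occurs because
`|x|_E = |N x|_F` (`normAbs_eq_normAbs_norm`). Whittaker functionals do not change, since characters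
are trivial on unipotent elements; intertwining operators do not change, since `χ_E` is
`σ`-invariant; and the two character functions are multiplied by values that agree along norms.

The trivial representation. It is a quotient of the representation induced from the trivial
character of the diagonal torus with the exponents `halfSum`. With the normalising factor, the
functions in that space satisfy `f(bg) = δ(b) f(g)` for the modulus `δ` of the Borel subgroup `B`,
and the quotient map is integration over `B\G`, realised as `∫ η f` with a compactly supported
weight `η` whose averages over the cosets of `B` are `1`. Right invariance rests on the modulus of
`B` (`isModulus_borelModulus`) and on the unimodularity of `GL_n`. The automorphism `σ` multiplies
this functional by a non-negative scalar some power of which is `1`, hence fixes it, and so the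
normalised operator is the identity.

Part (b). An unramified character is determined by its value at a uniformiser, hence is some
`|det|^z`, and `|det|_F^z` is sent to `|det|_E^z`. -/

theorem exists_cyclic_decomposition {R M : Type*} [CommRing R] [IsDomain R]
    [IsPrincipalIdealRing R] [AddCommGroup M] [Module R M] [Module.Finite R M] {p : R}
    (hp : Irreducible p) {k : ℕ} (hM : ∀ m : M, p ^ k • m = 0) :
    ∃ (d : ℕ) (e : Fin d → ℕ) (w : Fin d → M), (∀ m, ∃ f : Fin d → R, m = ∑ j, f j • w j) ∧
      (∀ j, p ^ e j • w j = 0) ∧ ∀ f : Fin d → R, ∑ j, f j • w j = 0 → ∀ j, p ^ e j ∣ f j := by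
  obtain ⟨d, e, ⟨φ⟩⟩ := Module.torsion_by_prime_power_decomposition (M := M) hp
    (fun {m} => ⟨⟨p ^ k, k, rfl⟩, hM m⟩)
  -- The structure theorem is recast through generators and their relations, a form that can be
  -- transported along a semilinear map.
  let w : Fin d → M := fun j => φ.symm (DirectSum.of _ j (Submodule.Quotient.mk 1))
  have hw : ∀ f : Fin d → R, φ (∑ j, f j • w j) =
      ∑ j, DirectSum.of (fun i => R ⧸ R ∙ p ^ e i) j (Submodule.Quotient.mk (f j)) := by
    intro f
    rw [map_sum]
    refine Finset.sum_congr rfl fun j _ => ?_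
    rw [map_smul, LinearEquiv.apply_symm_apply]
    change f j • DirectSum.lof R (Fin d) (fun i => R ⧸ R ∙ p ^ e i) j _ =
      DirectSum.lof R (Fin d) (fun i => R ⧸ R ∙ p ^ e i) j _
    rw [← map_smul, ← Submodule.Quotient.mk_smul, smul_eq_mul, mul_one]
  have happ : ∀ (f : Fin d → R) (j : Fin d), φ (∑ j, f j • w j) j = Submodule.Quotient.mk (f j) := by
    intro f j
    rw [hw, DFinsupp.finsetSum_apply, Finset.sum_eq_single j]
    · exact DirectSum.of_eq_same _ _
    · intro i _ hij
      exact DirectSum.of_eq_of_ne _ _ _ (Ne.symm hij)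
    · simp
  refine ⟨d, e, w, fun m => ?_, fun j => ?_, fun f hf j => ?_⟩
  · choose f hf using fun j => Submodule.Quotient.mk_surjective (R ∙ p ^ e j) (φ m j)
    refine ⟨f, φ.injective (DFinsupp.ext fun j => ?_)⟩
    rw [happ, hf]
  · apply φ.injective
    rw [map_smul, LinearEquiv.apply_symm_apply, map_zero]
    change p ^ e j • DirectSum.lof R (Fin d) (fun i => R ⧸ R ∙ p ^ e i) j _ = 0
    rw [← map_smul, ← Submodule.Quotient.mk_smul, smul_eq_mul, mul_one,
      (Submodule.Quotient.mk_eq_zero _).2 (Submodule.mem_span_singleton_self _), map_zero]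
  · have := happ f j
    rw [hf, map_zero, eq_comm, DirectSum.zero_apply, Submodule.Quotient.mk_eq_zero,
      Submodule.mem_span_singleton] at this
    obtain ⟨a, ha⟩ := this
    exact ⟨a, by rw [← ha, smul_eq_mul, mul_comm]⟩

theorem semilinear_pow {R M : Type*} [CommRing R] [AddCommGroup M] [Module R M] {s : RingAut R}
    {Φ : AddAut M} (hΦ : ∀ (a : R) m, Φ (a • m) = s a • Φ m) (i : ℕ) (a : R) (m : M) :
    (i • Φ) (a • m) = (s ^ i) a • (i • Φ) m := by
  induction i with
  | zero => simp
  | succ i ih => rw [pow_succ', succ_nsmul', AddAut.add_apply, ih, hΦ]; rfl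

/-- The module is the direct sum of its primary components at the pairwise coprime `s^i p`, and
`Φ^i` carries the component at `p` to the one at `s^i p`. If the `w j` generate the cyclic summands
of the component at `p`, then `u j = ∑ Φ^i (w j)` spans, by the Chinese remainder theorem, one
cyclic module for the whole orbit, and its annihilator is a power of the orbit product. -/
theorem exists_cyclic_decomposition_of_orbit {R M : Type*} [CommRing R] [IsDomain R]
    [IsPrincipalIdealRing R] [AddCommGroup M] [Module R M] [Module.Finite R M]
    {s : RingAut R} {Φ : AddAut M} (hΦ : ∀ (a : R) m, Φ (a • m) = s a • Φ m) {p : R}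
    (hp : Irreducible p) {r k : ℕ} (hr : 0 < r)
    (hcop : ∀ i < r, ∀ j < r, i ≠ j → IsCoprime ((s ^ i) p) ((s ^ j) p))
    (hM : ∀ m : M, (∏ i ∈ Finset.range r, (s ^ i) p) ^ k • m = 0) :
    ∃ (d : ℕ) (e : Fin d → ℕ) (u : Fin d → M), (∀ m, ∃ f : Fin d → R, m = ∑ j, f j • u j) ∧
      (∀ j, (∏ i ∈ Finset.range r, (s ^ i) p) ^ e j • u j = 0) ∧
      ∀ f : Fin d → R, ∑ j, f j • u j = 0 →
        ∀ j, (∏ i ∈ Finset.range r, (s ^ i) p) ^ e j ∣ f j := by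
  classical
  let N : Submodule R M := Submodule.torsionBy R M (p ^ k)
  obtain ⟨d, e, w, hw1, hw2, hw3⟩ := exists_cyclic_decomposition (M := N) hp (k := k)
    (fun m => Submodule.smul_torsionBy _ m)
  have hcopk : ∀ e : ℕ, ((Finset.range r : Finset ℕ) : Set ℕ).Pairwise
      (Function.onFun IsCoprime fun i => (s ^ i) p ^ e) := by
    intro e i hi j hj hij
    exact (hcop i (by simpa using hi) j (by simpa using hj) hij).pow
  obtain ⟨μ, hμ⟩ := (exists_sum_eq_one_iff_pairwise_coprime (s := fun i => (s ^ i) p ^ k)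
    (t := Finset.range r) ⟨0, by simpa using hr⟩).2 (by
      intro i j hij
      exact hcopk k i.2 j.2 (fun h => hij (Subtype.ext h)))
  -- The elements `c i` have sum `1`, and `c i` is divisible by `(s^j p)^k` for `j ≠ i`;
  -- multiplication by `c i` is the projection onto the component at `s^i p`.
  let c : ℕ → R := fun i => μ i * ∏ j ∈ Finset.range r \ {i}, (s ^ j) p ^ k
  have hc0 : ∀ i, ∀ j ∈ Finset.range r, j ≠ i → (s ^ j) p ^ k ∣ c i := by
    intro i j hj hij
    exact Dvd.dvd.mul_left (Finset.dvd_prod_of_mem (fun j => (s ^ j) p ^ k)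
      (by simp_all)) _
  have hc1 : ∀ i ∈ Finset.range r, ∀ m : M, (s ^ i) p ^ k • c i • m = 0 := by
    intro i hi m
    have hci : (s ^ i) p ^ k * c i = μ i * (∏ j ∈ Finset.range r, (s ^ j) p) ^ k := by
      rw [← Finset.prod_pow, ← Finset.mul_prod_erase _ _ hi]; simp only [c, Finset.sdiff_singleton_eq_erase]
      ring
    rw [← mul_smul, hci, mul_smul, hM, smul_zero]
  have hcw : ∀ i ∈ Finset.range r, ∀ i' ∈ Finset.range r, ∀ m ∈ N,
      c i • (i' • Φ) m = if i = i' then (i' • Φ) m else 0 := by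
    have key : ∀ i ∈ Finset.range r, ∀ i' ∈ Finset.range r, i' ≠ i → ∀ m ∈ N,
        c i • (i' • Φ) m = 0 := by
      intro i hi i' hi' hne m hm
      obtain ⟨a, ha⟩ := hc0 i i' hi' hne
      rw [ha, mul_comm, mul_smul, ← map_pow, ← semilinear_pow hΦ,
        (Submodule.mem_torsionBy_iff _ _).1 hm, map_zero, smul_zero]
    intro i hi i' hi' m hm
    split_ifs with h
    · subst h
      conv_rhs => rw [← one_smul R ((i • Φ) m), ← hμ, Finset.sum_smul]
      rw [Finset.sum_eq_single i]
      · intro j hj hji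
        exact key j hj i hi (Ne.symm hji) m hm
      · exact fun h => absurd hi h
    · exact key i hi i' hi' (Ne.symm h) m hm
  let u : Fin d → M := fun j => ∑ i ∈ Finset.range r, (i • Φ) (w j : M)
  have hcu : ∀ i ∈ Finset.range r, ∀ j, c i • u j = (i • Φ) (w j : M) := by
    intro i hi j
    rw [Finset.smul_sum, Finset.sum_eq_single i]
    · rw [hcw i hi i hi _ (w j).2, if_pos rfl]
    · intro i' hi' hne
      rw [hcw i hi i' hi' _ (w j).2, if_neg (Ne.symm hne)]
    · exact fun h => absurd hi h
  refine ⟨d, e, u, fun m => ?_, fun j => ?_, fun f hf j => ?_⟩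
  · have h1 : ∀ i, ∃ g : Fin d → R, i ∈ Finset.range r →
        c i • m = ∑ j, (g j * c i) • u j := by
      intro i
      by_cases hi : i ∈ Finset.range r
      · have hmem : (i • Φ).symm (c i • m) ∈ N := by
          rw [Submodule.mem_torsionBy_iff]
          apply (i • Φ).injective
          rw [semilinear_pow hΦ, AddEquiv.apply_symm_apply, map_pow, hc1 i hi, map_zero]
        obtain ⟨g, hg⟩ := hw1 ⟨_, hmem⟩
        refine ⟨fun j => (s ^ i) (g j), fun _ => ?_⟩
        have := congrArg (fun x : N => (i • Φ) (x : M)) hg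
        simp only [AddEquiv.apply_symm_apply, AddSubmonoidClass.coe_finsetSum,
          Submodule.coe_smul, map_sum, semilinear_pow hΦ] at this
        rw [this]
        refine Finset.sum_congr rfl fun j _ => ?_
        rw [mul_smul, hcu i hi]
      · exact ⟨0, fun h => absurd h hi⟩
    choose g hg using h1
    refine ⟨fun j => ∑ i ∈ Finset.range r, g i j * c i, ?_⟩
    simp_rw [Finset.sum_smul]
    rw [Finset.sum_comm, ← Finset.sum_congr rfl fun i hi => hg i hi, ← Finset.sum_smul]
    exact ((congrArg (· • m) hμ).trans (one_smul R m)).symm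
  · rw [Finset.smul_sum]
    refine Finset.sum_eq_zero fun i hi => ?_
    obtain ⟨a, ha⟩ : (s ^ i) p ∣ ∏ i ∈ Finset.range r, (s ^ i) p := Finset.dvd_prod_of_mem _ hi
    have h2 : p ^ e j • (w j : M) = 0 := by simpa using congrArg (Subtype.val) (hw2 j)
    rw [ha, mul_pow, mul_comm, mul_smul, ← map_pow, ← semilinear_pow hΦ, h2, map_zero,
      smul_zero]
  · rw [← Finset.prod_pow]
    refine Finset.prod_dvd_of_coprime (hcopk _) fun i hi => ?_
    have h3 : ∑ j, f j • (i • Φ) (w j : M) = 0 := by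
      rw [← smul_zero (c i), ← hf, Finset.smul_sum]
      refine Finset.sum_congr rfl fun j _ => ?_
      rw [smul_comm, hcu i hi]
    -- Projecting a relation between the `u j` by `c i` and pulling it back by `Φ^i` gives a
    -- relation between the `w j` with coefficients `s^{-i} (f j)`.
    have h4 : ∑ j, (s ^ i).symm (f j) • w j = 0 := by
      apply Subtype.ext
      apply (i • Φ).injective
      simp only [AddSubmonoidClass.coe_finsetSum, Submodule.coe_smul, map_sum,
        semilinear_pow hΦ, RingEquiv.apply_symm_apply, h3, ZeroMemClass.coe_zero, map_zero]
    have := map_dvd (s ^ i) (hw3 _ h4 j)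
    simpa using this

/-- An endomorphism that has a matrix with entries in `F` in a suitable `E`-basis. -/
def IsRationalEnd (F : Type*) {E V : Type*} [Field F] [Field E] [Algebra F E] [AddCommGroup V]
    [Module E V] (A : V →ₗ[E] V) : Prop :=
  ∃ (ι : Type) (_ : Fintype ι) (b : Module.Basis ι E V),
    ∀ i j, b.repr (A (b i)) j ∈ (algebraMap F E).range

variable {F E : Type*} [Field F] [Field E] [Algebra F E]

/-- The hypotheses say that `V` is the direct sum of the modules `E[X]/(Q j)`. In the basis `X^t
u_j` with `t < deg (Q j)` the endomorphism is a sum of companion matrices, whose entries are `0`,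
`1` and the negatives of coefficients of `Q j`. -/
theorem isRationalEnd_of_cyclic {V : Type*} [AddCommGroup V] [Module E V] (A : V →ₗ[E] V)
    {d : ℕ} (Q : Fin d → F[X]) (hQ : ∀ j, (Q j).Monic) (u : Fin d → V)
    (h1 : ∀ m, ∃ f : Fin d → E[X], m = ∑ j, aeval A (f j) (u j))
    (h2 : ∀ j, aeval A ((Q j).map (algebraMap F E)) (u j) = 0)
    (h3 : ∀ f : Fin d → E[X], ∑ j, aeval A (f j) (u j) = 0 →
      ∀ j, (Q j).map (algebraMap F E) ∣ f j) : IsRationalEnd F A := by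
  let Q' : Fin d → E[X] := fun j => (Q j).map (algebraMap F E)
  have hQ' : ∀ j, (Q' j).Monic := fun j => (hQ j).map _
  let N : Fin d → ℕ := fun j => (Q j).natDegree
  let T : (Π j, degreeLT E (N j)) →ₗ[E] V :=
    { toFun := fun f => ∑ j, aeval A (f j : E[X]) (u j)
      map_add' := fun f g => by simp [Finset.sum_add_distrib]
      map_smul' := fun a f => by simp [Finset.smul_sum] }
  have hdeg : ∀ j, (Q' j).degree = N j := fun j => by
    rw [degree_eq_natDegree (hQ' j).ne_zero, natDegree_map]
  have hT : Function.Bijective T := by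
    constructor
    · rw [← LinearMap.ker_eq_bot, LinearMap.ker_eq_bot']
      intro f hf
      funext j
      apply Subtype.ext
      by_contra hne
      have := degree_le_of_dvd (h3 _ hf j) hne
      have h4 := mem_degreeLT.1 (f j).2
      change (Q' j).degree ≤ _ at this
      rw [hdeg] at this
      exact absurd h4 (not_lt.2 this)
    · intro m
      obtain ⟨f, hf⟩ := h1 m
      refine ⟨fun j => ⟨f j %ₘ Q' j, mem_degreeLT.2 ?_⟩, ?_⟩
      · rw [← hdeg]; exact degree_modByMonic_lt _ (hQ' j)
      · rw [hf]
        change ∑ j, aeval A (f j %ₘ Q' j) (u j) = _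
        refine Finset.sum_congr rfl fun j _ => ?_
        conv_rhs => rw [← modByMonic_add_div (f j) (Q' j)]
        rw [map_add, mul_comm, map_mul, LinearMap.add_apply, Module.End.mul_apply, h2, map_zero,
          add_zero]
  let b0 : Module.Basis (Σ j, Fin (N j)) E (Π j, degreeLT E (N j)) :=
    Pi.basis fun j => degreeLT.basis E (N j)
  let b := b0.map (LinearEquiv.ofBijective T hT)
  have hb : ∀ j (t : Fin (N j)), b ⟨j, t⟩ = aeval A (X ^ (t : ℕ) : E[X]) (u j) := by
    intro j t
    have : b ⟨j, t⟩ = T (b0 ⟨j, t⟩) := rfl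
    rw [this]
    change ∑ i, aeval A ((b0 ⟨j, t⟩ i : degreeLT E (N i)) : E[X]) (u i) = _
    rw [Finset.sum_eq_single j]
    · simp [b0]
    · intro i _ hij
      simp [b0, Pi.basis_apply, Pi.single_eq_of_ne hij]
    · simp
  refine ⟨_, inferInstance, b, fun i => ?_⟩
  obtain ⟨j, t⟩ := i
  have hA : A (b ⟨j, t⟩) = aeval A (X ^ (t + 1 : ℕ) : E[X]) (u j) := by
    rw [hb, pow_succ', map_mul, aeval_X, Module.End.mul_apply]
  rcases Nat.lt_or_ge (t + 1) (N j) with h | h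
  · intro j'
    rw [hA, ← hb j ⟨t + 1, h⟩, Module.Basis.repr_self, Finsupp.single_apply]
    split_ifs
    · exact one_mem _
    · exact zero_mem _
  · have ht : (t : ℕ) + 1 = N j := le_antisymm t.2 h
    have hsum := (hQ j).as_sum
    have h5 : A (b ⟨j, t⟩) = -∑ i : Fin (N j), algebraMap F E ((Q j).coeff i) • b ⟨j, i⟩ := by
      rw [hA, ht]
      have h6 := h2 j
      rw [hsum] at h6
      rw [Polynomial.map_add, Polynomial.map_pow, map_X, map_add, LinearMap.add_apply] at h6
      rw [eq_neg_of_add_eq_zero_left h6, Polynomial.map_sum, map_sum, LinearMap.sum_apply,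
        Finset.sum_range]
      congr 1
      refine Finset.sum_congr rfl fun i _ => ?_
      rw [hb]
      simp [Polynomial.map_mul, Algebra.algebraMap_eq_smul_one]
    intro j'
    rw [h5, map_neg, map_sum, Finsupp.neg_apply, Finsupp.finsetSum_apply]
    refine neg_mem (sum_mem fun i _ => ?_)
    rw [map_smul, Module.Basis.repr_self, Finsupp.smul_apply, Finsupp.single_apply, smul_eq_mul]
    refine mul_mem ⟨_, rfl⟩ ?_
    split_ifs
    · exact one_mem _
    · exact zero_mem _

theorem IsRationalEnd.of_isCompl {V : Type*} [AddCommGroup V] [Module E V] {A : V →ₗ[E] V}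
    {U W : Submodule E V} (h : IsCompl U W) (hU : ∀ v ∈ U, A v ∈ U) (hW : ∀ v ∈ W, A v ∈ W)
    (h1 : IsRationalEnd F (A.restrict hU)) (h2 : IsRationalEnd F (A.restrict hW)) :
    IsRationalEnd F A := by
  obtain ⟨ι, _, b, hb⟩ := h1
  obtain ⟨κ, _, c, hc⟩ := h2
  let e := Submodule.prodEquivOfIsCompl U W h
  have hA : ∀ x : U × W, A (e x) = e (A.restrict hU x.1, A.restrict hW x.2) := by
    intro x
    simp [e, Submodule.coe_prodEquivOfIsCompl']
  refine ⟨ι ⊕ κ, inferInstance, (b.prod c).map e, ?_⟩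
  rintro (i | i) (j | j) <;>
    simp only [Module.Basis.map_apply, hA, Module.Basis.map_repr, LinearEquiv.trans_apply,
      LinearEquiv.symm_apply_apply] <;> simp [hb, hc, zero_mem]

end RationalForm

end Shintani

namespace Shintani

/-! ### Endomorphisms that commute with a semilinear automorphism -/

section RationalForm

open Polynomial

variable {F E : Type*} [Field F] [Field E] [Algebra F E]

theorem mem_range_algebraMap_of_fixed [FiniteDimensional F E] [IsGalois F E] {σ : E ≃ₐ[F] E}
    (hσ : ∀ s : E ≃ₐ[F] E, s ∈ Subgroup.zpowers σ) {x : E} (hx : σ x = x) :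
    x ∈ (algebraMap F E).range := by
  refine (IsGalois.mem_range_algebraMap_iff_fixed x).2 fun s => ?_
  have : Subgroup.zpowers σ ≤ MulAction.stabilizer (E ≃ₐ[F] E) x := by
    rw [Subgroup.zpowers_le]; exact hx
  exact this (hσ s)

/-- On `V` as an `E[X]`-module through `A`, the map `Φ` is semilinear for the action `s` on
polynomials. The orbit decomposition then has annihilators that are powers of the orbit product, and
these come from `F[X]`. -/
theorem isRationalEnd_of_aeval_pow_eq_zero {V : Type*} [AddCommGroup V] [Module E V]
    [FiniteDimensional E V] (A : Module.End E V) {s : RingAut E[X]} {Φ : AddAut V}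
    (hΦ : ∀ (f : E[X]) v, Φ (aeval A f v) = aeval A (s f) (Φ v)) {p : E[X]} (hp : Irreducible p)
    {r k : ℕ} (hr : 0 < r)
    (hcop : ∀ i < r, ∀ j < r, i ≠ j → IsCoprime ((s ^ i) p) ((s ^ j) p)) {P0 : F[X]}
    (hP0m : P0.Monic) (hP0 : P0.map (algebraMap F E) = ∏ i ∈ Finset.range r, (s ^ i) p)
    (hk : aeval A ((∏ i ∈ Finset.range r, (s ^ i) p) ^ k) = 0) : IsRationalEnd F A := by
  have hsm : ∀ (f : E[X]) (w : V), f • Module.AEval'.of A w = Module.AEval'.of A (aeval A f w) :=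
    fun f w => rfl
  let ΦM : AddAut (Module.AEval' A) := ((Module.AEval'.of A).toAddEquiv.symm.trans Φ).trans
    (Module.AEval'.of A).toAddEquiv
  have hΦM : ∀ w, ΦM (Module.AEval'.of A w) = Module.AEval'.of A (Φ w) := fun w => rfl
  obtain ⟨d, e, u, h1, h2, h3⟩ := exists_cyclic_decomposition_of_orbit (M := Module.AEval' A)
    (s := s) (Φ := ΦM) (p := p) (r := r) (k := k) (by
      intro f m
      obtain ⟨w, rfl⟩ := (Module.AEval'.of A).surjective m
      rw [hsm, hΦM, hΦM, hsm, hΦ]) hp hr hcop (by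
      intro m
      obtain ⟨w, rfl⟩ := (Module.AEval'.of A).surjective m
      rw [hsm, hk, LinearMap.zero_apply, map_zero])
  choose v hv using fun j => (Module.AEval'.of A).surjective (u j)
  have hsum : ∀ f : Fin d → E[X], ∑ j, f j • u j =
      Module.AEval'.of A (∑ j, aeval A (f j) (v j)) := by
    intro f
    rw [map_sum]
    refine Finset.sum_congr rfl fun j _ => ?_
    rw [← hv, hsm]
  have hmap : ∀ j, (P0 ^ e j).map (algebraMap F E) =
      (∏ i ∈ Finset.range r, (s ^ i) p) ^ e j := fun j => by
    rw [Polynomial.map_pow, hP0]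
  refine isRationalEnd_of_cyclic A (fun j => P0 ^ e j) (fun j => hP0m.pow _) v
    (fun m => ?_) (fun j => ?_) (fun f hf j => ?_)
  · obtain ⟨f, hf⟩ := h1 (Module.AEval'.of A m)
    exact ⟨f, (Module.AEval'.of A).injective (hf.trans (hsum f))⟩
  · have := h2 j
    rw [← hv, hsm] at this
    rw [hmap]
    exact (Module.AEval'.of A).injective (this.trans (map_zero _).symm)
  · rw [hmap]
    exact h3 f (by rw [hsum, hf, map_zero]) j

-- Induction on a bound for the dimension. For an irreducible factor `p` of the minimal polynomial,
-- the orbit product `P` is defined over `F`, and the Fitting decomposition of `P(A)` splits `V`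
-- into a kernel and a range, both stable under `A` and `Φ`. The kernel is a sum of cyclic modules
-- defined over `F`; the range is smaller because `p(A)` is not injective.
set_option maxHeartbeats 1000000 in
theorem isRationalEnd_of_semilinear [FiniteDimensional F E] [IsGalois F E] {σ : E ≃ₐ[F] E}
    (hσ : ∀ s : E ≃ₐ[F] E, s ∈ Subgroup.zpowers σ) (N : ℕ) :
    ∀ {V : Type*} [AddCommGroup V] [Module E V] [FiniteDimensional E V] (_ : Module.finrank E V ≤ N)
      (A : V →ₗ[E] V) (Φ : AddAut V) (_ : ∀ (a : E) v, Φ (a • v) = σ a • Φ v)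
      (_ : ∀ v, Φ (A v) = A (Φ v)), IsRationalEnd F A := by
  classical
  induction N with
  | zero =>
    intro V _ _ _ hN A Φ _ _
    have := Module.finrank_zero_iff.1 (Nat.le_zero.1 hN)
    refine ⟨_, inferInstance, Module.Basis.empty (ι := Empty) V, fun i => i.elim⟩
  | succ N ih =>
    intro V _ _ _ hN A Φ hΦ hA
    rcases subsingleton_or_nontrivial V with hV | hV
    · refine ⟨_, inferInstance, Module.Basis.empty (ι := Empty) V, fun i => i.elim⟩
    have hmin : ¬IsUnit (minpoly E A) := minpoly.not_isUnit E A
    obtain ⟨p, hpm, hpi, hpd⟩ := Polynomial.exists_monic_irreducible_factor _ hmin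
    let s : RingAut E[X] := Polynomial.mapEquiv (σ : E ≃+* E)
    have hs : ∀ f : E[X], s f = f.map (σ : E →+* E) := fun f => rfl
    have hΦA : ∀ (f : E[X]) v, Φ (aeval A f v) = aeval A (s f) (Φ v) := by
      intro f v
      induction f using Polynomial.induction_on' with
      | add f g hf hg => simp [hf, hg]
      | monomial n a =>
        have hpow : ∀ n v, Φ ((A ^ n) v) = (A ^ n) (Φ v) := by
          intro n
          induction n with
          | zero => simp
          | succ n ih => intro v; rw [pow_succ, Module.End.mul_apply, ih, hA]; rfl
        simp [hs, aeval_monomial, Algebra.algebraMap_eq_smul_one, hΦ, hpow]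
    have hs_pow : ∀ (i : ℕ) (f : E[X]), (s ^ i) f = s^[i] f := by
      intro i f
      induction i with
      | zero => rfl
      | succ i ih => rw [pow_succ', Function.iterate_succ_apply', ← ih]; rfl
    -- The orbit of `p` is finite because `σ` has finite order. The minimal period `r` counts its
    -- distinct members, which are coprime as distinct monic irreducible polynomials.
    have hper : p ∈ Function.periodicPts s := by
      obtain ⟨m, hm, h1⟩ := isOfFinOrder_iff_pow_eq_one.1 (isOfFinOrder_of_finite σ)
      refine ⟨m, hm, ?_⟩
      have h2 : ∀ (i : ℕ) (f : E[X]), s^[i] f = f.map ((σ ^ i : E ≃ₐ[F] E) : E →+* E) := by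
        intro i
        induction i with
        | zero => intro f; ext; simp
        | succ i ih => intro f; rw [Function.iterate_succ_apply', ih, hs, Polynomial.map_map,
                          pow_succ']; rfl
      change s^[m] p = p
      rw [h2, h1]
      ext; simp
    let r := Function.minimalPeriod s p
    have hr : 0 < r := Function.minimalPeriod_pos_of_mem_periodicPts hper
    have hmon : ∀ i, ((s ^ i) p).Monic := by
      intro i
      rw [hs_pow]
      induction i with
      | zero => exact hpm
      | succ i ih => rw [Function.iterate_succ_apply', hs]; exact ih.map _
    have hirr : ∀ i, Irreducible ((s ^ i) p) := fun i =>
      (MulEquiv.irreducible_iff (s ^ i).toMulEquiv).2 hpi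
    have hcop : ∀ i < r, ∀ j < r, i ≠ j → IsCoprime ((s ^ i) p) ((s ^ j) p) := by
      intro i hi j hj hij
      refine (hirr i).coprime_iff_not_dvd.2 fun hd => hij ?_
      have h1 : (s ^ i) p = (s ^ j) p := eq_of_monic_of_associated (hmon i) (hmon j)
        ((hirr i).associated_of_dvd (hirr j) hd)
      rw [hs_pow, hs_pow] at h1
      exact Function.iterate_injOn_Iio_minimalPeriod hi hj h1
    let P : E[X] := ∏ i ∈ Finset.range r, (s ^ i) p
    have hPm : P.Monic := monic_prod_of_monic _ _ fun i _ => hmon i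
    have hsP : s P = P := by
      -- Both sides are the product of `s^i p` over `0 ≤ i ≤ r`, because `s^r p = p`.
      have h1 : s P * p = P * p := by
        have h2 : s P = ∏ i ∈ Finset.range r, (s ^ (i + 1)) p := by
          simp only [P, map_prod]
          refine Finset.prod_congr rfl fun i _ => ?_
          rw [pow_succ']; rfl
        have h3 := Finset.prod_range_succ' (fun i => (s ^ i) p) r
        rw [Finset.prod_range_succ, hs_pow r p, Function.iterate_minimalPeriod] at h3
        rw [h2]
        exact h3.symm
      exact mul_right_cancel₀ hpm.ne_zero h1
    obtain ⟨P0, hP0⟩ : ∃ P0 : F[X], P0.map (algebraMap F E) = P := by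
      rw [← Polynomial.mem_lifts, Polynomial.lifts_iff_coeff_lifts]
      intro n
      refine mem_range_algebraMap_of_fixed hσ ?_
      conv_rhs => rw [← hsP, hs, coeff_map]
      rfl
    have hP0m : P0.Monic := by
      rw [← hP0] at hPm
      exact Polynomial.monic_of_injective (algebraMap F E).injective hPm
    obtain ⟨k, hk⟩ := (LinearMap.eventually_isCompl_ker_pow_range_pow (aeval A P)).exists_forall_of_atTop
    -- The exponent `k + 1` is positive even if the kernels stabilise at `k = 0`, so that `p`
    -- divides `P ^ (k + 1)`.
    have hcompl := hk (k + 1) (Nat.le_succ k)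
    rw [← map_pow] at hcompl
    have hcomm : ∀ (f : E[X]) v, A (aeval A f v) = aeval A f (A v) := by
      intro f v
      have : A * aeval A f = aeval A f * A := by
        have h := congrArg (aeval A) (mul_comm (X : E[X]) f)
        rwa [map_mul, map_mul, aeval_X] at h
      exact congrArg (fun T : Module.End E V => T v) this
    have hsPk : s (P ^ (k + 1)) = P ^ (k + 1) := by rw [map_pow, hsP]
    set B := aeval A (P ^ (k + 1)) with hB
    have hΦB : ∀ v, Φ (B v) = B (Φ v) := fun v => by rw [hB, hΦA, hsPk]
    have hkA : ∀ v ∈ LinearMap.ker B, A v ∈ LinearMap.ker B := by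
      intro v hv
      rw [LinearMap.mem_ker] at hv ⊢
      rw [hB, ← hcomm, ← hB, hv, map_zero]
    have hrA : ∀ v ∈ LinearMap.range B, A v ∈ LinearMap.range B := by
      rintro _ ⟨v, rfl⟩
      exact ⟨A v, (hcomm _ _).symm⟩
    have hkΦ : ∀ v, v ∈ LinearMap.ker B ↔ Φ v ∈ LinearMap.ker B := by
      intro v
      rw [LinearMap.mem_ker, LinearMap.mem_ker, ← hΦB, map_eq_zero_iff _ Φ.injective]
    have hrΦ : ∀ v, v ∈ LinearMap.range B ↔ Φ v ∈ LinearMap.range B := by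
      intro v
      constructor
      · rintro ⟨w, rfl⟩
        exact ⟨Φ w, (hΦB w).symm⟩
      · rintro ⟨w, hw⟩
        refine ⟨Φ.symm w, Φ.injective ?_⟩
        rw [hΦB, AddEquiv.apply_symm_apply, hw]
    have hrest : ∀ U : Submodule E V, (∀ v, v ∈ U ↔ Φ v ∈ U) →
        ∃ Φ' : AddAut U, ∀ v : U, (Φ' v : V) = Φ v := by
      intro U hU
      exact ⟨{ toFun := fun v => ⟨Φ v, (hU v).1 v.2⟩
               invFun := fun v => ⟨Φ.symm v, (hU _).2 (by rw [AddEquiv.apply_symm_apply]; exact v.2)⟩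
               left_inv := fun v => by simp
               right_inv := fun v => by simp
               map_add' := fun v w => by ext; simp }, fun v => rfl⟩
    refine IsRationalEnd.of_isCompl hcompl hkA hrA ?_ ?_
    · set W := LinearMap.ker B
      set A' : W →ₗ[E] W := A.restrict hkA
      obtain ⟨Φ', hΦ'⟩ := hrest W hkΦ
      have hA' : ∀ (f : E[X]) (w : W), (aeval A' f w : V) = aeval A f (w : V) := by
        intro f w
        induction f using Polynomial.induction_on' with
        | add f g hf hg => simp [hf, hg]
        | monomial n a =>
          have hpow : ∀ n (w : W), ((A' ^ n) w : V) = (A ^ n) (w : V) := by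
            intro n
            induction n with
            | zero => simp
            | succ n ih => intro w; rw [pow_succ, Module.End.mul_apply, ih, pow_succ]; rfl
          simp [aeval_monomial, Algebra.algebraMap_eq_smul_one, hpow]
      refine isRationalEnd_of_aeval_pow_eq_zero A' (s := s) (Φ := Φ') (fun f w => ?_) hpi hr hcop
        hP0m hP0 (k := k + 1) ?_
      · apply Subtype.ext
        rw [hΦ', hA', hA', hΦA, hΦ']
      · ext w
        rw [hA']
        exact LinearMap.mem_ker.1 w.2
    · obtain ⟨Φ', hΦ'⟩ := hrest _ hrΦ
      refine ih ?_ _ Φ' (fun a v => ?_) (fun v => ?_)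
      · have h1 := LinearMap.finrank_range_add_finrank_ker B
        have h2 : 0 < Module.finrank E (LinearMap.ker B) := by
          -- If `p(A)` were injective, the factor `p` could be cancelled from the minimal
          -- polynomial, leaving an annihilating polynomial of smaller degree.
          have hker : LinearMap.ker (aeval A p) ≠ ⊥ := by
            intro hbot
            obtain ⟨q, hq⟩ := hpd
            have h5 : aeval A q = 0 := by
              ext v
              apply LinearMap.ker_eq_bot.1 hbot
              have := congrArg (fun T : Module.End E V => T v) (minpoly.aeval E A)
              simp only [hq, map_mul, Module.End.mul_apply, LinearMap.zero_apply] at this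
              rw [this, LinearMap.zero_apply, map_zero]
            have hq0 : q ≠ 0 := by
              rintro rfl
              rw [mul_zero] at hq
              exact minpoly.ne_zero (Algebra.IsIntegral.isIntegral A) hq
            have h6 := minpoly.degree_le_of_ne_zero E A hq0 h5
            rw [hq, degree_mul, degree_eq_natDegree hpm.ne_zero, degree_eq_natDegree hq0] at h6
            have h7 := hpi.natDegree_pos
            have h8 : p.natDegree + q.natDegree ≤ q.natDegree := by exact_mod_cast h6
            omega
          rw [Module.finrank_pos_iff]
          refine Submodule.nontrivial_iff_ne_bot.2 fun hbot => hker ?_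
          rw [eq_bot_iff, ← hbot]
          intro v hv
          rw [LinearMap.mem_ker] at hv ⊢
          have hpP : (s ^ 0) p ∣ P :=
            Finset.dvd_prod_of_mem (fun i => (s ^ i) p) (Finset.mem_range.2 hr)
          rw [hs_pow, Function.iterate_zero_apply] at hpP
          obtain ⟨q, hq⟩ : p ∣ P ^ (k + 1) := hpP.trans (dvd_pow_self P (Nat.succ_ne_zero k))
          rw [hB, hq, mul_comm, map_mul, Module.End.mul_apply, hv, map_zero]
        omega
      · apply Subtype.ext
        rw [hΦ', Submodule.coe_smul, hΦ, Submodule.coe_smul, hΦ']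
      · apply Subtype.ext
        rw [hΦ', LinearMap.coe_restrict_apply, hA, LinearMap.coe_restrict_apply, hΦ']

end RationalForm

end Shintani

namespace Shintani

/-! ### Characters of `GL_n` factor through the determinant -/

section DetFactor

variable {n : ℕ} {F : Type*} [Field F]

/-- The diagonal matrix with entry `t` at place `i` and `1` elsewhere. -/
def dilation (i : Fin n) : Fˣ →* G n F where
  toFun t := ⟨Matrix.diagonal (Function.update 1 i (t : F)),
    Matrix.diagonal (Function.update 1 i ((t⁻¹ : Fˣ) : F)), by
      rw [Matrix.diagonal_mul_diagonal, ← Matrix.diagonal_one]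
      congr 1; ext j
      by_cases h : j = i
      · subst h; simp
      · simp [Function.update_of_ne h], by
      rw [Matrix.diagonal_mul_diagonal, ← Matrix.diagonal_one]
      congr 1; ext j
      by_cases h : j = i
      · subst h; simp
      · simp [Function.update_of_ne h]⟩
  map_one' := by ext; simp
  map_mul' s t := by
    ext1
    simp only [Units.val_mul, Matrix.diagonal_mul_diagonal]
    congr 1; ext j
    by_cases h : j = i
    · subst h; simp
    · simp [Function.update_of_ne h]

theorem coe_dilation (i : Fin n) (t : Fˣ) :
    (dilation i t : Matrix (Fin n) (Fin n) F) = Matrix.diagonal (Function.update 1 i (t : F)) := rfl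

theorem det_dilation (i : Fin n) (t : Fˣ) : Matrix.GeneralLinearGroup.det (dilation i t) = t := by
  ext
  rw [Matrix.GeneralLinearGroup.val_det_apply, coe_dilation, Matrix.det_diagonal,
    Finset.prod_update_of_mem (Finset.mem_univ i)]
  simp

theorem map_conj {H A : Type*} [Group H] [CommMonoid A] (χ : H →* A) (x y : H) :
    χ (x * y * x⁻¹) = χ y := by
  rw [map_mul, map_mul, mul_right_comm, ← map_mul, mul_inv_cancel, map_one, one_mul]

variable {A : Type*} [CommMonoid A] (χ : G n F →* A)

/-- Conjugation by a dilation turns the transvection with parameter `a` into the one with parameter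
`ta`, so those with parameter `(t - 1)a` are killed. In an infinite field some `t` differs from `0`
and `1`, and then `(t - 1)a` takes every value. -/
theorem map_eq_one_of_coe_eq_transvection [Infinite F] {i j : Fin n} (hij : i ≠ j) (c : F) (g : G n F)
    (hg : (g : Matrix (Fin n) (Fin n) F) = Matrix.transvection i j c) : χ g = 1 := by
  classical
  obtain ⟨t, ht⟩ := Infinite.exists_notMem_finset ({0, 1} : Finset F)
  simp only [Finset.mem_insert, Finset.mem_singleton, not_or] at ht
  obtain ⟨ht0, ht1⟩ := ht
  have hs : t - 1 ≠ 0 := sub_ne_zero.2 ht1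
  have hdet : ∀ c : F, (Matrix.transvection i j c).det ≠ 0 := fun c => by
    rw [Matrix.det_transvection_of_ne _ _ hij]; exact one_ne_zero
  let u : F → G n F := fun c => Matrix.GeneralLinearGroup.mkOfDetNeZero _ (hdet c)
  have hu : ∀ c, (u c : Matrix (Fin n) (Fin n) F) = Matrix.transvection i j c := fun c => rfl
  have hmul : ∀ a b, u (a + b) = u a * u b := fun a b => by
    ext1; rw [Units.val_mul, hu, hu, hu, Matrix.transvection_mul_transvection_same _ _ hij]
  have hconj : ∀ a, dilation i (Units.mk0 t ht0) * u a * (dilation i (Units.mk0 t ht0))⁻¹ =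
      u (t * a) := by
    intro a
    rw [mul_inv_eq_iff_eq_mul]
    ext p q
    rw [Units.val_mul, Units.val_mul, hu, hu, coe_dilation, Matrix.diagonal_mul,
      Matrix.mul_diagonal]
    simp only [Matrix.transvection, Matrix.add_apply, Matrix.one_apply, Matrix.single_apply,
      Function.update_apply]
    by_cases hp : p = i
    · subst hp
      by_cases hq : q = p
      · subst hq; simp [hij.symm]
      · by_cases hj : j = q
        · subst hj; simp [hij, hij.symm]
        · simp [hj, Ne.symm hq, hq]
    · by_cases hq : q = i
      · subst hq; simp [hp, Ne.symm hp]
      · simp [hp, hq, Ne.symm hp]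
  have hgu : g = u ((t * ((t - 1)⁻¹ * c)) + -((t - 1)⁻¹ * c)) := by
    ext1
    rw [hg, hu]
    congr 1
    field_simp
    ring
  have h1 : χ (u ((t - 1)⁻¹ * c)) * χ (u (-((t - 1)⁻¹ * c))) = 1 := by
    rw [← map_mul, ← hmul, add_neg_cancel]
    have : u 0 = 1 := by ext1; rw [hu]; simp
    rw [this, map_one]
  rw [hgu, hmul, map_mul, ← hconj, map_conj, h1]

theorem map_dilation_eq (i j : Fin n) (t : Fˣ) : χ (dilation i t) = χ (dilation j t) := by
  rcases eq_or_ne i j with rfl | hij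
  · rfl
  let w : G n F := ⟨(Equiv.swap i j).permMatrix F, (Equiv.swap i j).permMatrix F, by
    rw [← Matrix.permMatrix_mul]; simp, by rw [← Matrix.permMatrix_mul]; simp⟩
  have hw : w * dilation j t * w⁻¹ = dilation i t := by
    rw [mul_inv_eq_iff_eq_mul]
    ext p q
    rw [Units.val_mul, Units.val_mul, coe_dilation, coe_dilation, Matrix.mul_diagonal,
      Matrix.diagonal_mul]
    change (Equiv.swap i j).permMatrix F p q * _ = _ * (Equiv.swap i j).permMatrix F p q
    rw [Equiv.Perm.permMatrix, PEquiv.toMatrix_apply]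
    simp only [Equiv.toPEquiv_apply, Option.mem_some_iff]
    split_ifs with h
    · subst h
      rw [one_mul, mul_one]
      by_cases hp : p = i
      · subst hp; simp
      · rw [Function.update_of_ne hp, Function.update_of_ne]
        · simp
        · intro h; exact hp (by simpa using congrArg (Equiv.swap i j) h)
    · simp
  rw [← hw, map_conj]

/-- Invertible matrices are products of transvections, which are killed, and of diagonal matrices,
which are products of dilations that are conjugate under permutation matrices. The target is any
commutative monoid because the lemma is also applied to Haar moduli with values in the non-negative
reals. -/
theorem map_eq_map_dilation_det [Infinite F] (i : Fin n) (g : G n F) :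
    χ g = χ (dilation i (Matrix.GeneralLinearGroup.det g)) := by
  classical
  have key : ∀ M : Matrix (Fin n) (Fin n) F, M.det ≠ 0 → ∀ g : G n F,
      (g : Matrix (Fin n) (Fin n) F) = M →
      χ g = χ (dilation i (Matrix.GeneralLinearGroup.det g)) := by
    intro M hM
    refine Matrix.diagonal_transvection_induction_of_det_ne_zero
      (fun M => ∀ g : G n F, (g : Matrix (Fin n) (Fin n) F) = M →
        χ g = χ (dilation i (Matrix.GeneralLinearGroup.det g))) M hM ?_ ?_ ?_
    · intro D hD g hg
      rw [Matrix.det_diagonal, Finset.prod_ne_zero_iff] at hD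
      let d : Fin n → Fˣ := fun j => Units.mk0 (D j) (hD j (Finset.mem_univ j))
      have key : ∀ s : Finset (Fin n), ∀ g : G n F, (g : Matrix (Fin n) (Fin n) F) =
          Matrix.diagonal (fun j => if j ∈ s then D j else 1) →
          χ g = χ (dilation i (∏ j ∈ s, d j)) := by
        intro s
        induction s using Finset.induction_on with
        | empty =>
          intro g hg
          have : g = 1 := by ext1; simpa using hg
          simp [this]
        | insert a s ha ih =>
          intro g hg
          have h1 : g = dilation a (d a) * ((dilation a (d a))⁻¹ * g) := by group
          rw [h1, Finset.prod_insert ha, map_mul χ (dilation a (d a)), map_mul (dilation i),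
            map_mul χ (dilation i (d a)), map_dilation_eq χ a i]
          congr 1
          refine ih _ ?_
          rw [← map_inv, Units.val_mul, hg, coe_dilation, Matrix.diagonal_mul_diagonal]
          congr 1
          ext j
          by_cases hj : j = a
          · subst hj; simp [d, ha, hD]
          · simp [hj]
      rw [key Finset.univ g (by simpa using hg)]
      congr 2
      ext
      rw [Matrix.GeneralLinearGroup.val_det_apply, hg, Matrix.det_diagonal]
      simp [d]
    · intro t g hg
      have h1 : Matrix.GeneralLinearGroup.det g = 1 := by
        ext
        rw [Matrix.GeneralLinearGroup.val_det_apply, hg, Matrix.TransvectionStruct.det]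
        rfl
      rw [map_eq_one_of_coe_eq_transvection χ t.hij t.c g hg, h1, map_one, map_one]
    · intro A B hA hB ihA ihB g hg
      have h1 : g = Matrix.GeneralLinearGroup.mkOfDetNeZero A hA *
          Matrix.GeneralLinearGroup.mkOfDetNeZero B hB := by
        ext1; exact hg
      rw [h1, map_mul, map_mul Matrix.GeneralLinearGroup.det, map_mul (dilation i),
        map_mul χ, ihA _ rfl, ihB (Matrix.GeneralLinearGroup.mkOfDetNeZero B hB) rfl]
  exact key g (by rw [← Matrix.GeneralLinearGroup.val_det_apply]; exact Units.ne_zero _) g rfl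

end DetFactor

/-! ### The norm class -/

section NormClass

variable {n : ℕ} {F E : Type*} [Field F] [Field E] [Algebra F E]

theorem galGL_mul (s t : E ≃ₐ[F] E) (g : G n E) : galGL (s * t) g = galGL s (galGL t g) := by
  ext; rfl

theorem galGL_one (g : G n E) : galGL (1 : E ≃ₐ[F] E) g = g := by
  ext; rfl

theorem det_galGL (s : E ≃ₐ[F] E) (g : G n E) :
    ((galGL s g : G n E) : Matrix (Fin n) (Fin n) E).det =
      s (g : Matrix (Fin n) (Fin n) E).det := by
  exact ((s : E →+* E).map_det _).symm

theorem mem_levi_zero [NeZero n] (g : G n F) : g ∈ levi F (0 : Fin n → Fin n) :=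
  fun _ _ h => absurd rfl h

variable [FiniteDimensional F E] [IsGalois F E] {σ : E ≃ₐ[F] E}

theorem orderOf_eq_finrank (hσ : ∀ s : E ≃ₐ[F] E, s ∈ Subgroup.zpowers σ) :
    orderOf σ = Module.finrank F E := by
  rw [orderOf_eq_card_of_forall_mem_zpowers hσ, IsGalois.card_aut_eq_finrank]

theorem det_galNorm (hσ : ∀ s : E ≃ₐ[F] E, s ∈ Subgroup.zpowers σ) (g : G n E) :
    ((galNorm σ g : G n E) : Matrix (Fin n) (Fin n) E).det =
      algebraMap F E (Algebra.norm F (g : Matrix (Fin n) (Fin n) E).det) := by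
  have h1 : ((galNorm σ g : G n E) : Matrix (Fin n) (Fin n) E).det =
      ∏ i ∈ Finset.range (orderOf σ), (σ ^ i) (g : Matrix (Fin n) (Fin n) E).det := by
    rw [galNorm, ← orderOf_eq_finrank hσ]
    induction orderOf σ with
    | zero => simp
    | succ m ih =>
      rw [List.range_succ, List.map_append, List.prod_append, Finset.prod_range_succ, Units.val_mul,
        Matrix.det_mul, ih, List.map_singleton, List.prod_singleton, det_galGL]
  classical
  rw [h1, Algebra.norm_eq_prod_automorphisms]
  refine Finset.prod_bij (fun i _ => σ ^ i) (fun _ _ => Finset.mem_univ _) ?_ ?_ fun _ _ => rfl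
  · intro i hi j hj h
    exact pow_injOn_Iio_orderOf (by simpa using hi) (by simpa using hj) h
  · intro s _
    obtain ⟨k, hk, rfl⟩ := (mem_zpowers_iff_mem_range_orderOf.1 (hσ s) |> Finset.mem_image.1)
    exact ⟨k, hk, rfl⟩

theorem det_of_isNorm (hσ : ∀ s : E ≃ₐ[F] E, s ∈ Subgroup.zpowers σ) {b : Fin n → Fin n}
    {g : G n E} {y : G n F} (h : IsNorm σ b g y) :
    (y : Matrix (Fin n) (Fin n) F).det = Algebra.norm F (g : Matrix (Fin n) (Fin n) E).det := by
  obtain ⟨x, -, hx⟩ := h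
  apply (algebraMap F E).injective
  rw [← det_galNorm hσ, RingHom.map_det]
  have := congrArg (fun z : G n E => (z : Matrix (Fin n) (Fin n) E).det) hx
  simp only [Units.val_mul, Matrix.det_mul] at this
  change _ = ((algebraMap F E).mapMatrix (y : Matrix (Fin n) (Fin n) F)).det at this
  rw [← this, mul_right_comm, ← Matrix.det_mul, ← Units.val_mul, inv_mul_cancel]
  simp

/-- Both sides are the product of the `σ^i(g)` for `0 ≤ i ≤ l`, with the first or the last factor
split off, since `σ^l = 1`. -/
theorem galNorm_mul_galGL (hσ : ∀ s : E ≃ₐ[F] E, s ∈ Subgroup.zpowers σ) (g : G n E) :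
    g * galGL σ (galNorm σ g) = galNorm σ g * g := by
  have h1 : σ ^ Module.finrank F E = 1 := by rw [← orderOf_eq_finrank hσ, pow_orderOf_eq_one]
  have h2 : g * galGL σ (galNorm σ g) =
      ((List.range (Module.finrank F E + 1)).map fun i => galGL (σ ^ i) g).prod := by
    rw [List.range_succ_eq_map, List.map_cons, List.prod_cons, pow_zero, galGL_one, galNorm,
      map_list_prod, List.map_map, List.map_map]
    congr 3
    funext i
    simp only [Function.comp_apply, ← galGL_mul, ← pow_succ']
  rw [h2, List.range_succ, List.map_append, List.prod_append, List.map_singleton,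
    List.prod_singleton, h1, galGL_one, galNorm]

/-- The semilinear bijection `v ↦ g σ(v)` commutes with `Ng` because `g σ(Ng) = (Ng) g`. Hence `Ng`
has a matrix over `F` in some basis, and the change of basis is the conjugating element. -/
theorem exists_isNorm [NeZero n] (hσ : ∀ s : E ≃ₐ[F] E, s ∈ Subgroup.zpowers σ) (g : G n E) :
    ∃ y : G n F, IsNorm σ 0 g y := by
  classical
  let A : (Fin n → E) →ₗ[E] (Fin n → E) :=
    Matrix.toLin' (galNorm σ g : Matrix (Fin n) (Fin n) E)
  let S : AddAut (Fin n → E) :=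
    { toFun := fun v i => σ (v i)
      invFun := fun v i => σ.symm (v i)
      left_inv := fun v => by simp
      right_inv := fun v => by simp
      map_add' := fun v w => by ext; simp }
  have hS : ∀ (M : Matrix (Fin n) (Fin n) E) v,
      S (M.mulVec v) = (M.map σ).mulVec (S v) := by
    intro M v
    ext i
    simp [S, Matrix.mulVec, dotProduct]
  let Φ : AddAut (Fin n → E) :=
    { toFun := fun v => (g : Matrix (Fin n) (Fin n) E).mulVec (S v)
      invFun := fun v => S.symm (((g⁻¹ : G n E) : Matrix (Fin n) (Fin n) E).mulVec v)
      left_inv := fun v => by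
        beta_reduce; rw [Matrix.mulVec_mulVec, ← Units.val_mul, inv_mul_cancel]; simp
      right_inv := fun v => by
        beta_reduce; rw [AddEquiv.apply_symm_apply, Matrix.mulVec_mulVec, ← Units.val_mul, mul_inv_cancel]; simp
      map_add' := fun v w => by rw [map_add, Matrix.mulVec_add] }
  have hΦ : ∀ v, Φ v = (g : Matrix (Fin n) (Fin n) E).mulVec (S v) := fun v => rfl
  obtain ⟨ι, _, b, hb⟩ := isRationalEnd_of_semilinear hσ _ le_rfl A Φ (fun a v => by
      have : S (a • v) = σ a • S v := by ext; simp [S]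
      rw [hΦ, hΦ, this, Matrix.mulVec_smul]) (fun v => by
      rw [hΦ, hΦ, Matrix.toLin'_apply, Matrix.toLin'_apply, hS, Matrix.mulVec_mulVec,
        Matrix.mulVec_mulVec, ← Units.val_mul, ← galNorm_mul_galGL hσ]
      rfl)
  let e : ι ≃ Fin n := Fintype.equivOfCardEq (by
    rw [← Module.finrank_eq_card_basis b, Module.finrank_fin_fun, Fintype.card_fin])
  let c := b.reindex e
  have hc : ∀ i j, c.repr (A (c i)) j ∈ (algebraMap F E).range := fun i j => by
    simpa [c] using hb (e.symm i) (e.symm j)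
  let x : G n E := ⟨(Pi.basisFun E (Fin n)).toMatrix c, c.toMatrix (Pi.basisFun E (Fin n)),
    Module.Basis.toMatrix_mul_toMatrix_flip _ _, Module.Basis.toMatrix_mul_toMatrix_flip _ _⟩
  have hx : ((x⁻¹ * galNorm σ g * x : G n E) : Matrix (Fin n) (Fin n) E) =
      LinearMap.toMatrix c c A := by
    have h1 := basis_toMatrix_mul_linearMap_toMatrix_mul_basis_toMatrix
      (Pi.basisFun E (Fin n)) c (Pi.basisFun E (Fin n)) c A
    rw [LinearMap.toMatrix_eq_toMatrix', LinearMap.toMatrix'_toLin'] at h1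
    rw [Units.val_mul, Units.val_mul, ← h1]
    change (x⁻¹ : G n E).val * (x.val * LinearMap.toMatrix c c A * (x⁻¹ : G n E).val) * x.val = _
    rw [mul_assoc x.val, ← mul_assoc, ← mul_assoc, Units.inv_mul, one_mul, mul_assoc, Units.inv_mul,
      mul_one]
  choose Y hY using fun i j => hc j i
  have hYx : (Matrix.of Y).map (algebraMap F E) =
      ((x⁻¹ * galNorm σ g * x : G n E) : Matrix (Fin n) (Fin n) E) := by
    rw [hx]
    ext i j
    rw [LinearMap.toMatrix_apply]
    exact hY i j
  have hdet : (Matrix.of Y).det ≠ 0 := by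
    intro h0
    have h1 := (algebraMap F E).map_det (Matrix.of Y)
    rw [h0, map_zero, RingHom.mapMatrix_apply, hYx] at h1
    exact (Matrix.GeneralLinearGroup.det (x⁻¹ * galNorm σ g * x)).ne_zero h1.symm
  refine ⟨Matrix.GeneralLinearGroup.mkOfDetNeZero _ hdet, x, mem_levi_zero x, ?_⟩
  ext1
  exact hYx.symm

end NormClass

end Shintani

namespace Shintani

/-! ### The normalised absolute value -/

section NormAbs

open scoped Pointwise NNReal

variable {F : Type*} [NontriviallyNormedField F] [LocallyCompactSpace F]

theorem normAbs_of_ne_zero {x : F} (h : x ≠ 0) :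
    normAbs x = (distribHaarChar F (Units.mk0 x h) : ℝ) := by
  rw [normAbs, dif_neg h]

theorem normAbs_coe_units (x : Fˣ) : normAbs (x : F) = (distribHaarChar F x : ℝ) := by
  rw [normAbs_of_ne_zero x.ne_zero]; simp

theorem normAbs_pos {x : F} (h : x ≠ 0) : 0 < normAbs x := by
  rw [normAbs_of_ne_zero h]; exact_mod_cast distribHaarChar_pos

theorem normAbs_nonneg (x : F) : 0 ≤ normAbs x := by
  rcases eq_or_ne x 0 with rfl | h
  · simp [normAbs]
  · exact (normAbs_pos h).le

@[simp] theorem normAbs_one : normAbs (1 : F) = 1 := by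
  have := normAbs_coe_units (1 : Fˣ)
  rw [map_one] at this
  exact_mod_cast this

theorem normAbs_mul (x y : F) : normAbs (x * y) = normAbs x * normAbs y := by
  rcases eq_or_ne x 0 with rfl | hx
  · simp [normAbs]
  rcases eq_or_ne y 0 with rfl | hy
  · simp [normAbs]
  rw [normAbs_of_ne_zero hx, normAbs_of_ne_zero hy, normAbs_of_ne_zero (mul_ne_zero hx hy),
    Units.mk0_mul, map_mul, NNReal.coe_mul]

variable (F) in
/-- The normalised absolute value as a homomorphism. -/
def normAbsHom : F →* ℝ where
  toFun := normAbs
  map_one' := normAbs_one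
  map_mul' := normAbs_mul

theorem normAbs_inv (x : F) : normAbs x⁻¹ = (normAbs x)⁻¹ := by
  rcases eq_or_ne x 0 with rfl | hx
  · simp [normAbs]
  · exact eq_inv_of_mul_eq_one_left (by rw [← normAbs_mul, inv_mul_cancel₀ hx, normAbs_one])

theorem normAbs_prod {ι : Type*} (s : Finset ι) (f : ι → F) :
    normAbs (∏ i ∈ s, f i) = ∏ i ∈ s, normAbs (f i) :=
  map_prod (normAbsHom F) f s

theorem normAbs_zpow (x : F) (k : ℤ) : normAbs (x ^ k) = normAbs x ^ k := by
  have h : ∀ m : ℕ, normAbs (x ^ m) = normAbs x ^ m := map_pow (normAbsHom F) x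
  cases k with
  | ofNat m => simp [h]
  | negSucc m => rw [zpow_negSucc, zpow_negSucc, normAbs_inv, h]

theorem normAbs_mul_measure [MeasurableSpace F] [BorelSpace F] (μ : Measure F)
    [μ.IsAddHaarMeasure] [μ.Regular] {x : F} (hx : x ≠ 0) (s : Set F) :
    ENNReal.ofReal (normAbs x) * μ s = μ (x • s) := by
  rw [normAbs_of_ne_zero hx, ENNReal.ofReal_coe_nnreal, distribHaarChar_mul]
  rfl

theorem normAbs_le_of_smul_subset [MeasurableSpace F] [BorelSpace F] (μ : Measure F)
    [μ.IsAddHaarMeasure] [μ.Regular] {x : F} (hx : x ≠ 0) {s t : Set F} (hs : μ s ≠ 0)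
    (hs' : μ s ≠ ⊤) (h : x • s ⊆ t) : ENNReal.ofReal (normAbs x) ≤ μ t / μ s := by
  rw [ENNReal.le_div_iff_mul_le (Or.inl hs) (Or.inl hs'), normAbs_mul_measure μ hx]
  exact measure_mono h

theorem smul_closedBall_subset {F : Type*} [NontriviallyNormedField F] {x : F} (hx : ‖x‖ ≤ 1) :
    x • Metric.closedBall (0 : F) 1 ⊆ Metric.closedBall 0 1 := by
  rintro _ ⟨v, hv, rfl⟩
  rw [mem_closedBall_zero_iff] at hv ⊢
  simp only [smul_eq_mul, norm_mul]
  exact mul_le_one₀ hx (norm_nonneg _) hv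

variable (F) in
theorem measure_unitBall_ne [MeasurableSpace F] [BorelSpace F] (μ : Measure F)
    [μ.IsAddHaarMeasure] :
    μ (Metric.closedBall (0 : F) 1) ≠ 0 ∧ μ (Metric.closedBall (0 : F) 1) ≠ ⊤ := by
  have := ProperSpace.of_locallyCompactSpace F (E := F)
  exact ⟨(Metric.measure_closedBall_pos μ 0 one_pos).ne',
    (isCompact_closedBall (0 : F) 1).measure_lt_top.ne⟩

theorem normAbs_le_one {x : F} (hx : ‖x‖ ≤ 1) : normAbs x ≤ 1 := by
  rcases eq_or_ne x 0 with rfl | h0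
  · simp [normAbs]
  borelize F
  obtain ⟨h1, h2⟩ := measure_unitBall_ne F Measure.addHaar
  have := normAbs_le_of_smul_subset Measure.addHaar h0 h1 h2 (smul_closedBall_subset hx)
  rw [ENNReal.div_self h1 h2] at this
  simpa using this

theorem normAbs_eq_one_of_norm_eq_one {x : F} (hx : ‖x‖ = 1) : normAbs x = 1 := by
  refine le_antisymm (normAbs_le_one hx.le) ?_
  have h0 : x ≠ 0 := by rintro rfl; simp at hx
  have h1 : normAbs x⁻¹ ≤ 1 := normAbs_le_one (by rw [norm_inv, hx, inv_one])
  rw [normAbs_inv] at h1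
  exact (inv_le_one₀ (normAbs_pos h0)).1 h1

/-- Multiplication by `x` moves the unit ball into its thickening by `‖x - 1‖`, whose measure tends
to that of the ball as `x → 1`. This is the upper bound; applied to `x⁻¹` it gives the lower one. -/
theorem tendsto_normAbs_one : Tendsto (fun x : F => normAbs x) (𝓝 1) (𝓝 1) := by
  have := ProperSpace.of_locallyCompactSpace F (E := F)
  borelize F
  let μ : Measure F := Measure.addHaar
  obtain ⟨h1, h2⟩ := measure_unitBall_ne F μ
  set B := Metric.closedBall (0 : F) 1 with hB
  have hne : ∀ᶠ x : F in 𝓝 1, x ≠ 0 := isOpen_ne.mem_nhds one_ne_zero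
  have hlim : Tendsto (fun x : F => μ (Metric.cthickening ‖x - 1‖ B) / μ B) (𝓝 1) (𝓝 1) := by
    have h3 : Tendsto (fun x : F => ‖x - 1‖) (𝓝 1) (𝓝 0) := by
      have : Continuous fun x : F => ‖x - 1‖ := by fun_prop
      simpa using this.tendsto 1
    have h4 := (tendsto_measure_cthickening_of_isCompact (μ := μ)
      (isCompact_closedBall (0 : F) 1)).comp h3
    have h5 := ENNReal.Tendsto.div_const h4 (Or.inr h1)
    rw [← hB, ENNReal.div_self h1 h2] at h5
    exact h5
  have hub : ∀ᶠ x : F in 𝓝 1, ENNReal.ofReal (normAbs x) ≤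
      μ (Metric.cthickening ‖x - 1‖ B) / μ B := by
    filter_upwards [hne] with x hx
    refine normAbs_le_of_smul_subset μ hx h1 h2 ?_
    rintro _ ⟨v, hv, rfl⟩
    refine Metric.mem_cthickening_of_dist_le _ v _ _ hv ?_
    rw [hB, mem_closedBall_zero_iff] at hv
    have : x • v - v = (x - 1) * v := by rw [smul_eq_mul]; ring
    change dist (x • v) v ≤ _
    rw [dist_eq_norm, this, norm_mul]
    exact mul_le_of_le_one_right (norm_nonneg _) hv
  have hinv : Tendsto (fun x : F => x⁻¹) (𝓝 1) (𝓝 1) := by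
    simpa using (continuousAt_inv₀ (one_ne_zero (α := F))).tendsto
  rw [tendsto_order]
  constructor
  · intro a ha
    rcases le_or_gt a 0 with h0 | h0
    · filter_upwards [hne] with x hx using h0.trans_lt (normAbs_pos hx)
    have h6 : (1 : ENNReal) < ENNReal.ofReal a⁻¹ := by
      rw [← ENNReal.ofReal_one, ENNReal.ofReal_lt_ofReal_iff (inv_pos.2 h0)]
      exact (one_lt_inv₀ h0).2 ha
    filter_upwards [hinv.eventually hub, hinv.eventually (hlim.eventually_lt_const h6), hne]
      with x hx1 hx2 hx
    have h7 := hx1.trans_lt hx2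
    rw [ENNReal.ofReal_lt_ofReal_iff (inv_pos.2 h0), normAbs_inv] at h7
    exact (inv_lt_inv₀ (normAbs_pos hx) h0).1 h7
  · intro a ha
    have h6 : (1 : ENNReal) < ENNReal.ofReal a := by
      rw [← ENNReal.ofReal_one, ENNReal.ofReal_lt_ofReal_iff (one_pos.trans ha)]
      exact ha
    filter_upwards [hub, hlim.eventually_lt_const h6] with x hx1 hx2
    exact (ENNReal.ofReal_lt_ofReal_iff (one_pos.trans ha)).1 (hx1.trans_lt hx2)

theorem continuousAt_normAbs {x : F} (hx : x ≠ 0) : ContinuousAt (normAbs : F → ℝ) x := by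
  have h1 : (normAbs : F → ℝ) = fun y => normAbs x * normAbs (x⁻¹ * y) := by
    funext y
    rw [← normAbs_mul, mul_inv_cancel_left₀ hx]
  have h2 : Tendsto (fun y => x⁻¹ * y) (𝓝 x) (𝓝 1) := by
    have : Continuous fun y => x⁻¹ * y := by fun_prop
    simpa [inv_mul_cancel₀ hx] using this.tendsto x
  have h3 := (tendsto_normAbs_one.comp h2).const_mul (normAbs x)
  rw [mul_one] at h3
  rw [h1, ContinuousAt, inv_mul_cancel₀ hx, normAbs_one, mul_one]
  exact h3

theorem Continuous.normAbs {X : Type*} [TopologicalSpace X] {f : X → F} (hf : Continuous f)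
    (h0 : ∀ x, f x ≠ 0) : Continuous fun x => normAbs (f x) :=
  continuous_iff_continuousAt.2 fun x =>
    (continuousAt_normAbs (h0 x)).comp_of_eq hf.continuousAt rfl

end NormAbs

/-! ### Linear automorphisms scale Haar measures by the absolute value of the determinant -/

section Scaling

open scoped Pointwise NNReal

/-- The map `e` transports a Haar measure of `A` to one of `B`, and the two scaling factors can be
compared on a compact neighbourhood of `0`. This permits passing from a vector space to coordinates.
-/
theorem addEquivAddHaarChar_conj {A B : Type*} [AddCommGroup A] [TopologicalSpace A]
    [IsTopologicalAddGroup A] [LocallyCompactSpace A] [MeasurableSpace A] [BorelSpace A]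
    [AddCommGroup B] [TopologicalSpace B]
    [IsTopologicalAddGroup B] [LocallyCompactSpace B] [MeasurableSpace B] [BorelSpace B]
    (e : A ≃ₜ+ B) (φ : A ≃ₜ+ A) (ψ : B ≃ₜ+ B) (h : ∀ a, e (φ a) = ψ (e a)) :
    addEquivAddHaarChar φ = addEquivAddHaarChar ψ := by
  let μ : Measure A := Measure.addHaar
  let ν : Measure B := μ.map e
  have : ν.IsAddHaarMeasure := e.isAddHaarMeasure_map μ
  have : ν.Regular := Measure.Regular.map e.toHomeomorph
  have h1 : addEquivAddHaarChar φ • ν.map ψ = ν := by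
    have h2 := congrArg (Measure.map e) (addEquivAddHaarChar_smul_map μ φ)
    have me : Measurable e := e.continuous_toFun.measurable
    have mφ : Measurable φ := φ.continuous_toFun.measurable
    have mψ : Measurable ψ := ψ.continuous_toFun.measurable
    rw [Measure.map_smul, Measure.map_map me mφ] at h2
    rw [Measure.map_map mψ me]
    have h3 : (ψ ∘ e : A → B) = e ∘ φ := funext fun a => (h a).symm
    rw [h3]
    exact h2
  have h2 := addEquivAddHaarChar_smul_map ν ψ
  obtain ⟨K, hK, hK0⟩ := exists_compact_mem_nhds (0 : B)
  have h3 : ν K ≠ 0 := (Measure.measure_pos_of_mem_nhds ν hK0).ne'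
  have h4 : ν K ≠ ⊤ := hK.measure_lt_top.ne
  have h5 : (addEquivAddHaarChar φ : ENNReal) * ν.map ψ K =
      (addEquivAddHaarChar ψ : ENNReal) * ν.map ψ K := by
    have e1 := congrArg (fun m : Measure B => m K) h1
    have e2 := congrArg (fun m : Measure B => m K) h2
    exact e1.trans e2.symm
  have h6 : (addEquivAddHaarChar ψ : ENNReal) * ν.map ψ K = ν K :=
    congrArg (fun m : Measure B => m K) h2
  have h7 : ν.map ψ K ≠ 0 := by rintro h; rw [h, mul_zero] at h6; exact h3 h6.symm
  have h8 : ν.map ψ K ≠ ⊤ := by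
    rintro h
    rw [h, ENNReal.mul_top (by exact_mod_cast (addEquivAddHaarChar_pos ψ).ne')] at h6
    exact h4 h6.symm
  exact_mod_cast (ENNReal.mul_left_inj h7 h8).1 h5

variable {F : Type*} [NontriviallyNormedField F] [LocallyCompactSpace F]

/-- The action of an invertible matrix on column vectors. -/
def mulVecEquiv {n : ℕ} (g : G n F) : (Fin n → F) ≃ₜ+ (Fin n → F) where
  toFun v := (g : Matrix (Fin n) (Fin n) F).mulVec v
  invFun v := ((g⁻¹ : G n F) : Matrix (Fin n) (Fin n) F).mulVec v
  left_inv v := by beta_reduce; rw [Matrix.mulVec_mulVec, ← Units.val_mul, inv_mul_cancel]; simp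
  right_inv v := by beta_reduce; rw [Matrix.mulVec_mulVec, ← Units.val_mul, mul_inv_cancel]; simp
  map_add' v w := Matrix.mulVec_add _ _ _
  continuous_toFun := by fun_prop
  continuous_invFun := by fun_prop

/-- The scaling factor is a homomorphism on `GL_n`, hence determined by its values on dilations, and
a dilation rescales only one side of a product of unit balls. -/
theorem addEquivAddHaarChar_mulVecEquiv {n : ℕ} [MeasurableSpace (Fin n → F)]
    [BorelSpace (Fin n → F)] (g : G n F) :
    (addEquivAddHaarChar (mulVecEquiv g) : ℝ) = normAbs (g : Matrix (Fin n) (Fin n) F).det := by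
  let χ : G n F →* ℝ≥0 :=
    { toFun := fun g => addEquivAddHaarChar (mulVecEquiv g)
      map_one' := by
        rw [← addEquivAddHaarChar_refl (G := Fin n → F)]
        congr 1
        ext v : 1
        simp [mulVecEquiv]
      map_mul' := fun g h => by
        rw [mul_comm, ← addEquivAddHaarChar_trans]
        congr 1
        ext v : 1
        simp [mulVecEquiv, Matrix.mulVec_mulVec] }
  rcases Nat.eq_zero_or_pos n with rfl | hn
  · have : g = 1 := by ext i; exact i.elim0
    have h1 : χ g = 1 := by rw [this, map_one]
    change ((χ g : ℝ≥0) : ℝ) = _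
    rw [h1]; simp
  have : NeZero n := ⟨hn.ne'⟩
  have := ProperSpace.of_locallyCompactSpace F (E := F)
  have : SecondCountableTopology F := secondCountable_of_proper
  change ((χ g : ℝ≥0) : ℝ) = _
  rw [map_eq_map_dilation_det χ 0 g, ← Matrix.GeneralLinearGroup.val_det_apply]
  generalize Matrix.GeneralLinearGroup.det g = t
  borelize F
  -- The Borel structure on `F^n` is the product one because `F` is second countable; this makes the
  -- product measure available.
  have hm : (inferInstance : MeasurableSpace (Fin n → F)) = MeasurableSpace.pi := by
    rw [BorelSpace.measurable_eq (α := Fin n → F)]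
    exact (@BorelSpace.measurable_eq (Fin n → F) _ MeasurableSpace.pi _).symm
  subst hm
  let μ : Measure (Fin n → F) := Measure.pi fun _ => (Measure.addHaar : Measure F)
  let B := Metric.closedBall (0 : F) 1
  obtain ⟨h1, h2⟩ := measure_unitBall_ne F Measure.addHaar
  have hpre : mulVecEquiv (dilation 0 t : G n F) ⁻¹'
      (Set.univ.pi (Function.update (fun _ => B) 0 ((t : F) • B))) = Set.univ.pi fun _ => B := by
    ext v
    simp only [Set.mem_preimage, Set.mem_univ_pi]
    refine forall_congr' fun i => ?_
    have h3 : mulVecEquiv (dilation 0 t : G n F) v i =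
        Function.update (1 : Fin n → F) 0 (t : F) i * v i := by
      change (Matrix.mulVec (Matrix.diagonal _) v) i = _
      rw [Matrix.mulVec_diagonal]
    rw [h3]
    by_cases hi : i = 0
    · subst hi
      rw [Function.update_self, Function.update_self, ← smul_eq_mul,
        Set.smul_mem_smul_set_iff₀ t.ne_zero]
    · rw [Function.update_of_ne hi, Function.update_of_ne hi, Pi.one_apply, one_mul]
  have h4 := addEquivAddHaarChar_smul_preimage μ
    (X := Set.univ.pi (Function.update (fun _ => B) 0 ((t : F) • B)))
    (mulVecEquiv (dilation 0 t : G n F))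
  rw [hpre, Measure.pi_pi, Measure.pi_pi] at h4
  have h5 : ∏ i : Fin n, (Measure.addHaar : Measure F) (Function.update (fun _ => B) 0 ((t : F) • B) i) =
      ENNReal.ofReal (normAbs (t : F)) * ∏ _i : Fin n, (Measure.addHaar : Measure F) B := by
    rw [← Finset.mul_prod_erase _ _ (Finset.mem_univ (0 : Fin n)),
      ← Finset.mul_prod_erase _ (fun _ : Fin n => (Measure.addHaar : Measure F) B)
        (Finset.mem_univ (0 : Fin n)), Function.update_self,
      ← normAbs_mul_measure _ t.ne_zero, mul_assoc]
    congr 2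
    refine Finset.prod_congr rfl fun i hi => ?_
    rw [Function.update_of_ne (Finset.ne_of_mem_erase hi)]
  rw [h5, ENNReal.smul_def, smul_eq_mul, ENNReal.mul_left_inj
    (Finset.prod_ne_zero_iff.2 fun _ _ => h1) (ENNReal.prod_ne_top fun _ _ => h2)] at h4
  have h6 := congrArg ENNReal.toReal h4
  rw [ENNReal.toReal_ofReal (normAbs_nonneg _)] at h6
  exact h6

variable {V : Type*} [AddCommGroup V] [Module F V] [TopologicalSpace V] [IsTopologicalAddGroup V]
  [ContinuousSMul F V] [T2Space V] [FiniteDimensional F V] [LocallyCompactSpace V]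

theorem addEquivAddHaarChar_eq_normAbs_det [MeasurableSpace V] [BorelSpace V] (φ : V ≃ₜ+ V)
    (T : V →ₗ[F] V) (hT : ∀ v, φ v = T v) :
    (addEquivAddHaarChar φ : ℝ) = normAbs (LinearMap.det T) := by
  have := ProperSpace.of_locallyCompactSpace F (E := F)
  have : CompleteSpace F := inferInstance
  let n := Module.finrank F V
  let e : V ≃L[F] (Fin n → F) := ContinuousLinearEquiv.ofFinrankEq (by simp [n])
  let T' : (Fin n → F) →ₗ[F] (Fin n → F) := e.toLinearEquiv ∘ₗ T ∘ₗ e.symm.toLinearEquiv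
  have hdet : LinearMap.det T' = LinearMap.det T := LinearMap.det_conj T e.toLinearEquiv
  have hT0 : LinearMap.det T ≠ 0 := by
    have hb : Function.Bijective T := by
      have : (T : V → V) = φ := funext fun v => (hT v).symm
      rw [this]; exact φ.bijective
    have := LinearEquiv.isUnit_det' (LinearEquiv.ofBijective T hb)
    exact this.ne_zero
  have hM : (LinearMap.toMatrix' T').det ≠ 0 := by
    rw [LinearMap.det_toMatrix', hdet]; exact hT0
  let g : G n F := Matrix.GeneralLinearGroup.mkOfDetNeZero _ hM
  borelize (Fin n → F)
  have h := addEquivAddHaarChar_conj (A := V) (B := Fin n → F)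
    { e.toLinearEquiv.toAddEquiv with
      continuous_toFun := e.continuous
      continuous_invFun := e.symm.continuous } φ (mulVecEquiv g) (fun a => by
      change e (φ a) = (LinearMap.toMatrix' T').mulVec (e a)
      rw [LinearMap.toMatrix'_mulVec, hT]
      simp [T'])
  rw [h, addEquivAddHaarChar_mulVecEquiv]
  change normAbs (LinearMap.toMatrix' T').det = _
  rw [LinearMap.det_toMatrix', hdet]

/-- Multiplication by `x` on `E` is `F`-linear of determinant `N x`. Its effect on Haar measure,
computed in these two ways, gives the two sides. -/
theorem normAbs_eq_normAbs_norm {E : Type*} [NontriviallyNormedField E] [LocallyCompactSpace E]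
    [NormedAlgebra F E] [FiniteDimensional F E] (x : E) :
    normAbs x = normAbs (Algebra.norm F x) := by
  rcases eq_or_ne x 0 with rfl | hx
  · simp [normAbs, Algebra.norm_zero]
  borelize E
  let φ : E ≃ₜ+ E :=
    { toFun := fun v => x * v
      invFun := fun v => x⁻¹ * v
      left_inv := fun v => inv_mul_cancel_left₀ hx v
      right_inv := fun v => mul_inv_cancel_left₀ hx v
      map_add' := mul_add x
      continuous_toFun := by fun_prop
      continuous_invFun := by fun_prop }
  rw [Algebra.norm_apply, ← addEquivAddHaarChar_eq_normAbs_det φ _ fun v => rfl]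
  let μ : Measure E := Measure.addHaar
  obtain ⟨h1, h2⟩ := measure_unitBall_ne E μ
  have h3 := normAbs_mul_measure μ hx (Metric.closedBall 0 1)
  have h4 := addEquivAddHaarChar_smul_preimage μ (X := x • Metric.closedBall 0 1) φ
  have h5 : φ ⁻¹' (x • Metric.closedBall 0 1) = Metric.closedBall 0 1 := by
    ext v
    exact Set.smul_mem_smul_set_iff₀ hx (Metric.closedBall 0 1) v
  rw [h5, ← h3, ENNReal.smul_def, smul_eq_mul, ENNReal.mul_left_inj h1 h2] at h4
  have h6 := congrArg ENNReal.toReal h4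
  rw [ENNReal.toReal_ofReal (normAbs_nonneg _)] at h6
  exact h6.symm

end Scaling

end Shintani

namespace Shintani

set_option linter.unusedSectionVars false

/-! ### Invariant functionals on covariant functions -/

section Covariant

open scoped Pointwise

variable {H B : Type*} [Group H] [TopologicalSpace H] [IsTopologicalGroup H]
  [MeasurableSpace H] [BorelSpace H]
  [Group B] [TopologicalSpace B] [IsTopologicalGroup B]
  [MeasurableSpace B] [BorelSpace B] {ι : B →* H}

/-- The weighted average of `η` over the left cosets of the image of `ι`. -/
def cosetIntegral (ι : B →* H) (ν : Measure B) (w : B → ℝ) (η : H → ℝ) (g : H) : ℝ :=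
  ∫ b, w b * η ((ι b)⁻¹ * g) ∂ν

theorem isCompact_preimage_div (hι : IsClosedEmbedding ι) {K N : Set H} (hK : IsCompact K)
    (hN : IsCompact N) : IsCompact (ι ⁻¹' (N / K)) := by
  rw [div_eq_mul_inv]
  exact hι.isCompact_preimage (hN.mul hK.inv)

theorem continuous_cosetIntegral [LocallyCompactSpace H] (hι : IsClosedEmbedding ι) (ν : Measure B)
    [IsFiniteMeasureOnCompacts ν] {w : B → ℝ} (hw : Continuous w) {η : H → ℝ} (hη : Continuous η)
    (hη' : HasCompactSupport η) : Continuous (cosetIntegral ι ν w η) := by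
  rw [continuous_iff_continuousAt]
  intro g
  obtain ⟨N, hN, hNg⟩ := exists_compact_mem_nhds g
  have hc : ContinuousOn (cosetIntegral ι ν w η) N := by
    refine continuousOn_integral_of_compact_support
      (f := fun g b => w b * η ((ι b)⁻¹ * g)) (isCompact_preimage_div hι hη' hN) ?_ ?_
    · have := hι.continuous
      exact Continuous.continuousOn (by fun_prop)
    · intro g b hg hb
      have : η ((ι b)⁻¹ * g) = 0 := by
        by_contra h0
        refine hb ⟨g, hg, (ι b)⁻¹ * g, subset_tsupport _ h0, ?_⟩
        simp
      rw [this, mul_zero]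
  exact hc.continuousAt hNg

theorem cosetIntegral_mul_left (ν : Measure B) [ν.IsMulLeftInvariant] (w : B →* ℝ) (η : H → ℝ)
    (b : B) (g : H) : cosetIntegral ι ν w η (ι b * g) = w b * cosetIntegral ι ν w η g := by
  rw [cosetIntegral, ← integral_mul_left_eq_self _ b, cosetIntegral, ← integral_const_mul]
  congr 1
  funext x
  simp [mul_assoc]

theorem cosetIntegral_pos [T2Space B] (hι : IsClosedEmbedding ι) (ν : Measure B)
    [IsFiniteMeasureOnCompacts ν] [ν.IsOpenPosMeasure] {w : B → ℝ} (hw : Continuous w)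
    (hw0 : ∀ b, 0 < w b) {η : H → ℝ} (hη : Continuous η) (hη' : HasCompactSupport η)
    (hη0 : ∀ g, 0 ≤ η g) {g : H} {b : B} (hb : 0 < η ((ι b)⁻¹ * g)) :
    0 < cosetIntegral ι ν w η g := by
  have hcont := hι.continuous
  refine Continuous.integral_pos_of_hasCompactSupport_nonneg_nonzero (x := b) (by fun_prop) ?_ ?_ ?_
  · refine HasCompactSupport.intro (isCompact_preimage_div hι hη' (isCompact_singleton (x := g))) ?_
    intro b hb
    have : η ((ι b)⁻¹ * g) = 0 := by
      by_contra h0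
      exact hb ⟨g, rfl, (ι b)⁻¹ * g, subset_tsupport _ h0, by simp⟩
    rw [this, mul_zero]
  · exact fun b => mul_nonneg (hw0 b).le (hη0 _)
  · exact (mul_pos (hw0 b) hb).ne'

/-- `f (b g) = δ(b) f(g)` -/
def IsCovariant (ι : B →* H) (δ : B →* ℝ) (f : H → ℂ) : Prop :=
  ∀ b g, f (ι b * g) = (δ b : ℂ) * f g

variable {δ : B →* ℝ} {μ : Measure H} {ν : Measure B} {c : ℝ}

/-- `δ` relates the left Haar measure `ν` to the right Haar measure, up to the constant `c`. -/
def IsModulus (ν : Measure B) (δ : B →* ℝ) (c : ℝ) : Prop :=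
  ∀ ψ : B → ℝ, Continuous ψ → HasCompactSupport ψ → ∫ b, δ b * ψ b ∂ν = c * ∫ b, ψ b⁻¹ ∂ν

/-- Written as a double integral over `H` and `B`, the left side is transformed by the substitution
`g ↦ bg`; the covariance of `f` produces `δ(b)`, which the modulus identity trades for the inversion
`b ↦ b⁻¹`. The symmetry obtained shows that `∫ η f` depends on `η` only through its coset averages.
-/
theorem integral_mul_cosetIntegral [T2Space H] [T2Space B] (hι : IsClosedEmbedding ι)
    [IsFiniteMeasureOnCompacts μ] [μ.IsMulLeftInvariant]
    [IsFiniteMeasureOnCompacts ν] (hδ : Continuous δ) (hmod : IsModulus ν δ c) {f : H → ℂ}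
    (hf : Continuous f) (hfδ : IsCovariant ι δ f) {η η' : H → ℝ} (hη : Continuous η)
    (hηc : HasCompactSupport η) (hη' : Continuous η') (hηc' : HasCompactSupport η') :
    ∫ g, ((η g * cosetIntegral ι ν 1 η' g : ℝ) : ℂ) * f g ∂μ =
      c * ∫ g, ((η' g * cosetIntegral ι ν 1 η g : ℝ) : ℂ) * f g ∂μ := by
  have hcont := hι.continuous
  have hcompact := isCompact_preimage_div hι hηc' hηc
  calc ∫ g, ((η g * cosetIntegral ι ν 1 η' g : ℝ) : ℂ) * f g ∂μ
      = ∫ g, ∫ b, ((η g * η' ((ι b)⁻¹ * g) : ℝ) : ℂ) * f g ∂ν ∂μ := by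
        congr 1
        funext g
        rw [integral_mul_const, cosetIntegral, ← integral_const_mul]
        congr 1
        rw [← integral_complex_ofReal]
        simp
    _ = ∫ b, ∫ g, ((η g * η' ((ι b)⁻¹ * g) : ℝ) : ℂ) * f g ∂μ ∂ν := by
        refine integral_integral_swap_of_hasCompactSupport ?_ ?_
        · exact Continuous.mul (Complex.continuous_ofReal.comp (by fun_prop)) (by fun_prop)
        · refine HasCompactSupport.intro (hηc.prod hcompact) ?_
          rintro ⟨g, b⟩ hgb
          have : η g * η' ((ι b)⁻¹ * g) = 0 := by
            by_contra h0
            have h1 := subset_tsupport _ (left_ne_zero_of_mul h0)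
            exact hgb ⟨h1, g, h1, (ι b)⁻¹ * g,
              subset_tsupport _ (right_ne_zero_of_mul h0), by simp⟩
          simp only [Function.uncurry_apply_pair, this, Complex.ofReal_zero, zero_mul]
    _ = ∫ b, ∫ g, ((δ b * η (ι b * g) * η' g : ℝ) : ℂ) * f g ∂μ ∂ν := by
        congr 1
        funext b
        rw [← integral_mul_left_eq_self _ (ι b)]
        congr 1
        funext g
        rw [hfδ, inv_mul_cancel_left]
        push_cast
        ring
    _ = ∫ g, ∫ b, ((δ b * η (ι b * g) * η' g : ℝ) : ℂ) * f g ∂ν ∂μ := by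
        symm
        refine integral_integral_swap_of_hasCompactSupport ?_ ?_
        · exact Continuous.mul (Complex.continuous_ofReal.comp (by fun_prop)) (by fun_prop)
        · refine HasCompactSupport.intro
            (hηc'.prod (isCompact_preimage_div hι hηc' hηc)) ?_
          rintro ⟨g, b⟩ hgb
          have : η (ι b * g) * η' g = 0 := by
            by_contra h0
            have h1 := subset_tsupport _ (right_ne_zero_of_mul h0)
            exact hgb ⟨h1, ι b * g, subset_tsupport _ (left_ne_zero_of_mul h0), g, h1, by simp⟩
          simp only [Function.uncurry_apply_pair, mul_assoc, this, mul_zero, Complex.ofReal_zero,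
            zero_mul]
    _ = c * ∫ g, ((η' g * cosetIntegral ι ν 1 η g : ℝ) : ℂ) * f g ∂μ := by
        rw [← integral_const_mul]
        congr 1
        funext g
        have h1 := hmod (fun b => η (ι b * g)) (by fun_prop) (by
          refine HasCompactSupport.intro
            (isCompact_preimage_div hι (isCompact_singleton (x := g)) hηc) ?_
          intro b hb
          by_contra h0
          exact hb ⟨ι b * g, subset_tsupport _ h0, g, rfl, by simp⟩)
        rw [integral_mul_const]
        have h2 : ∫ b, ((δ b * η (ι b * g) * η' g : ℝ) : ℂ) ∂ν =
            ((c * (η' g * cosetIntegral ι ν 1 η g) : ℝ) : ℂ) := by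
          rw [integral_complex_ofReal, integral_mul_const, h1, cosetIntegral]
          simp only [Pi.one_apply, one_mul, map_inv]
          congr 1
          ring
        rw [h2]
        push_cast
        ring

/-- `η` is a continuous, compactly supported, non-negative function whose averages over all left
cosets of the image of `ι` are `1`. -/
structure IsCosetUnit (ι : B →* H) (ν : Measure B) (η : H → ℝ) : Prop where
  continuous : Continuous η
  hasCompactSupport : HasCompactSupport η
  nonneg : ∀ g, 0 ≤ η g
  cosetIntegral_eq : ∀ g, cosetIntegral ι ν 1 η g = 1

/-- The weight is `φ` divided by its coset average, which is positive everywhere and constant on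
cosets. -/
theorem exists_isCosetUnit [T2Space B] [LocallyCompactSpace H] (hι : IsClosedEmbedding ι)
    (ν : Measure B) [IsFiniteMeasureOnCompacts ν] [ν.IsOpenPosMeasure] [ν.IsMulLeftInvariant]
    {φ : H → ℝ} (hφ : Continuous φ) (hφc : HasCompactSupport φ) (hφ0 : ∀ g, 0 ≤ φ g)
    (hφpos : ∀ g, ∃ b, 0 < φ ((ι b)⁻¹ * g)) :
    ∃ η, IsCosetUnit ι ν η ∧ ∀ g, 0 < φ g → 0 < η g := by
  have hpos : ∀ g, 0 < cosetIntegral ι ν 1 φ g := fun g =>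
    cosetIntegral_pos hι ν continuous_one (fun _ => one_pos) hφ hφc hφ0 (hφpos g).choose_spec
  have hcont := continuous_cosetIntegral hι ν continuous_one hφ hφc
  refine ⟨fun g => φ g / cosetIntegral ι ν 1 φ g, ⟨hφ.div hcont fun g => (hpos g).ne', ?_, ?_, ?_⟩,
    fun g hg => div_pos hg (hpos g)⟩
  · exact hφc.mono' (by
      intro g hg
      refine subset_tsupport _ ?_
      intro h0
      exact hg (by simp [h0]))
  · exact fun g => div_nonneg (hφ0 g) (hpos g).le
  · intro g
    have h1 : ∀ b, cosetIntegral ι ν 1 φ ((ι b)⁻¹ * g) = cosetIntegral ι ν 1 φ g := by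
      intro b
      have := cosetIntegral_mul_left (ι := ι) ν (1 : B →* ℝ) φ b⁻¹ g
      rw [map_inv, MonoidHom.one_apply, one_mul] at this
      exact this
    rw [cosetIntegral]
    simp only [h1, ← mul_div_assoc]
    rw [integral_div]
    exact div_self (hpos g).ne'

/-- A right translate of `η` again has all coset averages `1`, so by the symmetry of
`integral_mul_cosetIntegral` it defines the same functional. -/
theorem IsCosetUnit.integral_mul_right [T2Space H] [T2Space B] (hι : IsClosedEmbedding ι)
    [IsFiniteMeasureOnCompacts μ] [μ.IsMulLeftInvariant] [μ.IsMulRightInvariant]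
    [IsFiniteMeasureOnCompacts ν] (hδ : Continuous δ) (hmod : IsModulus ν δ c) {f : H → ℂ}
    (hf : Continuous f) (hfδ : IsCovariant ι δ f) {η : H → ℝ} (hη : IsCosetUnit ι ν η) (h : H) :
    ∫ g, (η g : ℂ) * f (g * h) ∂μ = ∫ g, (η g : ℂ) * f g ∂μ := by
  have key : ∀ h, ∫ g, (η g : ℂ) * f (g * h) ∂μ = c * ∫ g, (η g : ℂ) * f g ∂μ := by
    intro h
    have h1 : ∀ g, cosetIntegral ι ν 1 (fun g => η (g * h⁻¹)) g = 1 := by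
      intro g
      rw [← hη.cosetIntegral_eq (g * h⁻¹)]
      simp only [cosetIntegral, mul_assoc]
    have h2 := integral_mul_cosetIntegral (μ := μ) hι hδ hmod hf hfδ (η := fun g => η (g * h⁻¹))
      (hη.continuous.comp (continuous_mul_const h⁻¹))
      (hη.hasCompactSupport.comp_homeomorph (Homeomorph.mulRight h⁻¹)) hη.continuous
      hη.hasCompactSupport
    simp only [h1, hη.cosetIntegral_eq, mul_one] at h2
    have h3 := integral_mul_right_eq_self (μ := μ) (fun g => (η (g * h⁻¹) : ℂ) * f g) h
    simp only [mul_inv_cancel_right] at h3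
    rw [← h2, h3]
  -- The case `h = 1` of `key` absorbs the constant `c`, which therefore need not be computed.
  rw [key h]
  have := key 1
  simp only [mul_one] at this
  exact this.symm

/-- After the substitution by `θ` the weight becomes `η ∘ θ⁻¹`. Its coset averages are still
constant, though perhaps not `1`, since `θ` induces an automorphism of `B` that rescales Haar
measure; the functional is thus multiplied by a constant. -/
theorem IsCosetUnit.exists_integral_comp [T2Space H] [T2Space B] [LocallyCompactSpace H]
    [LocallyCompactSpace B] (hι : IsClosedEmbedding ι)
    [μ.IsHaarMeasure] [μ.Regular] [ν.IsHaarMeasure] [ν.Regular] (hδ : Continuous δ)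
    (hmod : IsModulus ν δ c)
    {η : H → ℝ} (hη : IsCosetUnit ι ν η) (θ : H ≃ₜ* H) (θB : B ≃ₜ* B)
    (hθ : ∀ b, θ (ι b) = ι (θB b)) :
    ∃ a : ℝ, ∀ f : H → ℂ, Continuous f → IsCovariant ι δ f →
      ∫ g, (η g : ℂ) * f (θ g) ∂μ = a * ∫ g, (η g : ℂ) * f g ∂μ := by
  have hB : ∀ ψ : B → ℝ, ∫ b, ψ (θB.symm b) ∂ν = (mulEquivHaarChar θB.symm : ℝ)⁻¹ * ∫ b, ψ b ∂ν := by
    intro ψ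
    conv_rhs => rw [← mulEquivHaarChar_smul_map ν θB.symm, integral_smul_nnreal_measure]
    have h0 : ∫ b, ψ b ∂ν.map θB.symm = ∫ b, ψ (θB.symm b) ∂ν :=
      θB.symm.toHomeomorph.measurableEmbedding.integral_map ψ
    rw [h0, NNReal.smul_def, smul_eq_mul, inv_mul_cancel_left₀
      (by exact_mod_cast (mulEquivHaarChar_pos θB.symm).ne')]
  have hH : ∀ ψ : H → ℂ, ∫ g, ψ (θ g) ∂μ = (mulEquivHaarChar θ : ℂ)⁻¹ * ∫ g, ψ g ∂μ := by
    intro ψ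
    conv_rhs => rw [← mulEquivHaarChar_smul_map μ θ, integral_smul_nnreal_measure]
    have h0 : ∫ g, ψ g ∂μ.map θ = ∫ g, ψ (θ g) ∂μ :=
      θ.toHomeomorph.measurableEmbedding.integral_map ψ
    rw [h0, NNReal.smul_def, Complex.real_smul, inv_mul_cancel_left₀
      (by exact_mod_cast (mulEquivHaarChar_pos θ).ne')]
  refine ⟨(mulEquivHaarChar θ : ℝ)⁻¹ * (c * (mulEquivHaarChar θB.symm : ℝ)⁻¹), fun f hf hfδ => ?_⟩
  have h1 : ∀ g, cosetIntegral ι ν 1 (fun g => η (θ.symm g)) g =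
      (mulEquivHaarChar θB.symm : ℝ)⁻¹ := by
    intro g
    have h2 : ∀ b, θ.symm ((ι b)⁻¹ * g) = (ι (θB.symm b))⁻¹ * θ.symm g := by
      intro b
      apply θ.injective
      simp [hθ]
    simp only [cosetIntegral, h2, Pi.one_apply, one_mul]
    rw [hB fun b => η ((ι b)⁻¹ * θ.symm g)]
    have := hη.cosetIntegral_eq (θ.symm g)
    simp only [cosetIntegral, Pi.one_apply, one_mul] at this
    rw [this, mul_one]
  have h2 := integral_mul_cosetIntegral (μ := μ) hι hδ hmod hf hfδ (η := fun g => η (θ.symm g))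
      (hη.continuous.comp θ.symm.continuous_toFun)
      (hη.hasCompactSupport.comp_homeomorph θ.symm.toHomeomorph) hη.continuous
      hη.hasCompactSupport
  simp only [h1, hη.cosetIntegral_eq, mul_one] at h2
  have h3 := hH fun g => (η (θ.symm g) : ℂ) * f g
  simp only [ContinuousMulEquiv.symm_apply_apply] at h3
  rw [h3, h2]
  push_cast
  have h4 : ∀ g, (η g : ℂ) * ((mulEquivHaarChar θB.symm : ℂ))⁻¹ * f g =
      ((mulEquivHaarChar θB.symm : ℂ))⁻¹ * ((η g : ℂ) * f g) := fun g => by ring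
  simp only [h4]
  rw [integral_const_mul]
  ring

end Covariant

end Shintani

namespace Shintani

open scoped Matrix

set_option linter.unusedSectionVars false

/-! ### Topology of `GL_n` -/

section TopologyGL

variable {n : ℕ} {F : Type*} [NontriviallyNormedField F]

theorem coe_inv_eq (g : G n F) : ((g⁻¹ : G n F) : Matrix (Fin n) (Fin n) F) =
    (g : Matrix (Fin n) (Fin n) F).det⁻¹ • (g : Matrix (Fin n) (Fin n) F).adjugate := by
  rw [Matrix.coe_units_inv, Matrix.inv_def, Ring.inverse_eq_inv']

theorem det_ne_zero (g : G n F) : (g : Matrix (Fin n) (Fin n) F).det ≠ 0 :=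
  (Matrix.GeneralLinearGroup.det g).ne_zero

theorem continuous_GL_iff {X : Type*} [TopologicalSpace X] {f : X → G n F} :
    Continuous f ↔ Continuous fun x => (f x : Matrix (Fin n) (Fin n) F) := by
  refine ⟨fun h => Units.continuous_val.comp h, fun h => ?_⟩
  rw [Units.continuous_iff]
  refine ⟨h, ?_⟩
  refine continuous_matrix fun i j => ?_
  have h1 : ∀ x, (((f x)⁻¹ : G n F) : Matrix (Fin n) (Fin n) F) i j = (f x : Matrix (Fin n) (Fin n) F).det⁻¹ *
      (f x : Matrix (Fin n) (Fin n) F).adjugate i j := fun x => by rw [coe_inv_eq]; rfl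
  refine (Continuous.congr ?_ fun x => (h1 x).symm)
  exact (h.matrix_det.inv₀ fun x => det_ne_zero (f x)).mul
    (h.matrix_adjugate.matrix_elem i j)

theorem continuous_entry (i j : Fin n) :
    Continuous fun g : G n F => (g : Matrix (Fin n) (Fin n) F) i j :=
  Continuous.matrix_elem Units.continuous_val i j

theorem continuous_entry_inv (i j : Fin n) :
    Continuous fun g : G n F => ((g⁻¹ : G n F) : Matrix (Fin n) (Fin n) F) i j :=
  (continuous_entry i j).comp continuous_inv

instance [LocallyCompactSpace F] : LocallyCompactSpace (G n F) := by
  have : LocallyCompactSpace (Matrix (Fin n) (Fin n) F) :=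
    inferInstanceAs (LocallyCompactSpace (Fin n → Fin n → F))
  have : LocallyCompactSpace (Matrix (Fin n) (Fin n) F)ᵐᵒᵖ :=
    MulOpposite.opHomeomorph.symm.isClosedEmbedding.locallyCompactSpace
  exact Units.isClosedEmbedding_embedProduct.locallyCompactSpace

/-- The map `g ↦ (g, g⁻¹)` embeds the group as a closed subset of pairs of matrices, so bounds on
the entries of both suffice. -/
theorem isCompact_bounded [LocallyCompactSpace F] (C : ℝ) :
    IsCompact {g : G n F | (∀ i j, ‖(g : Matrix (Fin n) (Fin n) F) i j‖ ≤ C) ∧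
      ∀ i j, ‖((g⁻¹ : G n F) : Matrix (Fin n) (Fin n) F) i j‖ ≤ C} := by
  have := ProperSpace.of_locallyCompactSpace F (E := F)
  let K : Set (Matrix (Fin n) (Fin n) F) := {M | ∀ i j, M i j ∈ Metric.closedBall (0 : F) C}
  have hK : IsCompact K := by
    have h1 : IsCompact (Set.univ.pi fun _ : Fin n => Set.univ.pi fun _ : Fin n =>
        Metric.closedBall (0 : F) C) :=
      isCompact_univ_pi fun _ => isCompact_univ_pi fun _ => isCompact_closedBall _ _
    have h2 : K = (Set.univ.pi fun _ : Fin n => Set.univ.pi fun _ : Fin n =>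
        Metric.closedBall (0 : F) C) :=
      Set.ext fun M => ⟨fun h i _ j _ => h i j, fun h i j => h i trivial j trivial⟩
    exact h2 ▸ h1
  have h2 := (Units.isClosedEmbedding_embedProduct
    (α := Matrix (Fin n) (Fin n) F)).isCompact_preimage
    (hK.prod (hK.image MulOpposite.continuous_op))
  have h3 : {g : G n F | (∀ i j, ‖(g : Matrix (Fin n) (Fin n) F) i j‖ ≤ C) ∧
      ∀ i j, ‖((g⁻¹ : G n F) : Matrix (Fin n) (Fin n) F) i j‖ ≤ C} =
      Units.embedProduct (Matrix (Fin n) (Fin n) F) ⁻¹' (K ×ˢ (MulOpposite.op '' K)) := by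
    ext g
    rw [Set.mem_preimage, Units.embedProduct_apply, Set.mem_prod,
      MulOpposite.op_injective.mem_set_image]
    simp only [K, mem_closedBall_zero_iff, Set.mem_ofPred_eq]
  rw [h3]
  exact h2

theorem isClosed_levi (b : Fin n → Fin n) : IsClosed (levi F b : Set (G n F)) := by
  have : (levi F b : Set (G n F)) = ⋂ i, ⋂ j, {g : G n F | b i ≠ b j →
      (g : Matrix (Fin n) (Fin n) F) i j = 0 ∧
      ((g⁻¹ : G n F) : Matrix (Fin n) (Fin n) F) i j = 0} := by
    ext g
    simp only [Set.mem_iInter]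
    rfl
  rw [this]
  refine isClosed_iInter fun i => isClosed_iInter fun j => ?_
  by_cases h : b i = b j
  · simp [h]
  · simp only [ne_eq, h, not_false_eq_true, forall_const]
    exact (isClosed_eq (continuous_entry i j) continuous_const).inter
      (isClosed_eq (continuous_entry_inv i j) continuous_const)

instance [LocallyCompactSpace F] (b : Fin n → Fin n) : LocallyCompactSpace (levi F b) :=
  (isClosed_levi b).isClosedEmbedding_subtypeVal.locallyCompactSpace

end TopologyGL

/-! ### The Borel subgroup and its modulus -/

section Borel

variable {n : ℕ} {F : Type*} [NontriviallyNormedField F]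

variable (n F) in
/-- The group of invertible upper triangular matrices. -/
def borelSubgroup : Subgroup (G n F) where
  carrier := {g | (g : Matrix (Fin n) (Fin n) F).BlockTriangular id}
  one_mem' := by
    rw [Set.mem_ofPred_eq, Units.val_one]; exact Matrix.blockTriangular_one
  mul_mem' := fun hg hh => by
    rw [Set.mem_ofPred_eq, Units.val_mul]; exact hg.mul hh
  inv_mem' := fun {g} hg => by
    rw [Set.mem_ofPred_eq, Matrix.coe_units_inv]
    have : Invertible (g : Matrix (Fin n) (Fin n) F) := g.invertible
    exact Matrix.blockTriangular_inv_of_blockTriangular hg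

theorem borel_apply_eq_zero (b : borelSubgroup n F) {i j : Fin n} (h : j < i) :
    ((b : G n F) : Matrix (Fin n) (Fin n) F) i j = 0 := b.2 h

theorem borel_det (b : borelSubgroup n F) : ((b : G n F) : Matrix (Fin n) (Fin n) F).det =
    ∏ i, ((b : G n F) : Matrix (Fin n) (Fin n) F) i i :=
  Matrix.det_of_isUpperTriangular b.2

theorem borel_diag_ne_zero (b : borelSubgroup n F) (i : Fin n) :
    ((b : G n F) : Matrix (Fin n) (Fin n) F) i i ≠ 0 := by
  have := det_ne_zero (b : G n F)
  rw [borel_det, Finset.prod_ne_zero_iff] at this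
  exact this i (Finset.mem_univ i)

theorem borel_diag_mul (b c : borelSubgroup n F) (i : Fin n) :
    (((b * c : borelSubgroup n F) : G n F) : Matrix (Fin n) (Fin n) F) i i =
      ((b : G n F) : Matrix (Fin n) (Fin n) F) i i *
      ((c : G n F) : Matrix (Fin n) (Fin n) F) i i := by
  rw [Subgroup.coe_mul, Units.val_mul, Matrix.mul_apply, Finset.sum_eq_single i]
  · intro j _ hj
    rcases lt_or_gt_of_ne hj with h | h
    · rw [borel_apply_eq_zero b h, zero_mul]
    · rw [borel_apply_eq_zero c h, mul_zero]
  · simp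

theorem isClosed_borelSubgroup : IsClosed (borelSubgroup n F : Set (G n F)) := by
  have : (borelSubgroup n F : Set (G n F)) = ⋂ i, ⋂ j, {g : G n F | j < i →
      (g : Matrix (Fin n) (Fin n) F) i j = 0} := by
    ext g
    simp only [Set.mem_iInter]
    exact ⟨fun h i j hij => h hij, fun h i j hij => h i j hij⟩
  rw [this]
  refine isClosed_iInter fun i => isClosed_iInter fun j => ?_
  by_cases h : j < i
  · simp only [h, forall_const]
    exact isClosed_eq (continuous_entry i j) continuous_const
  · simp [h]

instance [LocallyCompactSpace F] : LocallyCompactSpace (borelSubgroup n F) :=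
  isClosed_borelSubgroup.isClosedEmbedding_subtypeVal.locallyCompactSpace

/-- The index set of the entries of upper triangular matrices. -/
abbrev UpperIndex (n : ℕ) := {p : Fin n × Fin n // p.1 ≤ p.2}

/-- The entries of an upper triangular matrix. -/
def borelCoord (b : borelSubgroup n F) (p : UpperIndex n) : F :=
  ((b : G n F) : Matrix (Fin n) (Fin n) F) p.1.1 p.1.2

/-- The image is the locus of non-zero determinant in the space of upper triangular matrices. Haar
measures of the Borel subgroup can thus be written as densities against an additive Haar measure. -/
theorem isOpenEmbedding_borelCoord :
    IsOpenEmbedding (borelCoord : borelSubgroup n F → UpperIndex n → F) := by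
  let M : (UpperIndex n → F) → Matrix (Fin n) (Fin n) F := fun v =>
    Matrix.of fun i j => if h : i ≤ j then v ⟨(i, j), h⟩ else 0
  have hMc : Continuous M := by
    refine continuous_matrix fun i j => ?_
    by_cases h : i ≤ j
    · simp only [M, Matrix.of_apply, h, dif_pos]; fun_prop
    · simp only [M, Matrix.of_apply, h, dif_neg, not_false_eq_true]; fun_prop
  have hMt : ∀ v, (M v).BlockTriangular id := fun v i j hij => by
    simp [M, not_le.2 (show j < i from hij)]
  have hMb : ∀ b : borelSubgroup n F, M (borelCoord b) = (b : G n F) := by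
    intro b
    ext i j
    by_cases h : i ≤ j
    · simp [M, h, borelCoord]
    · simp [M, h, borel_apply_eq_zero b (not_le.1 h)]
  let U : Set (UpperIndex n → F) := {v | (M v).det ≠ 0}
  have hU : IsOpen U := isOpen_ne_fun hMc.matrix_det continuous_const
  have hcoord : Continuous (borelCoord : borelSubgroup n F → UpperIndex n → F) :=
    continuous_pi fun p => (continuous_entry _ _).comp continuous_subtype_val
  have hmem : ∀ b : borelSubgroup n F, borelCoord b ∈ U := fun b => by
    change (M _).det ≠ 0
    rw [hMb]; exact det_ne_zero _
  have hinv : Continuous fun v : U => Matrix.GeneralLinearGroup.mkOfDetNeZero (M v) v.2 :=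
    continuous_GL_iff.2 (hMc.comp continuous_subtype_val)
  let e : borelSubgroup n F ≃ₜ U :=
    { toFun := fun b => ⟨borelCoord b, hmem b⟩
      invFun := fun v => ⟨Matrix.GeneralLinearGroup.mkOfDetNeZero (M v) v.2, hMt v⟩
      left_inv := fun b => by
        apply Subtype.ext
        ext1
        exact hMb b
      right_inv := fun v => by
        apply Subtype.ext
        funext p
        change M v p.1.1 p.1.2 = _
        simp [M, p.2]
      continuous_toFun := hcoord.subtype_mk hmem
      continuous_invFun := hinv.subtype_mk fun v => hMt v }
  exact hU.isOpenEmbedding_subtypeVal.comp e.isOpenEmbedding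

/-- Left multiplication by `b` in coordinates. -/
def leftMulMatrix (b : borelSubgroup n F) : Matrix (UpperIndex n) (UpperIndex n) F :=
  fun p q => if p.1.2 = q.1.2 then ((b : G n F) : Matrix (Fin n) (Fin n) F) p.1.1 q.1.1 else 0

/-- Right multiplication by `b` in coordinates. -/
def rightMulMatrix (b : borelSubgroup n F) : Matrix (UpperIndex n) (UpperIndex n) F :=
  fun p q => if p.1.1 = q.1.1 then ((b : G n F) : Matrix (Fin n) (Fin n) F) q.1.2 p.1.2 else 0

theorem sum_upperIndex (f : Fin n → Fin n → F) :
    ∑ q : UpperIndex n, f q.1.1 q.1.2 = ∑ i, ∑ j, if i ≤ j then f i j else 0 := by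
  rw [← Finset.sum_product', ← Finset.sum_filter]
  exact (Finset.sum_subtype (f := fun p : Fin n × Fin n => f p.1 p.2) _ (by simp)).symm

theorem leftMulMatrix_mulVec (b c : borelSubgroup n F) :
    (leftMulMatrix b).mulVec (borelCoord c) = borelCoord (b * c) := by
  funext p
  have h := sum_upperIndex fun i j =>
    (if p.1.2 = j then ((b : G n F) : Matrix (Fin n) (Fin n) F) p.1.1 i else 0) *
      ((c : G n F) : Matrix (Fin n) (Fin n) F) i j
  change ∑ q, _ = _ at h
  rw [Matrix.mulVec, dotProduct]
  refine h.trans ?_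
  rw [borelCoord, Subgroup.coe_mul, Units.val_mul, Matrix.mul_apply]
  refine Finset.sum_congr rfl fun i _ => ?_
  rw [Finset.sum_eq_single p.1.2]
  · rw [if_pos rfl]
    split_ifs with hi
    · rfl
    · rw [borel_apply_eq_zero c (not_le.1 hi), mul_zero]
  · intro j _ hj
    simp [Ne.symm hj]
  · simp

theorem rightMulMatrix_mulVec (b c : borelSubgroup n F) :
    (rightMulMatrix b).mulVec (borelCoord c) = borelCoord (c * b) := by
  funext p
  have h := sum_upperIndex fun i j =>
    (if p.1.1 = i then ((b : G n F) : Matrix (Fin n) (Fin n) F) j p.1.2 else 0) *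
      ((c : G n F) : Matrix (Fin n) (Fin n) F) i j
  change ∑ q, _ = _ at h
  rw [Matrix.mulVec, dotProduct]
  refine h.trans ?_
  rw [borelCoord, Subgroup.coe_mul, Units.val_mul, Matrix.mul_apply, Finset.sum_comm]
  refine Finset.sum_congr rfl fun j _ => ?_
  rw [Finset.sum_eq_single p.1.1]
  · rw [if_pos rfl]
    split_ifs with hi
    · rw [mul_comm]
    · rw [borel_apply_eq_zero c (not_le.1 hi), zero_mul]
  · intro j _ hj
    simp [Ne.symm hj]
  · simp

/-- Ordered by rows the matrix is block triangular; row `i` contributes a scalar block `b_ii` whose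
size is the number `n - i` of columns `j ≥ i`. -/
theorem det_leftMulMatrix (b : borelSubgroup n F) : (leftMulMatrix b).det =
    ∏ i, ((b : G n F) : Matrix (Fin n) (Fin n) F) i i ^ (n - i : ℕ) := by
  have ht : (leftMulMatrix b).BlockTriangular fun p => p.1.1 := by
    intro p q hpq
    rw [leftMulMatrix]
    split_ifs
    · exact borel_apply_eq_zero b hpq
    · rfl
  rw [ht.det_fintype]
  refine Finset.prod_congr rfl fun i _ => ?_
  have h1 : (leftMulMatrix b).toSquareBlock (fun p => p.1.1) i =
      Matrix.diagonal fun _ => ((b : G n F) : Matrix (Fin n) (Fin n) F) i i := by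
    ext p q
    rw [Matrix.toSquareBlock_def, Matrix.of_apply, leftMulMatrix, Matrix.diagonal_apply, p.2, q.2]
    refine if_congr ?_ rfl rfl
    constructor
    · intro h
      exact Subtype.ext (Subtype.ext (Prod.ext (p.2.trans q.2.symm) h))
    · rintro rfl; rfl
  rw [h1, Matrix.det_diagonal, Finset.prod_const, Finset.card_univ]
  congr 1
  let e : {p : UpperIndex n // p.1.1 = i} ≃ {j : Fin n // i ≤ j} :=
    { toFun := fun p => ⟨p.1.1.2, p.2.symm.trans_le p.1.2⟩
      invFun := fun j => ⟨⟨(i, j.1), j.2⟩, rfl⟩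
      left_inv := fun p => Subtype.ext (Subtype.ext (Prod.ext p.2.symm rfl))
      right_inv := fun j => rfl }
  rw [Fintype.card_congr e, Fintype.card_subtype]
  have h2 : (Finset.univ.filter fun j : Fin n => i ≤ j) = Finset.Ici i := by ext; simp
  rw [h2, Fin.card_Ici]

/-- Ordered by columns the transpose is block triangular; column `i` contributes a scalar block
`b_ii` whose size is the number `i + 1` of rows `j ≤ i`. -/
theorem det_rightMulMatrix (b : borelSubgroup n F) : (rightMulMatrix b).det =
    ∏ i, ((b : G n F) : Matrix (Fin n) (Fin n) F) i i ^ ((i : ℕ) + 1) := by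
  have ht : (rightMulMatrix b)ᵀ.BlockTriangular fun p => p.1.2 := by
    intro p q hpq
    rw [Matrix.transpose_apply, rightMulMatrix]
    split_ifs
    · exact borel_apply_eq_zero b hpq
    · rfl
  rw [← Matrix.det_transpose, ht.det_fintype]
  refine Finset.prod_congr rfl fun i _ => ?_
  have h1 : (rightMulMatrix b)ᵀ.toSquareBlock (fun p => p.1.2) i =
      Matrix.diagonal fun _ => ((b : G n F) : Matrix (Fin n) (Fin n) F) i i := by
    ext p q
    rw [Matrix.toSquareBlock_def, Matrix.of_apply, Matrix.transpose_apply, rightMulMatrix,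
      Matrix.diagonal_apply, p.2, q.2]
    refine if_congr ?_ rfl rfl
    constructor
    · intro h
      exact Subtype.ext (Subtype.ext (Prod.ext h.symm (p.2.trans q.2.symm)))
    · rintro rfl; rfl
  rw [h1, Matrix.det_diagonal, Finset.prod_const, Finset.card_univ]
  congr 1
  let e : {p : UpperIndex n // p.1.2 = i} ≃ {j : Fin n // j ≤ i} :=
    { toFun := fun p => ⟨p.1.1.1, p.1.2.trans_eq p.2⟩
      invFun := fun j => ⟨⟨(j.1, i), j.2⟩, rfl⟩
      left_inv := fun p => Subtype.ext (Subtype.ext (Prod.ext rfl p.2.symm))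
      right_inv := fun j => rfl }
  rw [Fintype.card_congr e, Fintype.card_subtype]
  have h2 : (Finset.univ.filter fun j : Fin n => j ≤ i) = Finset.Iic i := by ext; simp
  rw [h2, Fin.card_Iic]

end Borel

end Shintani

namespace Shintani

set_option linter.unusedSectionVars false

open scoped NNReal ENNReal

/-- The factor by which `T` rescales `μ` cancels against the factor by which it rescales the
density. This turns an additive Haar measure into a multiplicative one. -/
theorem map_withDensity_inv {B : Type*} [MeasurableSpace B] (μ : Measure B) {k : B → ℝ≥0}
    (hk : Measurable k) (T : B ≃ᵐ B) {a : ℝ≥0} (ha : a ≠ 0) (hT : ∀ x, k (T x) = a * k x)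
    (hμ : a • μ.map T = μ) : (μ.withDensity fun x => ((k x)⁻¹ : ℝ≥0)).map T =
      μ.withDensity fun x => ((k x)⁻¹ : ℝ≥0) := by
  ext A hA
  have hg : Measurable fun x => (((k x)⁻¹ : ℝ≥0) : ℝ≥0∞) := hk.inv.coe_nnreal_ennreal
  rw [Measure.map_apply T.measurable hA, withDensity_apply _ (T.measurable hA),
    withDensity_apply _ hA]
  have h1 : ∀ x, (((k x)⁻¹ : ℝ≥0) : ℝ≥0∞) = a * (((k (T x))⁻¹ : ℝ≥0) : ℝ≥0∞) := by
    intro x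
    rw [hT, ← ENNReal.coe_mul, mul_inv, mul_inv_cancel_left₀ ha]
  calc ∫⁻ x in T ⁻¹' A, (((k x)⁻¹ : ℝ≥0) : ℝ≥0∞) ∂μ
      = ∫⁻ x in T ⁻¹' A, a * (((k (T x))⁻¹ : ℝ≥0) : ℝ≥0∞) ∂μ := lintegral_congr h1
    _ = a * ∫⁻ x in T ⁻¹' A, (((k (T x))⁻¹ : ℝ≥0) : ℝ≥0∞) ∂μ :=
        lintegral_const_mul _ (hg.comp T.measurable)
    _ = a * ∫⁻ x in A, (((k x)⁻¹ : ℝ≥0) : ℝ≥0∞) ∂(μ.map T) := by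
        rw [setLIntegral_map hA hg T.measurable]
    _ = ∫⁻ x in A, (((k x)⁻¹ : ℝ≥0) : ℝ≥0∞) ∂(a • μ.map T) := by
        rw [Measure.restrict_smul, lintegral_smul_measure]
        rfl
    _ = _ := by rw [hμ]

/-! ### Unimodularity of `GL_n` -/

section Unimodular

variable {n : ℕ} [NeZero n] {F : Type*} [NontriviallyNormedField F] [LocallyCompactSpace F]

/-- The scalar matrix `t`. -/
def scalarGL (t : Fˣ) : G n F := Units.map (algebraMap F (Matrix (Fin n) (Fin n) F)).toMonoidHom t

theorem coe_scalarGL (t : Fˣ) :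
    ((scalarGL t : G n F) : Matrix (Fin n) (Fin n) F) = Matrix.scalar (Fin n) (t : F) := rfl

theorem scalarGL_mul_comm (t : Fˣ) (g : G n F) : g * scalarGL t = scalarGL t * g := by
  ext1
  exact (Algebra.commutes (t : F) (g : Matrix (Fin n) (Fin n) F)).symm

theorem det_scalarGL (t : Fˣ) : Matrix.GeneralLinearGroup.det (scalarGL t : G n F) = t ^ n := by
  ext1
  rw [Matrix.GeneralLinearGroup.val_det_apply, coe_scalarGL]
  simp

/-- The modular character factors through the determinant and is trivial on central elements. The
scalar matrix `t = det g` has determinant `t^n`, so the `n`-th power of the character at `g` is `1`,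
and its values are non-negative reals. -/
theorem isMulRightInvariant_GL [MeasurableSpace (G n F)] [BorelSpace (G n F)]
    (μ : Measure (G n F)) [μ.IsHaarMeasure] [μ.Regular] : μ.IsMulRightInvariant := by
  have : Infinite F := NontriviallyNormedField.infinite F
  have h1 : ∀ t : Fˣ, Measure.modularCharacterFun (scalarGL t : G n F) = 1 := by
    intro t
    rw [Measure.modularCharacterFun_eq_haarScalarFactor μ]
    have : μ.map (· * scalarGL t) = μ := by
      rw [funext fun g => scalarGL_mul_comm t g, map_mul_left_eq_self]
    simp only [this, Measure.haarScalarFactor_self]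
  have h2 : ∀ g : G n F, Measure.modularCharacterFun g = 1 := by
    intro g
    let χ : G n F →* ℝ≥0 := Measure.modularCharacter
    have h3 := map_eq_map_dilation_det χ 0 g
    set t := Matrix.GeneralLinearGroup.det g
    have h4 := map_eq_map_dilation_det χ 0 (scalarGL t)
    rw [det_scalarGL, map_pow, map_pow] at h4
    have h5 : χ (scalarGL t) = 1 := h1 t
    rw [h5, eq_comm, pow_eq_one_iff_of_nonneg zero_le (NeZero.ne n)] at h4
    exact h3.trans h4
  constructor
  intro g
  have : Measure.Regular (μ.map (· * g)) := Measure.Regular.map (Homeomorph.mulRight g)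
  have h3 := Measure.isMulLeftInvariant_eq_smul_of_regular (μ.map (· * g)) μ
  rw [← Measure.modularCharacterFun_eq_haarScalarFactor μ, h2, one_smul] at h3
  exact h3

end Unimodular

/-! ### Left and right Haar measures of the Borel subgroup -/

section BorelModulus

variable {n : ℕ} {F : Type*} [NontriviallyNormedField F] [LocallyCompactSpace F]

/-- The additive equivalence given by an invertible matrix. -/
def matrixEquiv {ι : Type*} [Fintype ι] [DecidableEq ι] (M : Matrix ι ι F) (hM : M.det ≠ 0) :
    (ι → F) ≃ₜ+ (ι → F) where
  toFun v := M.mulVec v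
  invFun v := M⁻¹.mulVec v
  left_inv v := by
    beta_reduce
    rw [Matrix.mulVec_mulVec, Matrix.nonsing_inv_mul _ (isUnit_iff_ne_zero.2 hM), Matrix.one_mulVec]
  right_inv v := by
    beta_reduce
    rw [Matrix.mulVec_mulVec, Matrix.mul_nonsing_inv _ (isUnit_iff_ne_zero.2 hM), Matrix.one_mulVec]
  map_add' v w := Matrix.mulVec_add _ _ _
  continuous_toFun := by fun_prop
  continuous_invFun := by fun_prop

theorem map_comap_borelCoord [MeasurableSpace (borelSubgroup n F)] [BorelSpace (borelSubgroup n F)]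
    [MeasurableSpace (UpperIndex n → F)] [BorelSpace (UpperIndex n → F)]
    (μ : Measure (UpperIndex n → F)) [μ.IsAddHaarMeasure] [μ.Regular]
    (T : borelSubgroup n F ≃ₜ borelSubgroup n F) (M : Matrix (UpperIndex n) (UpperIndex n) F)
    (hM : M.det ≠ 0) (hT : ∀ c, M.mulVec (borelCoord c) = borelCoord (T c)) :
    (normAbs M.det).toNNReal • (μ.comap borelCoord).map T =
      μ.comap borelCoord := by
  have hemb := (isOpenEmbedding_borelCoord (n := n) (F := F)).measurableEmbedding
  have hc : addEquivAddHaarChar (matrixEquiv M hM) = (normAbs M.det).toNNReal := by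
    apply NNReal.coe_injective
    rw [Real.coe_toNNReal _ (normAbs_nonneg _), addEquivAddHaarChar_eq_normAbs_det (matrixEquiv M hM) (Matrix.toLin' M) fun v => rfl,
      LinearMap.det_toLin']
  ext A hA
  rw [← hc, Measure.smul_apply, Measure.map_apply T.continuous.measurable hA, hemb.comap_apply,
    hemb.comap_apply, ← addEquivAddHaarChar_smul_preimage μ (X := borelCoord '' A) (matrixEquiv M hM)]
  refine congrArg _ (congrArg μ (Set.ext fun v => ?_))
  constructor
  · rintro ⟨c, hc, rfl⟩
    exact ⟨T c, hc, (hT c).symm⟩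
  · rintro ⟨c, hc, h⟩
    refine ⟨T.symm c, by simpa using hc, (matrixEquiv M hM).injective ?_⟩
    rw [← h]
    exact (hT _).trans (by rw [T.apply_symm_apply])

/-- The character `∏ |b_{ii}|^{k_i}` of the group of upper triangular matrices. -/
def borelChar (k : Fin n → ℤ) : borelSubgroup n F →* ℝ where
  toFun b := ∏ i, normAbs (((b : G n F) : Matrix (Fin n) (Fin n) F) i i) ^ k i
  map_one' := by simp
  map_mul' b c := by
    simp only [borel_diag_mul, normAbs_mul, mul_zpow, Finset.prod_mul_distrib]

theorem borelChar_apply (k : Fin n → ℤ) (b : borelSubgroup n F) : borelChar k b =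
    ∏ i, normAbs (((b : G n F) : Matrix (Fin n) (Fin n) F) i i) ^ k i := rfl

theorem borelChar_pos (k : Fin n → ℤ) (b : borelSubgroup n F) : 0 < borelChar k b := by
  rw [borelChar_apply]
  exact Finset.prod_pos fun i _ => zpow_pos (normAbs_pos (borel_diag_ne_zero b i)) _

theorem continuous_borelChar (k : Fin n → ℤ) :
    Continuous (borelChar k : borelSubgroup n F → ℝ) := by
  refine (continuous_finsetProd _ fun i _ => ?_ : Continuous fun b : borelSubgroup n F =>
    ∏ i, normAbs (((b : G n F) : Matrix (Fin n) (Fin n) F) i i) ^ k i)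
  exact Continuous.zpow₀ (Continuous.normAbs ((continuous_entry i i).comp continuous_subtype_val)
      fun b => borel_diag_ne_zero b i) _ fun b => Or.inl (normAbs_pos (borel_diag_ne_zero b i)).ne'

theorem normAbs_det_leftMulMatrix (b : borelSubgroup n F) :
    normAbs (leftMulMatrix b).det = borelChar (fun i => n - i) b := by
  rw [det_leftMulMatrix, normAbs_prod]
  refine Finset.prod_congr rfl fun i _ => ?_
  rw [← zpow_natCast, normAbs_zpow]
  congr 1
  have := i.2
  push_cast [this.le]
  rfl

theorem normAbs_det_rightMulMatrix (b : borelSubgroup n F) :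
    normAbs (rightMulMatrix b).det = borelChar (fun i => i + 1) b := by
  rw [det_rightMulMatrix, normAbs_prod]
  refine Finset.prod_congr rfl fun i _ => ?_
  rw [← zpow_natCast, normAbs_zpow]
  congr 1

/-- The quotient of the modulus of left and right multiplication. -/
def borelModulus (n : ℕ) (F : Type*) [NontriviallyNormedField F] [LocallyCompactSpace F] :
    borelSubgroup n F →* ℝ := borelChar fun i => n - 1 - 2 * i

theorem borelModulus_pos (b : borelSubgroup n F) : 0 < borelModulus n F b := borelChar_pos _ b

theorem borelModulus_mul (b : borelSubgroup n F) :
    borelModulus n F b * borelChar (fun i => i + 1) b = borelChar (fun i => n - i) b := by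
  rw [borelModulus, borelChar_apply, borelChar_apply, borelChar_apply, ← Finset.prod_mul_distrib]
  refine Finset.prod_congr rfl fun i _ => ?_
  rw [← zpow_add₀ (normAbs_pos (borel_diag_ne_zero b i)).ne']
  congr 1
  ring

/-- By the Jacobians of left and right multiplication, `db / ∏ |b_ii|^(n-i)` is a left and `db / ∏
|b_ii|^(i+1)` a right Haar measure, and `δ` is their quotient. Inversion makes the second one left
invariant, so uniqueness of Haar measure compares both with `ν`. -/
theorem isModulus_borelModulus [MeasurableSpace (borelSubgroup n F)] [BorelSpace (borelSubgroup n F)]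
    (ν : Measure (borelSubgroup n F)) [ν.IsHaarMeasure] :
    ∃ c, IsModulus ν (borelModulus n F) c := by
  borelize (UpperIndex n → F)
  let μV : Measure (UpperIndex n → F) := Measure.addHaar
  let μ0 : Measure (borelSubgroup n F) := μV.comap borelCoord
  have hemb := isOpenEmbedding_borelCoord (n := n) (F := F)
  have hfin : IsFiniteMeasureOnCompacts μ0 :=
    IsFiniteMeasureOnCompacts.comap' μV hemb.continuous hemb.measurableEmbedding
  have hloc : IsLocallyFiniteMeasure μ0 := inferInstance
  have hopen : μ0.IsOpenPosMeasure := Measure.IsOpenPosMeasure.comap μV hemb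
  let k (j : Fin n → ℤ) (b : borelSubgroup n F) : ℝ≥0 := ⟨borelChar j b, (borelChar_pos j b).le⟩
  have hkc : ∀ j, Continuous (k j) := fun j => (continuous_borelChar j).subtype_mk _
  have hk0 : ∀ j b, k j b ≠ 0 := fun j b h => (borelChar_pos j b).ne' (congrArg NNReal.toReal h)
  have hkm : ∀ j b c, k j (b * c) = k j b * k j c := fun j b c =>
    NNReal.eq (map_mul (borelChar j) b c)
  let d (j : Fin n → ℤ) : Measure (borelSubgroup n F) :=
    μ0.withDensity fun x => ((k j x)⁻¹ : ℝ≥0)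
  have hdloc : ∀ j, IsLocallyFiniteMeasure (d j) := fun j =>
    IsLocallyFiniteMeasure.withDensity_coe ((hkc j).inv₀ (hk0 j))
  have hdopen : ∀ j, (d j).IsOpenPosMeasure := fun j => by
    refine (withDensity_absolutelyContinuous' (μ := μ0)
      (f := fun x => (((k j x)⁻¹ : ℝ≥0) : ℝ≥0∞)) ?_ ?_).isOpenPosMeasure
    · exact ((hkc j).measurable.inv.coe_nnreal_ennreal).aemeasurable
    · exact Filter.Eventually.of_forall fun x => by simp [hk0]
  have hdint : ∀ j (f : borelSubgroup n F → ℝ), ∫ b, f b ∂(d j) =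
      ∫ b, (borelChar j b)⁻¹ * f b ∂μ0 := fun j f => by
    exact integral_withDensity_eq_integral_smul (f := fun x => (k j x)⁻¹) (hkc j).measurable.inv f
  have hL : (d fun i => n - i).IsMulLeftInvariant := ⟨fun b => by
    have hb : (normAbs (leftMulMatrix b).det).toNNReal = k (fun i => n - i) b :=
      NNReal.eq ((Real.coe_toNNReal _ (normAbs_nonneg _)).trans (normAbs_det_leftMulMatrix b))
    refine map_withDensity_inv μ0 (hkc _).measurable (Homeomorph.mulLeft b).toMeasurableEquiv
      (hk0 _ b) (fun x => hkm _ b x) ?_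
    rw [← hb]
    refine map_comap_borelCoord μV (Homeomorph.mulLeft b) (leftMulMatrix b) ?_
      fun c => leftMulMatrix_mulVec b c
    intro h
    have := normAbs_det_leftMulMatrix b
    rw [h] at this
    exact (borelChar_pos _ b).ne (by rw [← this]; simp [normAbs])⟩
  have hR : (d fun i => i + 1).IsMulRightInvariant := ⟨fun b => by
    have hb : (normAbs (rightMulMatrix b).det).toNNReal = k (fun i => i + 1) b :=
      NNReal.eq ((Real.coe_toNNReal _ (normAbs_nonneg _)).trans (normAbs_det_rightMulMatrix b))
    refine map_withDensity_inv μ0 (hkc _).measurable (Homeomorph.mulRight b).toMeasurableEquiv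
      (hk0 _ b) (fun x => (hkm _ x b).trans (mul_comm _ _)) ?_
    rw [← hb]
    refine map_comap_borelCoord μV (Homeomorph.mulRight b) (rightMulMatrix b) ?_
      fun c => rightMulMatrix_mulVec b c
    intro h
    have := normAbs_det_rightMulMatrix b
    rw [h] at this
    exact (borelChar_pos _ b).ne (by rw [← this]; simp [normAbs])⟩
  set νL := d fun i => n - i
  set νR := d fun i => i + 1
  have hνL : νL.IsHaarMeasure := {}
  have key : ∀ ψ : borelSubgroup n F → ℝ, ∫ b, borelModulus n F b * ψ b ∂νL = ∫ b, ψ b ∂νR := by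
    intro ψ
    rw [hdint, hdint]
    congr 1
    funext b
    rw [← borelModulus_mul, ← mul_assoc, mul_inv, mul_comm (borelModulus n F b)⁻¹, mul_assoc _ _⁻¹,
      inv_mul_cancel₀ (borelModulus_pos b).ne', mul_one]
  have hs := (Measure.haarScalarFactor_pos_of_isHaarMeasure νL ν).ne'
  -- The constant collects the factors by which `νL` and the inverse of `νR` differ from `ν`.
  refine ⟨(Measure.haarScalarFactor νL ν : ℝ)⁻¹ * Measure.haarScalarFactor νR.inv ν,
    fun ψ hψ hψc => ?_⟩
  have h1 := Measure.integral_isMulLeftInvariant_eq_smul_of_hasCompactSupport νL ν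
    (f := fun b => borelModulus n F b * ψ b) ((continuous_borelChar _).mul hψ) hψc.mul_left
  have h2 := Measure.integral_isMulLeftInvariant_eq_smul_of_hasCompactSupport νR.inv ν
    (f := fun b => ψ b⁻¹) (hψ.comp continuous_inv) (hψc.comp_homeomorph (Homeomorph.inv _))
  have h3 : ∫ b, ψ b⁻¹ ∂νR.inv = ∫ b, ψ b ∂νR := by
    rw [Measure.inv]
    have := (Homeomorph.inv (borelSubgroup n F)).measurableEmbedding.integral_map (μ := νR)
      (fun b => ψ b⁻¹)
    simpa using this
  rw [h3, ← key, h1, integral_smul_nnreal_measure, integral_smul_nnreal_measure, NNReal.smul_def,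
    NNReal.smul_def, smul_eq_mul, smul_eq_mul] at h2
  rw [mul_assoc, ← h2, inv_mul_cancel_left₀ (by exact_mod_cast hs)]

end BorelModulus

/-! ### Reduction modulo the Borel subgroup -/

section Reduction

variable {n : ℕ} {F : Type*} [NontriviallyNormedField F]

/-- Gaussian elimination from the bottom row upwards: an entry of maximal norm in the current row
becomes the pivot, the row is divided by it, and the entries above it are cleared. Rows are only
added to rows above, so the operations are upper triangular, and the pivot columns of lower rows
already vanish in the current row and are not disturbed. -/
theorem exists_borel_mul_pivot (g : G n F) (k : ℕ) (hk : k ≤ n) :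
    ∃ (b : borelSubgroup n F) (c : Fin n → Fin n), ∀ i : Fin n, n ≤ i + k →
      (∀ j, ‖((b * g : G n F) : Matrix (Fin n) (Fin n) F) i j‖ ≤ 1) ∧
      ((b * g : G n F) : Matrix (Fin n) (Fin n) F) i (c i) = 1 ∧
      ∀ i' < i, ((b * g : G n F) : Matrix (Fin n) (Fin n) F) i' (c i) = 0 := by
  induction k with
  | zero => exact ⟨1, id, fun i hi => absurd i.2 (by omega)⟩
  | succ k ih =>
    obtain ⟨b, c, hb⟩ := ih (by omega)
    set h : G n F := b * g with hh
    -- The last row not treated yet.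
    let i0 : Fin n := ⟨n - k - 1, by omega⟩
    have hne : ∃ j, (h : Matrix (Fin n) (Fin n) F) i0 j ≠ 0 := by
      by_contra! h0
      exact det_ne_zero h (Matrix.det_eq_zero_of_row_eq_zero i0 h0)
    have : Nonempty (Fin n) := ⟨i0⟩
    obtain ⟨j0, hj0⟩ := Finite.exists_max fun j => ‖(h : Matrix (Fin n) (Fin n) F) i0 j‖
    have hp : (h : Matrix (Fin n) (Fin n) F) i0 j0 ≠ 0 := by
      obtain ⟨j, hj⟩ := hne
      exact norm_pos_iff.1 ((norm_pos_iff.2 hj).trans_le (hj0 j))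
    set q := (h : Matrix (Fin n) (Fin n) F) i0 j0 with hq
    let u : Fin n → F := fun p => if p < i0 then -((h : Matrix (Fin n) (Fin n) F) p j0 / q)
      else if p = i0 then q⁻¹ else 0
    let M : Matrix (Fin n) (Fin n) F := (1 : Matrix (Fin n) (Fin n) F).updateCol i0 u
    have hM : M.BlockTriangular id := by
      intro p r hpr
      by_cases hr : r = i0
      · subst hr
        have hpr : i0 < p := hpr
        simp [M, u, hpr.not_gt, hpr.ne']
      · have hpr : r < p := hpr
        simp [M, hr, hpr.ne']
    have hMdet : M.det ≠ 0 := by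
      rw [Matrix.det_of_isUpperTriangular hM, Finset.prod_ne_zero_iff]
      intro p _
      by_cases hp' : p = i0
      · subst hp'; simp [M, u, hp]
      · simp [M, hp']
    let b' : borelSubgroup n F := ⟨Matrix.GeneralLinearGroup.mkOfDetNeZero M hMdet, hM⟩
    have hmul : ∀ p r, ((b' * h : G n F) : Matrix (Fin n) (Fin n) F) p r =
        (if p = i0 then 0 else (h : Matrix (Fin n) (Fin n) F) p r) +
          u p * (h : Matrix (Fin n) (Fin n) F) i0 r := by
      intro p r
      change (M * (h : Matrix (Fin n) (Fin n) F)) p r = _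
      rw [Matrix.mul_apply, ← Finset.add_sum_erase _ _ (Finset.mem_univ i0), add_comm]
      congr 1
      · rw [Finset.sum_congr rfl (g := fun x => if p = x then
          (if p = i0 then 0 else (h : Matrix (Fin n) (Fin n) F) p r) else 0)]
        · rw [Finset.sum_ite_eq]
          split_ifs <;> simp_all
        · intro x hx
          have hx' := Finset.ne_of_mem_erase hx
          by_cases hpx : p = x
          · subst hpx; simp [M, hx']
          · simp [M, hx', hpx]
      · simp [M]
    refine ⟨b' * b, Function.update c i0 j0, fun i hi => ?_⟩
    have hassoc : (((b' * b : borelSubgroup n F) : G n F) * g) = b' * h := by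
      rw [Subgroup.coe_mul, mul_assoc]
    rw [hassoc]
    simp only [hmul]
    by_cases hii : i = i0
    · subst hii
      simp only [lt_irrefl, if_true, if_false, u, Function.update_self, zero_add]
      refine ⟨fun j => ?_, inv_mul_cancel₀ hp, fun i' hi' => ?_⟩
      · rw [norm_mul, norm_inv, inv_mul_le_one₀ (norm_pos_iff.2 hp)]
        exact hj0 j
      · rw [if_neg hi'.ne, if_pos hi', ← hq, neg_mul, div_mul_cancel₀ _ hp, add_neg_cancel]
    · have hgt : i0 < i := by
        rw [Fin.lt_def]
        have : (i : ℕ) ≠ n - k - 1 := fun h => hii (Fin.ext h)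
        change n - k - 1 < (i : ℕ)
        omega
      obtain ⟨h1, h2, h3⟩ := hb i (by have := Fin.lt_def.1 hgt; change n - k - 1 < (i : ℕ) at this; omega)
      have hu : u i = 0 := by simp [u, hgt.not_gt, hii]
      simp only [hii, if_false, hu, zero_mul, add_zero, Function.update_of_ne hii]
      refine ⟨h1, h2, fun i' hi' => ?_⟩
      rw [h3 i0 hgt, mul_zero, add_zero, h3 i' hi', ite_self]

/-- The pivots of the elimination lie in distinct columns; permuting these makes the matrix lower
triangular with diagonal `1`, so the determinant is `±1`. This takes the place of the Iwasawa
decomposition for ultrametric and Archimedean fields alike. -/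
theorem exists_borel_mul_bounded (g : G n F) : ∃ b : borelSubgroup n F,
    (∀ i j, ‖((b * g : G n F) : Matrix (Fin n) (Fin n) F) i j‖ ≤ 1) ∧
    ‖((b * g : G n F) : Matrix (Fin n) (Fin n) F).det‖ = 1 := by
  obtain ⟨b, c, hb⟩ := exists_borel_mul_pivot g n le_rfl
  have hb := fun i => hb i (by omega)
  refine ⟨b, fun i => (hb i).1, ?_⟩
  set M := ((b * g : G n F) : Matrix (Fin n) (Fin n) F)
  have hc : Function.Injective c := by
    have key : ∀ i i', i' < i → c i ≠ c i' := by
      intro i i' h hcc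
      have h1 := (hb i).2.2 i' h
      rw [hcc, (hb i').2.1] at h1
      exact one_ne_zero h1
    intro i i' h
    rcases lt_trichotomy i i' with h1 | h1 | h1
    · exact absurd h.symm (key _ _ h1)
    · exact h1
    · exact absurd h (key _ _ h1)
  let e : Equiv.Perm (Fin n) := Equiv.ofBijective c (Finite.injective_iff_bijective.1 hc)
  have h1 := Matrix.det_permute' e M
  have h2 : (M.submatrix id e).det = 1 := by
    rw [Matrix.det_of_isLowerTriangular]
    · exact Finset.prod_eq_one fun i _ => (hb i).2.1
    · intro i j hij
      exact (hb j).2.2 i hij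
  rw [h2] at h1
  have h3 := congrArg norm h1
  rw [norm_one, norm_mul] at h3
  have h4 : ‖((Equiv.Perm.sign e : ℤ) : F)‖ = 1 := by
    rcases Int.units_eq_one_or (Equiv.Perm.sign e) with h | h <;> simp [h]
  rw [h4, one_mul] at h3
  exact h3.symm

end Reduction

end Shintani

namespace Shintani

set_option linter.unusedSectionVars false

/-! ### Bounded elements -/

section Bounded

variable {n : ℕ} {F : Type*} [NontriviallyNormedField F]

/-- The elements `g` such that the entries of `g` and of `g⁻¹` have norm at most `C`. -/
def boundedSet (n : ℕ) (F : Type*) [NontriviallyNormedField F] (C : ℝ) : Set (G n F) :=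
  {g | (∀ i j, ‖(g : Matrix (Fin n) (Fin n) F) i j‖ ≤ C) ∧
      ∀ i j, ‖((g⁻¹ : G n F) : Matrix (Fin n) (Fin n) F) i j‖ ≤ C}

theorem exists_norm_adjugate_le (n : ℕ) (F : Type*) [NontriviallyNormedField F]
    [LocallyCompactSpace F] : ∃ C : ℝ, 1 ≤ C ∧ ∀ M : Matrix (Fin n) (Fin n) F,
      (∀ i j, ‖M i j‖ ≤ 1) → ∀ i j, ‖M.adjugate i j‖ ≤ C := by
  have := ProperSpace.of_locallyCompactSpace F (E := F)
  have hK : IsCompact (Set.univ.pi fun _ : Fin n => Set.univ.pi fun _ : Fin n =>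
        Metric.closedBall (0 : F) 1) :=
      isCompact_univ_pi fun _ => isCompact_univ_pi fun _ => isCompact_closedBall _ _
  have hc : Continuous fun M : Matrix (Fin n) (Fin n) F => ∑ i, ∑ j, ‖M.adjugate i j‖ :=
    continuous_finsetSum _ fun i _ => continuous_finsetSum _ fun j _ =>
      ((continuous_id.matrix_adjugate).matrix_elem i j).norm
  obtain ⟨C, hC⟩ := hK.bddAbove_image hc.continuousOn
  refine ⟨max 1 C, le_max_left _ _, fun M hM i j => le_max_of_le_right ?_⟩
  have h1 := hC ⟨M, fun i _ j _ => mem_closedBall_zero_iff.2 (hM i j), rfl⟩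
  refine le_trans ?_ h1
  refine le_trans ?_ (Finset.single_le_sum (f := fun i => ∑ j, ‖M.adjugate i j‖)
    (fun i _ => Finset.sum_nonneg fun j _ => norm_nonneg _) (Finset.mem_univ i))
  exact Finset.single_le_sum (f := fun j => ‖M.adjugate i j‖)
    (fun j _ => norm_nonneg _) (Finset.mem_univ j)

theorem mem_boundedSet_of_det {C : ℝ} (hC : 1 ≤ C) (h : ∀ M : Matrix (Fin n) (Fin n) F,
      (∀ i j, ‖M i j‖ ≤ 1) → ∀ i j, ‖M.adjugate i j‖ ≤ C) {g : G n F}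
    (hg : ∀ i j, ‖(g : Matrix (Fin n) (Fin n) F) i j‖ ≤ 1)
    (hdet : ‖(g : Matrix (Fin n) (Fin n) F).det‖ = 1) : g ∈ boundedSet n F C := by
  refine ⟨fun i j => (hg i j).trans hC, fun i j => ?_⟩
  have h1 : ((g⁻¹ : G n F) : Matrix (Fin n) (Fin n) F) i j =
      (g : Matrix (Fin n) (Fin n) F).det⁻¹ * (g : Matrix (Fin n) (Fin n) F).adjugate i j := by
    rw [coe_inv_eq]; rfl
  rw [h1, norm_mul, norm_inv, hdet, inv_one, one_mul]
  exact h _ hg i j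

variable [IsUltrametricDist F]

theorem norm_det_le_one {M : Matrix (Fin n) (Fin n) F} (hM : ∀ i j, ‖M i j‖ ≤ 1) : ‖M.det‖ ≤ 1 := by
  rw [Matrix.det_apply']
  refine IsUltrametricDist.norm_sum_le_of_forall_le_of_nonneg zero_le_one fun s _ => ?_
  have h4 : ‖((Equiv.Perm.sign s : ℤ) : F)‖ = 1 := by
    rcases Int.units_eq_one_or (Equiv.Perm.sign s) with h | h <;> simp [h]
  rw [norm_mul, h4, one_mul, norm_prod]
  exact Finset.prod_le_one (fun _ _ => norm_nonneg _) fun i _ => hM _ _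

theorem norm_adjugate_le_one {M : Matrix (Fin n) (Fin n) F} (hM : ∀ i j, ‖M i j‖ ≤ 1) (i j : Fin n) :
    ‖M.adjugate i j‖ ≤ 1 := by
  rw [Matrix.adjugate_apply]
  refine norm_det_le_one fun p q => ?_
  by_cases hp : p = j
  · subst hp
    rw [Matrix.updateRow_self]
    by_cases hq : q = i
    · subst hq; simp
    · simp [hq]
  · rw [Matrix.updateRow_ne hp]; exact hM p q

variable (n F) in
/-- The group of the elements `g` such that the entries of `g` and of `g⁻¹` are integral. -/
def integralSubgroup : Subgroup (G n F) where
  carrier := boundedSet n F 1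
  one_mem' := by
    have h : ∀ i j, ‖(1 : Matrix (Fin n) (Fin n) F) i j‖ ≤ 1 := fun i j => by
      by_cases h : i = j
      · subst h; simp
      · simp [Matrix.one_apply_ne h]
    exact ⟨h, by rw [inv_one]; exact h⟩
  mul_mem' := by
    have h : ∀ M N : Matrix (Fin n) (Fin n) F, (∀ i j, ‖M i j‖ ≤ 1) → (∀ i j, ‖N i j‖ ≤ 1) →
        ∀ i j, ‖(M * N) i j‖ ≤ 1 := fun M N hM hN i j => by
      rw [Matrix.mul_apply]
      refine IsUltrametricDist.norm_sum_le_of_forall_le_of_nonneg zero_le_one fun s _ => ?_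
      rw [norm_mul]
      exact mul_le_one₀ (hM _ _) (norm_nonneg _) (hN _ _)
    intro x y hx hy
    refine ⟨h _ _ hx.1 hy.1, ?_⟩
    rw [mul_inv_rev]
    exact h _ _ hy.2 hx.2
  inv_mem' := fun {x} hx => ⟨hx.2, by rw [inv_inv]; exact hx.1⟩

theorem isOpen_integralSubgroup : IsOpen (integralSubgroup n F : Set (G n F)) := by
  refine Subgroup.isOpen_of_mem_nhds _ (g := 1) ?_
  have h1 : ∀ i j, ∀ᶠ g : G n F in 𝓝 1,
      ‖(g : Matrix (Fin n) (Fin n) F) i j - (1 : Matrix (Fin n) (Fin n) F) i j‖ < 1 := fun i j =>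
    ((((continuous_entry i j).sub continuous_const).norm).tendsto 1).eventually_lt_const (by simp)
  have h2 : ∀ i j, ∀ᶠ g : G n F in 𝓝 1,
      ‖((g⁻¹ : G n F) : Matrix (Fin n) (Fin n) F) i j - (1 : Matrix (Fin n) (Fin n) F) i j‖ < 1 :=
    fun i j => ((((continuous_entry_inv i j).sub continuous_const).norm).tendsto
      1).eventually_lt_const (by simp)
  have h3 : ∀ i j, ‖(1 : Matrix (Fin n) (Fin n) F) i j‖ ≤ 1 :=
    fun i j => by
      by_cases h : i = j
      · subst h; simp
      · simp [Matrix.one_apply_ne h]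
  have key : ∀ x y : F, ‖x - y‖ < 1 → ‖y‖ ≤ 1 → ‖x‖ ≤ 1 := fun x y hxy hy => by
    have := IsUltrametricDist.norm_add_le_max (x - y) y
    rw [sub_add_cancel] at this
    exact this.trans (max_le hxy.le hy)
  filter_upwards [eventually_all.2 fun i => eventually_all.2 (h1 i),
    eventually_all.2 fun i => eventually_all.2 (h2 i)] with g hg1 hg2
  exact ⟨fun i j => key _ _ (hg1 i j) (h3 i j), fun i j => key _ _ (hg2 i j) (h3 i j)⟩

theorem isCompact_integralSubgroup [LocallyCompactSpace F] :
    IsCompact (integralSubgroup n F : Set (G n F)) := isCompact_bounded 1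

theorem exists_borel_mul_integral (g : G n F) :
    ∃ b : borelSubgroup n F, (b : G n F) * g ∈ integralSubgroup n F := by
  obtain ⟨b, h1, h2⟩ := exists_borel_mul_bounded g
  exact ⟨b, mem_boundedSet_of_det le_rfl (fun _ hM => norm_adjugate_le_one hM) h1 h2⟩

end Bounded

/-! ### The invariant functional on functions covariant under the Borel subgroup -/

section Functional

variable {n : ℕ} [NeZero n] {F : Type*} [NontriviallyNormedField F] [LocallyCompactSpace F]

theorem isClosedEmbedding_borel : IsClosedEmbedding (borelSubgroup n F).subtype :=
  isClosed_borelSubgroup.isClosedEmbedding_subtypeVal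

variable [MeasurableSpace (G n F)] [BorelSpace (G n F)]

/-- A weight of compact support for integration modulo the Borel subgroup. -/
def IsBorelUnit (η : G n F → ℝ) : Prop :=
  ∃ (_ : MeasurableSpace (borelSubgroup n F)) (_ : BorelSpace (borelSubgroup n F)),
    IsCosetUnit (borelSubgroup n F).subtype (Measure.haar : Measure (borelSubgroup n F)) η

/-- The integral over the quotient by the Borel subgroup. -/
def borelIntegral (η : G n F → ℝ) (f : G n F → ℂ) : ℂ :=
  ∫ g, (η g : ℂ) * f g ∂(Measure.haar : Measure (G n F))

/-- `f(bg) = δ(b) f(g)` for the modulus `δ` of the Borel subgroup. -/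
abbrev IsBorelCovariant (f : G n F → ℂ) : Prop :=
  IsCovariant (borelSubgroup n F).subtype (borelModulus n F) f

theorem exists_isBorelUnit {φ : G n F → ℝ} (hφ : Continuous φ) (hφc : HasCompactSupport φ)
    (hφ0 : ∀ g, 0 ≤ φ g) (hφpos : ∀ g, ∃ b : borelSubgroup n F, 0 < φ (b * g)) :
    ∃ η : G n F → ℝ, IsBorelUnit η ∧ ∀ g, 0 < φ g → 0 < η g := by
  borelize ↥(borelSubgroup n F)
  obtain ⟨η, h1, h2⟩ := exists_isCosetUnit (isClosedEmbedding_borel (n := n) (F := F))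
    (Measure.haar : Measure (borelSubgroup n F)) hφ hφc hφ0 fun g => by
      obtain ⟨b, hb⟩ := hφpos g
      exact ⟨b⁻¹, by simpa using hb⟩
  exact ⟨η, ⟨_, ‹_›, h1⟩, h2⟩

theorem borelIntegral_mul_right {η : G n F → ℝ} (hη : IsBorelUnit η) {f : G n F → ℂ}
    (hf : Continuous f) (hfδ : IsBorelCovariant f) (h : G n F) :
    borelIntegral η (fun g => f (g * h)) = borelIntegral η f := by
  obtain ⟨_, _, hη⟩ := hη
  obtain ⟨c, hc⟩ := isModulus_borelModulus (Measure.haar : Measure (borelSubgroup n F))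
  have := isMulRightInvariant_GL (Measure.haar : Measure (G n F))
  exact hη.integral_mul_right isClosedEmbedding_borel (continuous_borelChar _) hc hf hfδ h

theorem exists_borelIntegral_comp {η : G n F → ℝ} (hη : IsBorelUnit η) (θ : G n F ≃ₜ* G n F)
    (hθ : ∀ g, g ∈ borelSubgroup n F ↔ θ g ∈ borelSubgroup n F) :
    ∃ a : ℝ, ∀ f : G n F → ℂ, Continuous f → IsBorelCovariant f →
      borelIntegral η (fun g => f (θ g)) = a * borelIntegral η f := by
  obtain ⟨_, _, hη⟩ := hη
  obtain ⟨c, hc⟩ := isModulus_borelModulus (Measure.haar : Measure (borelSubgroup n F))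
  have hθs : ∀ b : borelSubgroup n F, θ.symm b ∈ borelSubgroup n F := fun b => by
    rw [hθ, θ.apply_symm_apply]; exact b.2
  let θB : borelSubgroup n F ≃ₜ* borelSubgroup n F :=
    { toFun := fun b => ⟨θ b, (hθ b).1 b.2⟩
      invFun := fun b => ⟨θ.symm b, hθs b⟩
      left_inv := fun b => by ext1; simp
      right_inv := fun b => by ext1; simp
      map_mul' := fun b c => by ext1; simp
      continuous_toFun := (θ.continuous.comp continuous_subtype_val).subtype_mk _
      continuous_invFun := (θ.symm.continuous.comp continuous_subtype_val).subtype_mk hθs }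
  exact hη.exists_integral_comp isClosedEmbedding_borel (continuous_borelChar _) hc θ θB
    fun b => rfl

theorem borelIntegral_add {η : G n F → ℝ} (hη : IsBorelUnit η) {f f' : G n F → ℂ}
    (hf : Continuous f) (hf' : Continuous f') :
    borelIntegral η (f + f') = borelIntegral η f + borelIntegral η f' := by
  obtain ⟨_, _, hη⟩ := hη
  have h : ∀ f : G n F → ℂ, Continuous f →
      Integrable (fun g => (η g : ℂ) * f g) (Measure.haar : Measure (G n F)) := fun f hf => by
    refine Continuous.integrable_of_hasCompactSupport
      ((Complex.continuous_ofReal.comp hη.continuous).mul hf) ?_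
    exact (hη.hasCompactSupport.comp_left (g := Complex.ofReal) rfl).mul_right
  rw [borelIntegral, borelIntegral, borelIntegral, ← integral_add (h f hf) (h f' hf')]
  simp only [Pi.add_apply, mul_add]

theorem borelIntegral_smul (η : G n F → ℝ) (a : ℂ) (f : G n F → ℂ) :
    borelIntegral η (a • f) = a * borelIntegral η f := by
  rw [borelIntegral, borelIntegral, ← integral_const_mul]
  congr 1
  funext g
  simp only [Pi.smul_apply, smul_eq_mul]
  ring

/-- A positive covariant function with the right invariance properties of `φ`. -/
theorem exists_isBorelCovariant {φ : G n F → ℝ} (hφ : Continuous φ) (hφc : HasCompactSupport φ)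
    (hφ0 : ∀ g, 0 ≤ φ g) (hφpos : ∀ g, ∃ b : borelSubgroup n F, 0 < φ (b * g)) :
    ∃ f : G n F → ℝ, Continuous f ∧ IsBorelCovariant (fun g => (f g : ℂ)) ∧ (∀ g, 0 < f g) ∧
      ∀ u, (∀ g, φ (g * u) = φ g) → ∀ g, f (g * u) = f g := by
  borelize ↥(borelSubgroup n F)
  refine ⟨cosetIntegral (borelSubgroup n F).subtype Measure.haar (borelModulus n F) φ,
    continuous_cosetIntegral isClosedEmbedding_borel _ (continuous_borelChar _) hφ hφc,
    fun b g => ?_, fun g => ?_, fun u hu g => ?_⟩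
  · beta_reduce
    rw [cosetIntegral_mul_left]
    push_cast
    rfl
  · obtain ⟨b, hb⟩ := hφpos g
    exact cosetIntegral_pos isClosedEmbedding_borel _ (continuous_borelChar _) borelModulus_pos
      hφ hφc hφ0 (b := b⁻¹) (by simpa using hb)
  · simp only [cosetIntegral, ← mul_assoc, hu]

theorem borelIntegral_pos {η : G n F → ℝ} (hη : IsBorelUnit η) {f : G n F → ℝ}
    (hf : Continuous f) (hf0 : ∀ g, 0 < f g) :
    ∃ a : ℝ, 0 < a ∧ borelIntegral η (fun g => (f g : ℂ)) = a := by
  obtain ⟨_, _, hη⟩ := hη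
  refine ⟨∫ g, η g * f g ∂(Measure.haar : Measure (G n F)), ?_, ?_⟩
  · have h0 : ∃ g, η g ≠ 0 := by
      by_contra! h0
      have := hη.cosetIntegral_eq 1
      simp [cosetIntegral, h0] at this
    obtain ⟨g, hg⟩ := h0
    exact Continuous.integral_pos_of_hasCompactSupport_nonneg_nonzero (x := g)
      (hη.continuous.mul hf) hη.hasCompactSupport.mul_right
      (fun g => mul_nonneg (hη.nonneg g) (hf0 g).le) (mul_ne_zero hg (hf0 g).ne')
  · rw [borelIntegral, ← integral_complex_ofReal]
    simp

/-- An automorphism of finite order preserves the functional. -/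
theorem borelIntegral_comp {η : G n F → ℝ} (hη : IsBorelUnit η) (θ : G n F ≃ₜ* G n F)
    (hθ : ∀ g, g ∈ borelSubgroup n F ↔ θ g ∈ borelSubgroup n F) {l : ℕ} (hl : l ≠ 0)
    (hθl : ∀ g, θ^[l] g = g)
    (hcov : ∀ b : borelSubgroup n F, borelModulus n F ⟨θ b, (hθ b).1 b.2⟩ = borelModulus n F b)
    {f₀ : G n F → ℝ} (hf₀ : Continuous f₀) (hf₀δ : IsBorelCovariant (fun g => (f₀ g : ℂ)))
    (hf₀pos : ∀ g, 0 < f₀ g) {f : G n F → ℂ} (hf : Continuous f) (hfδ : IsBorelCovariant f) :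
    borelIntegral η (fun g => f (θ g)) = borelIntegral η f := by
  obtain ⟨a, ha⟩ := exists_borelIntegral_comp hη θ hθ
  -- Applying the scaling `l` times gives `a^l = 1`. The positive function `f₀` has positive
  -- integral before and after composition with `θ`, which makes `a` non-negative and justifies the
  -- cancellation.
  suffices a = 1 by rw [ha f hf hfδ, this]; simp
  have hcont : ∀ k : ℕ, Continuous fun g => (f₀ (θ^[k] g) : ℂ) := fun k =>
    Complex.continuous_ofReal.comp (hf₀.comp (θ.continuous.iterate k))
  have hc : ∀ k : ℕ, IsBorelCovariant fun g => (f₀ (θ^[k] g) : ℂ) := by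
    intro k
    induction k with
    | zero => exact hf₀δ
    | succ k ih =>
      intro b g
      simp only [Function.iterate_succ_apply, map_mul]
      have := ih ⟨θ b, (hθ b).1 b.2⟩ (θ g)
      rw [hcov] at this
      exact this
  have hk : ∀ k : ℕ, borelIntegral η (fun g => (f₀ (θ^[k] g) : ℂ)) =
      a ^ k * borelIntegral η fun g => (f₀ g : ℂ) := by
    intro k
    induction k with
    | zero => simp
    | succ k ih =>
      have := ha _ (hcont k) (hc k)
      simp only [Function.iterate_succ_apply]
      rw [this, ih]
      ring
  obtain ⟨x, hx, hx'⟩ := borelIntegral_pos hη hf₀ hf₀pos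
  obtain ⟨y, hy, hy'⟩ := borelIntegral_pos hη (hf₀.comp θ.continuous) fun g => hf₀pos (θ g)
  have h1 := hk l
  simp only [hθl, hx'] at h1
  have h2 := hk 1
  simp only [Function.iterate_one, pow_one, hx'] at h2
  have h3 : (y : ℂ) = a * x := hy'.symm.trans h2
  have h4 : y = a * x := by exact_mod_cast h3
  have ha0 : 0 ≤ a := by
    by_contra! h
    nlinarith
  have h5 : x = a ^ l * x := by exact_mod_cast h1
  have h6 : a ^ l = 1 := by
    have := hx.ne'
    field_simp at h5
    exact h5.symm
  exact (pow_eq_one_iff_of_nonneg ha0 hl).1 h6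

end Functional

end Shintani

namespace Shintani

set_option linter.unusedSectionVars false

/-! ### Continuous characters -/

theorem LocallyIntegrable.continuous_mul {H : Type*} [TopologicalSpace H] [MeasurableSpace H]
    [BorelSpace H] {μ : Measure H} {f χ : H → ℂ} (hf : LocallyIntegrable f μ) (hχ : Continuous χ) :
    LocallyIntegrable (fun x => χ x * f x) μ := by
  intro x
  obtain ⟨N, hN, hint⟩ := hf x
  have h1 : ∀ᶠ y in 𝓝 x, ‖χ y‖ < ‖χ x‖ + 1 :=
    (hχ.norm.tendsto x).eventually_lt_const (lt_add_one _)
  obtain ⟨U, hU, hUo, hxU⟩ := eventually_nhds_iff.1 h1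
  refine ⟨N ∩ U, inter_mem hN (hUo.mem_nhds hxU), ?_⟩
  have h2 := hint.mono_set (Set.inter_subset_left : N ∩ U ⊆ N)
  refine Integrable.bdd_mul (c := ‖χ x‖ + 1) h2 hχ.aestronglyMeasurable ?_
  have h3 : ∀ᵐ y ∂(μ.restrict U), ‖χ y‖ ≤ ‖χ x‖ + 1 :=
    (ae_restrict_iff' hUo.measurableSet).2 (ae_of_all _ fun y hy => (hU y hy).le)
  exact ae_mono (Measure.restrict_mono Set.inter_subset_right le_rfl) h3

/-! ### Characters on unipotent elements and shifts of the exponents -/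

section LinearCharacters

variable {n : ℕ} [NeZero n] {F : Type*} [NontriviallyNormedField F]

theorem map_eq_of_det_eq {A : Type*} [CommMonoid A] (χ : G n F →* A) {g h : G n F}
    (hd : (g : Matrix (Fin n) (Fin n) F).det = (h : Matrix (Fin n) (Fin n) F).det) : χ g = χ h := by
  have : Infinite F := NontriviallyNormedField.infinite F
  rw [map_eq_map_dilation_det χ 0 g, map_eq_map_dilation_det χ 0 h]
  congr 2
  ext
  exact hd

theorem det_of_isUnip {c : Fin n → Fin n} (hc : Monotone c) {g : G n F} (hg : IsUnip c g) :
    (g : Matrix (Fin n) (Fin n) F).det = 1 := by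
  rw [Matrix.det_of_isUpperTriangular]
  · exact Finset.prod_eq_one fun i _ => by rw [hg i i le_rfl, if_pos rfl]
  · intro i j hij
    have hij : j < i := hij
    rw [hg i j (hc hij.le), if_neg hij.ne']

theorem map_eq_one_of_isUnip {A : Type*} [CommMonoid A] (χ : G n F →* A) {c : Fin n → Fin n}
    (hc : Monotone c) {g : G n F} (hg : IsUnip c g) : χ g = 1 := by
  rw [← map_one χ]
  refine map_eq_of_det_eq χ ?_
  rw [det_of_isUnip hc hg, Units.val_one, Matrix.det_one]

theorem continuous_dilation (i : Fin n) : Continuous (dilation i : Fˣ → G n F) := by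
  refine continuous_GL_iff.2 ?_
  simp only [coe_dilation]
  refine Continuous.matrix_diagonal ?_
  exact continuous_const.update i Units.continuous_val

theorem continuous_detGL :
    Continuous (Matrix.GeneralLinearGroup.det : G n F → Fˣ) := by
  refine Units.continuous_iff.2 ⟨?_, ?_⟩
  · exact Units.continuous_val.matrix_det
  · have : (fun g : G n F => (((Matrix.GeneralLinearGroup.det g)⁻¹ : Fˣ) : F)) =
      fun g : G n F => ((g : Matrix (Fin n) (Fin n) F).det)⁻¹ := by
      funext g
      rw [Units.val_inv_eq_inv_val]; rfl
    exact this ▸ (Units.continuous_val.matrix_det.inv₀ fun g => det_ne_zero g)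

theorem det_levi_eq_prod {c : Fin n → Fin n} {m : G n F} (hm : m ∈ levi F c) :
    (m : Matrix (Fin n) (Fin n) F).det = ∏ k, blockDet c k m := by
  have h : (m : Matrix (Fin n) (Fin n) F).BlockTriangular c := fun i j hij => (hm i j hij.ne').1
  exact h.det_fintype

theorem blockDet_ne_zero {c : Fin n → Fin n} {m : G n F} (hm : m ∈ levi F c) (k : Fin n) :
    blockDet c k m ≠ 0 := by
  have := det_ne_zero m
  rw [det_levi_eq_prod hm, Finset.prod_ne_zero_iff] at this
  exact this k (Finset.mem_univ k)

theorem indWeight_add [LocallyCompactSpace F] (b : Fin n → Fin n) {c : Fin n → Fin n}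
    (α : Fin n → ℝ) (s : ℝ) {m : G n F}
    (hm : m ∈ levi F c) : indWeight b c (fun k => α k + s) m =
      indWeight b c α m * normAbs (m : Matrix (Fin n) (Fin n) F).det ^ s := by
  rw [indWeight, indWeight, mul_assoc]
  congr 1
  rw [det_levi_eq_prod hm, normAbs_prod, ← Real.finsetProd_rpow _ _ fun k _ => normAbs_nonneg _,
    ← Finset.prod_mul_distrib]
  exact Finset.prod_congr rfl fun k _ => Real.rpow_add (normAbs_pos (blockDet_ne_zero hm k)) _ _

end LinearCharacters

/-! ### Unitary part of a character -/

section UnitaryPart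

variable {n : ℕ} {F : Type*} [NontriviallyNormedField F] [LocallyCompactSpace F]

/-- `χ = χ₀ |det|^s` with `χ₀` unitary. -/
structure IsUnitaryPart (s : ℝ) (χ χ₀ : G n F →ₜ* ℂˣ) : Prop where
  eq : ∀ g, (χ g : ℂ) = (normAbs (g : Matrix (Fin n) (Fin n) F).det ^ s : ℝ) * (χ₀ g : ℂ)
  norm_eq : ∀ g, ‖(χ₀ g : ℂ)‖ = 1

/-- The character `|det|^z`. -/
def absDet (n : ℕ) (F : Type*) [NontriviallyNormedField F] [LocallyCompactSpace F] (z : ℂ) :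
    G n F →ₜ* ℂˣ where
  toFun g := Units.mk0 ((normAbs (g : Matrix (Fin n) (Fin n) F).det : ℂ) ^ z) (by
    have := (normAbs_pos (det_ne_zero g)).ne'
    rw [Complex.cpow_def_of_ne_zero (by exact_mod_cast this)]
    exact Complex.exp_ne_zero _)
  map_one' := by ext; simp
  map_mul' g h := by
    ext
    simp only [Units.val_mk0, Units.val_mul, Matrix.det_mul, normAbs_mul, Complex.ofReal_mul]
    exact Complex.mul_cpow_ofReal_nonneg (normAbs_nonneg _) (normAbs_nonneg _) z
  continuous_toFun := by
    have h0 : ∀ g : G n F, normAbs (g : Matrix (Fin n) (Fin n) F).det ∈ Set.Ioi (0 : ℝ) :=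
      fun g => normAbs_pos (det_ne_zero g)
    have hc : Continuous fun g : G n F => normAbs (g : Matrix (Fin n) (Fin n) F).det :=
      Continuous.normAbs Units.continuous_val.matrix_det det_ne_zero
    have h1 : Continuous fun g : G n F =>
        (normAbs (g : Matrix (Fin n) (Fin n) F).det : ℂ) ^ z := by
      refine Continuous.cpow (Complex.continuous_ofReal.comp hc) continuous_const fun g => ?_
      rw [Complex.mem_slitPlane_iff]
      exact Or.inl (h0 g)
    refine Units.continuous_iff.2 ⟨h1, ?_⟩
    simp only [Units.val_inv_eq_inv_val, Units.val_mk0]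
    exact h1.inv₀ fun g => by
      rw [Complex.cpow_def_of_ne_zero (by exact_mod_cast (h0 g).ne')]
      exact Complex.exp_ne_zero _

theorem absDet_apply (z : ℂ) (g : G n F) :
    (absDet n F z g : ℂ) = (normAbs (g : Matrix (Fin n) (Fin n) F).det : ℂ) ^ z := rfl

theorem absDet_ofReal (s : ℝ) (g : G n F) : (absDet n F s g : ℂ) =
    (normAbs (g : Matrix (Fin n) (Fin n) F).det ^ s : ℝ) := by
  rw [absDet_apply, Complex.ofReal_cpow (normAbs_nonneg _)]

theorem isUnitaryPart_of_norm {s : ℝ} {χ : G n F →ₜ* ℂˣ}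
    (h : ∀ g, ‖(χ g : ℂ)‖ = normAbs (g : Matrix (Fin n) (Fin n) F).det ^ s) :
    IsUnitaryPart s χ (χ * (absDet n F s)⁻¹) := by
  have h0 : ∀ g : G n F, (χ * (absDet n F s)⁻¹) g = χ g * (absDet n F s g)⁻¹ := fun g => rfl
  constructor
  · intro g
    rw [h0, ← absDet_ofReal, mul_comm (χ g), Units.val_mul, ← mul_assoc, ← Units.val_mul,
      mul_inv_cancel, Units.val_one, one_mul]
  · intro g
    rw [h0, Units.val_mul, norm_mul, h, Units.val_inv_eq_inv_val, norm_inv, absDet_ofReal,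
      Complex.norm_real, Real.norm_of_nonneg (Real.rpow_nonneg (normAbs_nonneg _) _)]
    exact mul_inv_cancel₀ (Real.rpow_pos_of_pos (normAbs_pos (det_ne_zero g)) _).ne'

end UnitaryPart

/-! ### Twisting covariant functions -/

section TwistFun

variable {H : Type*} [Group H] {W : Type*} [AddCommGroup W] [Module ℂ W]

theorem twist_apply {V : Type*} [AddCommGroup V] [Module ℂ V] (χ : H →* ℂˣ)
    (ρ : Representation ℂ H V) (g : H) (v : V) : twist χ ρ g v = (χ g : ℂ) • ρ g v := rfl

theorem twist_inv_twist {V : Type*} [AddCommGroup V] [Module ℂ V] (χ : H →* ℂˣ)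
    (ρ : Representation ℂ H V) : twist χ⁻¹ (twist χ ρ) = ρ := by
  ext g v
  rw [twist_apply, twist_apply, smul_smul, MonoidHom.inv_apply, ← Units.val_mul, inv_mul_cancel,
    Units.val_one, one_smul]

/-- Multiplication of functions by a character. -/
def mulChar (W : Type*) [AddCommGroup W] [Module ℂ W] (χ : H →* ℂˣ) :
    (H → W) ≃ₗ[ℂ] (H → W) where
  toFun f x := (χ x : ℂ) • f x
  invFun f x := ((χ x)⁻¹ : ℂˣ) • f x
  map_add' f f' := by ext x; simp
  map_smul' a f := by ext x; simp [smul_comm a]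
  left_inv f := by ext x; simp [Units.smul_def, smul_smul]
  right_inv f := by ext x; simp [Units.smul_def, smul_smul]

theorem mulChar_apply (χ : H →* ℂˣ) (f : H → W) (x : H) : mulChar W χ f x = (χ x : ℂ) • f x := rfl

theorem mulChar_inv_mulChar (χ : H →* ℂˣ) (f : H → W) : mulChar W χ⁻¹ (mulChar W χ f) = f := by
  funext x
  rw [mulChar_apply, mulChar_apply, smul_smul, MonoidHom.inv_apply, ← Units.val_mul,
    inv_mul_cancel, Units.val_one, one_smul]

theorem mulChar_mulChar_inv (χ : H →* ℂˣ) (f : H → W) : mulChar W χ (mulChar W χ⁻¹ f) = f := by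
  funext x
  rw [mulChar_apply, mulChar_apply, smul_smul, MonoidHom.inv_apply, ← Units.val_mul,
    mul_inv_cancel, Units.val_one, one_smul]

variable {n : ℕ} [NeZero n] {F : Type*} [NontriviallyNormedField F] [LocallyCompactSpace F]

/-- Restriction of a character to a Levi subgroup. -/
abbrev resChar (b : Fin n → Fin n) (χ : G n F →ₜ* ℂˣ) : levi F b →* ℂˣ :=
  (χ : G n F →* ℂˣ).comp (levi F b).subtype

/-- The absolute value of `χ` is moved into the exponents and only its unitary part into the
inducing representation, so that the latter can stay tempered. The unipotent condition is unaffected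
because `χ` is trivial there. -/
theorem mulChar_mem_covFns {b c : Fin n → Fin n} (hc : Monotone c) {α : Fin n → ℝ}
    {τ : Representation ℂ (levi F c) W} {s : ℝ} {χ χ₀ : G n F →ₜ* ℂˣ} (hχ : IsUnitaryPart s χ χ₀)
    {f : levi F b → W} (hf : f ∈ covFns b c α τ) :
    mulChar W (resChar b χ) f ∈ covFns b c (fun k => α k + s) (twist (resChar c χ₀) τ) := by
  refine ⟨fun m g hm => ?_, fun u g hu => ?_⟩
  · rw [mulChar_apply, hf.1 m g hm, mulChar_apply, twist_apply, map_mul, Units.val_mul,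
      indWeight_add b α s hm, map_smul, smul_smul, smul_smul, smul_smul]
    congr 1
    have h1 : ((resChar b χ) m : ℂ) = _ := hχ.eq m
    have h2 : (resChar c χ₀) ⟨m, hm⟩ = χ₀ m := rfl
    rw [h1, h2]
    push_cast
    ring
  · rw [mulChar_apply, hf.2 u g hu, mulChar_apply, map_mul]
    have : (resChar b χ) u = 1 := map_eq_one_of_isUnip (χ : G n F →* ℂˣ) hc hu
    rw [this, one_mul]

theorem IsUnitaryPart.inv {s : ℝ} {χ χ₀ : G n F →ₜ* ℂˣ} (hχ : IsUnitaryPart s χ χ₀) :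
    IsUnitaryPart (-s) χ⁻¹ χ₀⁻¹ := by
  constructor
  · intro g
    have h1 : (χ⁻¹ : G n F →ₜ* ℂˣ) g = (χ g)⁻¹ := rfl
    have h2 : (χ₀⁻¹ : G n F →ₜ* ℂˣ) g = (χ₀ g)⁻¹ := rfl
    rw [h1, h2, Units.val_inv_eq_inv_val, Units.val_inv_eq_inv_val, hχ.eq, mul_inv,
      Real.rpow_neg (normAbs_nonneg _), Complex.ofReal_inv]
  · intro g
    have h2 : (χ₀⁻¹ : G n F →ₜ* ℂˣ) g = (χ₀ g)⁻¹ := rfl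
    rw [h2, Units.val_inv_eq_inv_val, norm_inv, hχ.norm_eq, inv_one]

theorem resChar_inv (b : Fin n → Fin n) (χ : G n F →ₜ* ℂˣ) :
    resChar b χ⁻¹ = (resChar b χ)⁻¹ := rfl

theorem mulChar_mem_covFns_iff {b c : Fin n → Fin n} (hc : Monotone c) {α : Fin n → ℝ}
    {τ : Representation ℂ (levi F c) W} {s : ℝ} {χ χ₀ : G n F →ₜ* ℂˣ} (hχ : IsUnitaryPart s χ χ₀)
    {f : levi F b → W} :
    mulChar W (resChar b χ) f ∈ covFns b c (fun k => α k + s) (twist (resChar c χ₀) τ) ↔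
      f ∈ covFns b c α τ := by
  refine ⟨fun h => ?_, mulChar_mem_covFns hc hχ⟩
  have := mulChar_mem_covFns hc hχ.inv h
  simpa [resChar_inv, mulChar_inv_mulChar, twist_inv_twist] using this

end TwistFun

/-! ### Base change of characters -/

section NormChar

variable {n : ℕ} [NeZero n] {F E : Type*} [NontriviallyNormedField F]
  [NontriviallyNormedField E] [NormedAlgebra F E] [FiniteDimensional F E]
  [IsGalois F E] {σ : E ≃ₐ[F] E}

theorem IsNorm.zero {b : Fin n → Fin n} {g : G n E} {y : G n F} (h : IsNorm σ b g y) :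
    IsNorm σ 0 g y := by
  obtain ⟨x, -, hx⟩ := h
  exact ⟨x, mem_levi_zero x, hx⟩

/-- The value of `χ_E` at `g` depends only on `N_{E/F}(det g)`, which is Galois invariant. -/
theorem IsNormComp.map_galGL (hσ : ∀ s : E ≃ₐ[F] E, s ∈ Subgroup.zpowers σ)
    {χ : G n F →ₜ* ℂˣ} {χE : G n E →ₜ* ℂˣ} (h : IsNormComp σ χ χE) (g : G n E) :
    χE (galGL σ g) = χE g := by
  obtain ⟨y, hy⟩ := (h g).1
  obtain ⟨y', hy'⟩ := (h (galGL σ g)).1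
  rw [(h g).2 y hy, (h _).2 y' hy']
  refine map_eq_of_det_eq (χ : G n F →* ℂˣ) ?_
  rw [det_of_isNorm hσ hy, det_of_isNorm hσ hy', det_galGL, Algebra.norm_eq_of_algEquiv]

theorem IsNormComp.ext {χ : G n F →ₜ* ℂˣ} {χE χE' : G n E →ₜ* ℂˣ} (h : IsNormComp σ χ χE)
    (h' : IsNormComp σ χ χE') : χE = χE' := by
  ext1 g
  obtain ⟨y, hy⟩ := (h g).1
  rw [(h g).2 y hy, (h' g).2 y hy]

variable [LocallyCompactSpace F] [LocallyCompactSpace E]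

variable (n F E) in
/-- `χ ↦ χ_E` -/
def baseChangeChar : (G n F →ₜ* ℂˣ) →* (G n E →ₜ* ℂˣ) where
  toFun χ :=
    { toMonoidHom := ((χ : G n F →* ℂˣ).comp (dilation 0)).comp
        ((Units.map (Algebra.norm F : E →* F)).comp Matrix.GeneralLinearGroup.det)
      continuous_toFun := by
        have h : Continuous (Algebra.norm F : E → F) := by
          have := ProperSpace.of_locallyCompactSpace F (E := F)
          have hl : Continuous (Algebra.leftMulMatrix (Module.finBasis F E)) :=
            LinearMap.continuous_of_finiteDimensional
              (Algebra.leftMulMatrix (Module.finBasis F E)).toLinearMap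
          exact hl.matrix_det.congr fun x =>
            (Algebra.norm_eq_matrix_det (Module.finBasis F E) x).symm
        exact χ.continuous_toFun.comp ((continuous_dilation 0).comp
          ((h.units_map _).comp continuous_detGL)) }
  map_one' := rfl
  map_mul' _ _ := rfl

theorem isNormComp_baseChangeChar (hσ : ∀ s : E ≃ₐ[F] E, s ∈ Subgroup.zpowers σ)
    (χ : G n F →ₜ* ℂˣ) : IsNormComp σ χ (baseChangeChar n F E χ) := by
  refine fun g => ⟨exists_isNorm hσ g, fun y hy => ?_⟩
  have : Infinite F := NontriviallyNormedField.infinite F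
  refine Eq.trans ?_ (map_eq_map_dilation_det (χ : G n F →* ℂˣ) 0 y).symm
  change χ (dilation 0 _) = χ (dilation 0 _)
  congr 2
  ext
  exact (det_of_isNorm hσ hy).symm

/-- The unitary parts of `χ` and `χ_E` correspond to each other. -/
theorem IsNormComp.exists_isUnitaryPart (hσ : ∀ s : E ≃ₐ[F] E, s ∈ Subgroup.zpowers σ)
    {χ : G n F →ₜ* ℂˣ} {χE : G n E →ₜ* ℂˣ} (h : IsNormComp σ χ χE) {s : ℝ}
    (hs : ∀ g, ‖(χ g : ℂ)‖ = normAbs (g : Matrix (Fin n) (Fin n) F).det ^ s) :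
    ∃ (χ₀ : G n F →ₜ* ℂˣ) (χE₀ : G n E →ₜ* ℂˣ), IsUnitaryPart s χ χ₀ ∧ IsUnitaryPart s χE χE₀ ∧
      IsNormComp σ χ₀ χE₀ := by
  -- For `y` in the norm class of `g` one has `|det g|_E = |N det g|_F = |det y|_F`, so the same
  -- exponent `s` serves over both fields.
  have hdet : ∀ (g : G n E) (y : G n F), IsNorm σ 0 g y →
      normAbs (g : Matrix (Fin n) (Fin n) E).det = normAbs (y : Matrix (Fin n) (Fin n) F).det := by
    intro g y hy
    rw [normAbs_eq_normAbs_norm (F := F), det_of_isNorm hσ hy]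
  have hsE : ∀ g, ‖(χE g : ℂ)‖ = normAbs (g : Matrix (Fin n) (Fin n) E).det ^ s := by
    intro g
    obtain ⟨y, hy⟩ := (h g).1
    rw [(h g).2 y hy, hs, hdet g y hy]
  refine ⟨_, _, isUnitaryPart_of_norm hs, isUnitaryPart_of_norm hsE, fun g => ⟨(h g).1, ?_⟩⟩
  intro y hy
  change χE g * (absDet n E s g)⁻¹ = χ y * (absDet n F s y)⁻¹
  rw [(h g).2 y hy]
  congr 2
  ext
  rw [absDet_apply, absDet_apply, hdet g y hy]

end NormChar

end Shintani

namespace Shintani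

set_option linter.unusedSectionVars false

/-! ### Characters of non-Archimedean fields -/

section Uniformizer

open scoped Pointwise

variable {F : Type*} [NontriviallyNormedField F] [LocallyCompactSpace F] [IsUltrametricDist F]

/-- A uniformiser: an element of maximal norm in the open unit ball. -/
theorem exists_uniformizer (F : Type*) [NontriviallyNormedField F] [LocallyCompactSpace F]
    [IsUltrametricDist F] : ∃ ϖ : Fˣ, ‖(ϖ : F)‖ < 1 ∧ normAbs (ϖ : F) < 1 ∧
      ∀ x : Fˣ, ∃ (k : ℤ) (u : Fˣ), x = ϖ ^ k * u ∧ ‖(u : F)‖ = 1 := by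
  have := ProperSpace.of_locallyCompactSpace F (E := F)
  -- An open ball of an ultrametric space is closed, so the norm attains a maximum on it.
  have hcomp : IsCompact (Metric.ball (0 : F) 1) :=
    (isCompact_closedBall (0 : F) 1).of_isClosed_subset (IsUltrametricDist.isClosed_ball 0 1)
      Metric.ball_subset_closedBall
  obtain ⟨ϖ, hϖ, hmax⟩ := hcomp.exists_isMaxOn ⟨0, by simp⟩ continuous_norm.continuousOn
  have hmax : ∀ x : F, ‖x‖ < 1 → ‖x‖ ≤ ‖ϖ‖ := fun x hx => hmax (by simpa using hx)
  rw [mem_ball_zero_iff] at hϖ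
  obtain ⟨y, hy0, hy1⟩ := NormedField.exists_norm_lt_one F
  have hϖ0 : 0 < ‖ϖ‖ := hy0.trans_le (hmax y hy1)
  refine ⟨Units.mk0 ϖ (norm_pos_iff.1 hϖ0), hϖ, ?_, fun x => ?_⟩
  · borelize F
    let μ : Measure F := Measure.addHaar
    obtain ⟨h1, h2⟩ := measure_unitBall_ne F μ
    have h3 := normAbs_mul_measure μ (norm_pos_iff.1 hϖ0) (Metric.closedBall 0 1)
    -- The image of the unit ball misses the open ball of radius `1` around `1`, a set of positive
    -- measure; hence the inequality for `normAbs` is strict.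
    have h4 : ϖ • Metric.closedBall (0 : F) 1 ⊆ Metric.closedBall 0 1 \ {x | ‖x - 1‖ < 1} := by
      rintro _ ⟨z, hz, rfl⟩
      rw [mem_closedBall_zero_iff] at hz
      have hz' : ‖ϖ * z‖ < 1 := by
        rw [norm_mul]
        exact (mul_le_of_le_one_right hϖ0.le hz).trans_lt hϖ
      refine ⟨by simpa using hz'.le, fun h => ?_⟩
      have h : ‖ϖ * z - 1‖ < 1 := h
      have h5 := IsUltrametricDist.norm_add_le_max (ϖ * z) (1 - ϖ * z)
      rw [add_sub_cancel, norm_one, norm_sub_rev] at h5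
      exact absurd h5 (not_le.2 (max_lt hz' h))
    have hopen : IsOpen {x : F | ‖x - 1‖ < 1} :=
      isOpen_lt (by fun_prop) continuous_const
    have hsub : {x : F | ‖x - 1‖ < 1} ⊆ Metric.closedBall 0 1 := by
      intro x hx
      have hx : ‖x - 1‖ < 1 := hx
      have h5 := IsUltrametricDist.norm_add_le_max (x - 1) 1
      rw [sub_add_cancel, norm_one, max_eq_right hx.le] at h5
      simpa using h5
    have h6 : μ (Metric.closedBall 0 1 \ {x : F | ‖x - 1‖ < 1}) < μ (Metric.closedBall 0 1) := by
      rw [measure_sdiff hsub hopen.measurableSet.nullMeasurableSet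
        (measure_ne_top_of_subset hsub h2)]
      exact ENNReal.sub_lt_self h2 h1 (hopen.measure_pos μ ⟨1, by simp⟩).ne'
    have h7 := (h3.trans_le (measure_mono h4)).trans_lt h6
    by_contra! h8
    refine absurd h7 (not_lt.2 ?_)
    refine le_mul_of_one_le_left' ?_
    rw [ENNReal.one_le_ofReal]
    exact h8
  · obtain ⟨k, hk1, hk2⟩ := exists_mem_Ioc_zpow (norm_pos_iff.2 x.ne_zero)
      ((one_lt_inv₀ hϖ0).2 hϖ)
    -- With `‖ϖ‖^(-k) < ‖x‖ ≤ ‖ϖ‖^(-(k+1))`, the element `ϖ^(k+1) x` has norm in `(‖ϖ‖, 1]`, and no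
    -- norm lies strictly between `‖ϖ‖` and `1`.
    refine ⟨-(k + 1), (Units.mk0 ϖ (norm_pos_iff.1 hϖ0)) ^ (k + 1) * x, ?_, ?_⟩
    · rw [zpow_neg, inv_mul_cancel_left]
    · rw [Units.val_mul, Units.val_zpow_eq_zpow_val, Units.val_mk0, norm_mul, norm_zpow]
      rw [inv_zpow] at hk1 hk2
      have hpos : 0 < ‖ϖ‖ ^ (k + 1) := zpow_pos hϖ0 _
      have h1 : ‖ϖ‖ ^ (k + 1) * ‖(x : F)‖ ≤ 1 := by
        rwa [← le_inv_mul_iff₀ hpos, mul_one]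
      refine le_antisymm h1 (not_lt.1 fun h2 => ?_)
      have h3 := hmax (ϖ ^ (k + 1) * x) (by rwa [norm_mul, norm_zpow])
      rw [norm_mul, norm_zpow, zpow_add_one₀ hϖ0.ne', mul_right_comm,
        mul_le_iff_le_one_left hϖ0] at h3
      rw [inv_lt_iff_one_lt_mul₀ (zpow_pos hϖ0 _), mul_comm] at hk1
      exact absurd h3 (not_le.2 (by rwa [mul_comm] at hk1 ⊢))

/-- A continuous positive character of the multiplicative group is a power of the absolute
value. -/
theorem exists_eq_normAbs_rpow (ω : Fˣ →* ℝ) (hω : Continuous ω) (hpos : ∀ x, 0 < ω x) :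
    ∃ s : ℝ, ∀ x : Fˣ, ω x = normAbs (x : F) ^ s := by
  have := ProperSpace.of_locallyCompactSpace F (E := F)
  obtain ⟨ϖ, h1, h2, h3⟩ := exists_uniformizer F
  -- The units form a compact group, so `ω` is bounded there; a value above `1` would have unbounded
  -- powers.
  have hunit : ∀ u : Fˣ, ‖(u : F)‖ = 1 → ω u = 1 := by
    have hS : IsCompact {u : Fˣ | ‖(u : F)‖ = 1} := by
      have hc := (Units.isClosedEmbedding_embedProduct (α := F)).isCompact_preimage
        ((isCompact_closedBall (0 : F) 1).prod
          ((isCompact_closedBall (0 : F) 1).image MulOpposite.continuous_op))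
      have : {u : Fˣ | ‖(u : F)‖ = 1} = Units.embedProduct F ⁻¹'
          (Metric.closedBall 0 1 ×ˢ (MulOpposite.op '' Metric.closedBall 0 1)) := by
        ext u
        rw [Set.mem_preimage, Units.embedProduct_apply, Set.mem_prod,
          MulOpposite.op_injective.mem_set_image, mem_closedBall_zero_iff, mem_closedBall_zero_iff,
          Units.val_inv_eq_inv_val, norm_inv, Set.mem_ofPred_eq]
        have hu := norm_pos_iff.2 u.ne_zero
        rw [inv_le_one₀ hu]
        exact ⟨fun h => ⟨h.le, h.ge⟩, fun h => le_antisymm h.1 h.2⟩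
      rw [this]
      exact hc
    obtain ⟨C, hC⟩ := hS.bddAbove_image hω.continuousOn
    have hle : ∀ u : Fˣ, ‖(u : F)‖ = 1 → ω u ≤ 1 := by
      intro u hu
      by_contra! h
      obtain ⟨k, hk⟩ := pow_unbounded_of_one_lt C h
      refine absurd (hC ⟨u ^ k, ?_, rfl⟩) (not_le.2 ?_)
      · simp [hu]
      · rwa [map_pow]
    intro u hu
    refine le_antisymm (hle u hu) ?_
    have := hle u⁻¹ (by simp [hu])
    have h4 : ω u * ω u⁻¹ = 1 := by rw [← map_mul, mul_inv_cancel, map_one]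
    nlinarith [hpos u]
  have hϖ0 : 0 < normAbs (ϖ : F) := normAbs_pos ϖ.ne_zero
  have hlog : Real.log (normAbs (ϖ : F)) ≠ 0 := (Real.log_neg hϖ0 h2).ne
  refine ⟨Real.log (ω ϖ) / Real.log (normAbs (ϖ : F)), fun x => ?_⟩
  obtain ⟨k, u, rfl, hu⟩ := h3 x
  have hz : ω (ϖ ^ k) = ω ϖ ^ k := by
    cases k with
    | ofNat m => simp
    | negSucc m =>
      rw [zpow_negSucc, zpow_negSucc, ← map_pow]
      refine eq_inv_of_mul_eq_one_left ?_
      rw [← map_mul, inv_mul_cancel, map_one]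
  rw [map_mul, hunit u hu, mul_one, hz, Units.val_mul, normAbs_mul, normAbs_eq_one_of_norm_eq_one hu,
    mul_one, Units.val_zpow_eq_zpow_val, normAbs_zpow, ← Real.rpow_intCast, ← Real.rpow_intCast,
    ← Real.rpow_mul hϖ0.le, mul_comm, Real.rpow_mul hϖ0.le]
  congr 1
  rw [Real.rpow_def_of_pos hϖ0, mul_div_cancel₀ _ hlog, Real.exp_log (hpos ϖ)]

end Uniformizer

/-- A subgroup of the unit disc around `1` of radius `1/2` is trivial. -/
theorem eq_one_of_pow_near_one {z : ℂ} (h : ∀ k : ℕ, ‖z ^ k - 1‖ ≤ 1 / 2) : z = 1 := by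
  -- In `z^(2m) - 1 = (z^m - 1)(z^m + 1)` the second factor has norm at least `3/2`, so each
  -- squaring moves a point other than `1` away from `1` by that factor.
  have key : ∀ k : ℕ, (3 / 2 : ℝ) ^ k * ‖z - 1‖ ≤ ‖z ^ 2 ^ k - 1‖ := by
    intro k
    induction k with
    | zero => simp
    | succ k ih =>
      have h1 : z ^ 2 ^ (k + 1) - 1 = (z ^ 2 ^ k - 1) * (z ^ 2 ^ k + 1) := by ring
      have h2 : (3 / 2 : ℝ) ≤ ‖z ^ 2 ^ k + 1‖ := by
        have h3 := norm_sub_norm_le (2 : ℂ) (1 - z ^ 2 ^ k)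
        have h4 : (2 : ℂ) - (1 - z ^ 2 ^ k) = z ^ 2 ^ k + 1 := by ring
        rw [h4, norm_sub_rev 1] at h3
        have h5 := h (2 ^ k)
        have h6 : ‖(2 : ℂ)‖ = 2 := by simp
        linarith
      rw [h1, norm_mul, pow_succ]
      nlinarith [norm_nonneg (z ^ 2 ^ k - 1)]
  by_contra hne
  have hpos : 0 < ‖z - 1‖ := norm_pos_iff.2 (sub_ne_zero.2 hne)
  obtain ⟨k, hk⟩ := pow_unbounded_of_one_lt (1 / ‖z - 1‖) (by norm_num : (1 : ℝ) < 3 / 2)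
  rw [div_lt_iff₀ hpos] at hk
  linarith [key k, h (2 ^ k)]

/-! ### Continuous characters are smooth -/

section LocallyConstant

variable {n : ℕ} [NeZero n] {F : Type*} [NontriviallyNormedField F] [IsUltrametricDist F]

/-- Near `1` the group `Fˣ` has open subgroups of the form `‖u - 1‖ < r`. The image of a small one
lies in a disc around `1` that contains no non-trivial subgroup of `ℂˣ`; the preimage under the
determinant is the required subgroup. -/
theorem exists_open_subgroup_le_ker (χ : G n F →ₜ* ℂˣ) :
    ∃ U : Subgroup (G n F), IsOpen (U : Set (G n F)) ∧ ∀ u ∈ U, χ u = 1 := by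
  have : Infinite F := NontriviallyNormedField.infinite F
  have hc : Continuous fun u : Fˣ => (χ (dilation 0 u) : ℂ) :=
    Units.continuous_val.comp (χ.continuous_toFun.comp (continuous_dilation 0))
  have h1 : ∀ᶠ u : Fˣ in 𝓝 1, ‖(χ (dilation 0 u) : ℂ) - 1‖ < 1 / 2 := by
    refine ((hc.sub continuous_const).norm.tendsto 1).eventually_lt_const ?_
    simp
  have hemb : Topology.IsInducing (Units.val : Fˣ → F) :=
    Units.isEmbedding_val₀.isInducing
  rw [hemb.nhds_eq_comap, Filter.eventually_comap, Metric.eventually_nhds_iff] at h1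
  obtain ⟨r, hr, h1⟩ := h1
  let U : Subgroup Fˣ :=
    { carrier := {u | ‖(u : F) - 1‖ < min r 1}
      one_mem' := by simp [hr]
      mul_mem' := by
        intro u v hu hv
        have hu : ‖(u : F) - 1‖ < min r 1 := hu
        have hv : ‖(v : F) - 1‖ < min r 1 := hv
        have hu1 : ‖(u : F)‖ ≤ 1 := by
          have h5 := IsUltrametricDist.norm_add_le_max ((u : F) - 1) 1
          rwa [sub_add_cancel, norm_one, max_eq_right (hu.le.trans (min_le_right _ _))] at h5
        have h6 : ((u * v : Fˣ) : F) - 1 = u * (v - 1) + (u - 1) := by push_cast; ring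
        change ‖((u * v : Fˣ) : F) - 1‖ < min r 1
        rw [h6]
        refine (IsUltrametricDist.norm_add_le_max _ _).trans_lt (max_lt ?_ hu)
        rw [norm_mul]
        exact (mul_le_of_le_one_left (norm_nonneg _) hu1).trans_lt hv
      inv_mem' := by
        intro u hu
        have hu : ‖(u : F) - 1‖ < min r 1 := hu
        have hu1 : 1 ≤ ‖(u : F)‖ := by
          have h5 := IsUltrametricDist.norm_add_le_max (u : F) (1 - u)
          rw [add_sub_cancel, norm_one, norm_sub_rev] at h5
          rcases le_max_iff.1 h5 with h | h
          · exact h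
          · exact absurd (hu.trans_le (min_le_right _ _)) (not_lt.2 h)
        change ‖((u⁻¹ : Fˣ) : F) - 1‖ < min r 1
        have h6 : ((u⁻¹ : Fˣ) : F) - 1 = -((u : F)⁻¹ * (u - 1)) := by
          rw [Units.val_inv_eq_inv_val]
          field_simp
          ring
        rw [h6, norm_neg, norm_mul, norm_inv]
        exact (mul_le_of_le_one_left (norm_nonneg _) (inv_le_one_of_one_le₀ hu1)).trans_lt hu }
  have hU : IsOpen (U : Set Fˣ) :=
    isOpen_lt (Units.continuous_val.sub continuous_const).norm continuous_const
  have hker : ∀ u ∈ U, χ (dilation 0 u) = 1 := by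
    intro u hu
    ext
    refine eq_one_of_pow_near_one fun k => ?_
    have hk : u ^ k ∈ U := pow_mem hu k
    have h2 : ‖((u ^ k : Fˣ) : F) - 1‖ < min r 1 := hk
    have h3 := h1 (y := ((u ^ k : Fˣ) : F)) (by
      rw [dist_eq_norm]; exact h2.trans_le (min_le_left _ _)) (u ^ k) rfl
    rw [map_pow, map_pow, Units.val_pow_eq_pow_val] at h3
    exact h3.le
  refine ⟨U.comap Matrix.GeneralLinearGroup.det, hU.preimage continuous_detGL, fun u hu => ?_⟩
  have := map_eq_map_dilation_det (χ : G n F →* ℂˣ) 0 u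
  exact this.trans (hker _ hu)

end LocallyConstant

/-- The classification of positive characters of `Fˣ` enters as a hypothesis because its proofs for
ultrametric fields and for `ℝ` are different. -/
theorem exists_norm_eq_normAbs_rpow {n : ℕ} [NeZero n] {F : Type*} [NontriviallyNormedField F]
    [LocallyCompactSpace F] {χ : G n F →ₜ* ℂˣ}
    (h : ∀ ω : Fˣ →* ℝ, Continuous ω → (∀ x, 0 < ω x) →
      ∃ s : ℝ, ∀ x : Fˣ, ω x = normAbs (x : F) ^ s) :
    ∃ s : ℝ, ∀ g, ‖(χ g : ℂ)‖ = normAbs (g : Matrix (Fin n) (Fin n) F).det ^ s := by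
  have : Infinite F := NontriviallyNormedField.infinite F
  let ω : Fˣ →* ℝ :=
    { toFun := fun u => ‖(χ (dilation 0 u) : ℂ)‖
      map_one' := by simp
      map_mul' := fun u v => by simp }
  obtain ⟨s, hs⟩ := h ω
    (Units.continuous_val.comp (χ.continuous_toFun.comp (continuous_dilation 0))).norm
    fun u => (norm_pos_iff.2 (Units.ne_zero _) : 0 < ‖(χ (dilation 0 u) : ℂ)‖)
  refine ⟨s, fun g => ?_⟩
  have h1 := map_eq_map_dilation_det (χ : G n F →* ℂˣ) 0 g
  have h1 : χ g = χ (dilation 0 (Matrix.GeneralLinearGroup.det g)) := h1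
  rw [h1]
  exact hs _

end Shintani

namespace Shintani

set_option linter.unusedSectionVars false

namespace Padic

/-! ### Twisting in the `p`-adic case -/

section Twist

variable {H : Type*} [Group H] [TopologicalSpace H] {V : Type*} [AddCommGroup V] [Module ℂ V]

/-- The characters that are trivial on an open subgroup. -/
def IsSmoothChar (χ : H →* ℂˣ) : Prop :=
  ∃ U : Subgroup H, IsOpen (U : Set H) ∧ ∀ u ∈ U, χ u = 1

theorem IsSmoothChar.inv {χ : H →* ℂˣ} (h : IsSmoothChar χ) : IsSmoothChar χ⁻¹ := by
  obtain ⟨U, hU, h⟩ := h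
  exact ⟨U, hU, fun u hu => by rw [MonoidHom.inv_apply, h u hu, inv_one]⟩

theorem IsSmoothChar.eventually [ContinuousMul H] {χ : H →* ℂˣ} (h : IsSmoothChar χ) (x : H) :
    ∀ᶠ y in 𝓝 x, χ y = χ x := by
  obtain ⟨U, hU, h⟩ := h
  have h1 : IsOpen ((fun y => x⁻¹ * y) ⁻¹' (U : Set H)) := hU.preimage (continuous_const_mul _)
  filter_upwards [h1.mem_nhds (by simp [one_mem] : x ∈ _)] with y hy
  have := h _ hy
  rwa [map_mul, map_inv, inv_mul_eq_one, eq_comm] at this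

theorem IsSmoothChar.isLocallyConstant [ContinuousMul H] {χ : H →* ℂˣ} (h : IsSmoothChar χ) :
    IsLocallyConstant fun x => (χ x : ℂ) := by
  rw [IsLocallyConstant.iff_eventually_eq]
  intro x
  filter_upwards [h.eventually x] with y hy
  rw [hy]

theorem smoothPart_le_twist {χ : H →* ℂˣ} (hχ : IsSmoothChar χ) (ρ : Representation ℂ H V) :
    smoothPart ρ ≤ smoothPart (twist χ ρ) := by
  rintro v ⟨U, hU, h⟩
  obtain ⟨U', hU', h'⟩ := hχ
  refine ⟨U ⊓ U', hU.inter hU', fun u hu => ?_⟩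
  rw [twist_apply, h' u hu.2, h u hu.1, Units.val_one, one_smul]

/-- The subrepresentations of a twist. -/
def subrepresentationTwist (χ : H →* ℂˣ) (ρ : Representation ℂ H V) :
    Subrepresentation ρ ≃o Subrepresentation (twist χ ρ) where
  toFun S := ⟨S.toSubmodule, fun g _ hv => S.toSubmodule.smul_mem _ (S.apply_mem_toSubmodule g hv)⟩
  invFun S := ⟨S.toSubmodule, fun g v hv => by
    have h : (((χ g)⁻¹ : ℂˣ) : ℂ) • ((χ g : ℂ) • ρ g v) ∈ S.toSubmodule :=
      S.toSubmodule.smul_mem _ (S.apply_mem_toSubmodule g hv)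
    rwa [smul_smul, Units.inv_mul, one_smul] at h⟩
  left_inv _ := rfl
  right_inv _ := rfl
  map_rel_iff' := Iff.rfl

theorem isIrreducible_twist (χ : H →* ℂˣ) {ρ : Representation ℂ H V} (h : ρ.IsIrreducible) :
    (twist χ ρ).IsIrreducible := by
  have : IsSimpleOrder (Subrepresentation ρ) := h
  exact (subrepresentationTwist χ ρ).symm.isSimpleOrder

theorem IsSmoothIrred.twist {χ : H →* ℂˣ} (hχ : IsSmoothChar χ) {ρ : Representation ℂ H V}
    (h : IsSmoothIrred ρ) : IsSmoothIrred (twist χ ρ) :=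
  ⟨top_unique (h.1 ▸ smoothPart_le_twist hχ ρ), isIrreducible_twist χ h.2⟩

theorem SqIntModCenter.mul_left {χ f : H → ℂ} (hχ : ∀ g, ‖χ g‖ = 1) (h : SqIntModCenter f) :
    SqIntModCenter fun g => χ g * f g := by
  obtain ⟨m, hm, μ, φ, h1, h2, h3⟩ := h
  exact ⟨m, hm, μ, φ, h1, fun g => by rw [h2, norm_mul, hχ, one_mul], h3⟩

theorem IsSquareIntegrable.twist {χ : H →* ℂˣ} (hχ : IsSmoothChar χ)
    (hχ1 : ∀ g, ‖(χ g : ℂ)‖ = 1) {ρ : Representation ℂ H V} (h : IsSquareIntegrable ρ) :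
    IsSquareIntegrable (twist χ ρ) := by
  obtain ⟨h1, ⟨ip, hip⟩, v, ℓ, ⟨U, hU, hℓ⟩, ⟨g, hg⟩, hsq⟩ := h
  obtain ⟨U', hU', h'⟩ := id hχ
  refine ⟨h1.twist hχ, ⟨ip, fun g v w => ?_⟩, v, ℓ, ⟨U ⊓ U', hU.inter hU', fun u hu w => ?_⟩,
    ⟨g, ?_⟩, ?_⟩
  · rw [twist_apply, twist_apply, ip.smul_left, ← ip.conj_inner_symm, ip.smul_left, map_mul,
      ip.conj_inner_symm, hip, Complex.conj_conj, ← mul_assoc, mul_comm ((starRingEnd ℂ) _),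
      Complex.mul_conj, Complex.normSq_eq_norm_sq, hχ1]
    simp
  · rw [twist_apply, h' u hu.2, Units.val_one, one_smul, hℓ u hu.1]
  · rw [twist_apply, map_smul, smul_eq_mul]
    exact mul_ne_zero (Units.ne_zero _) hg
  · simp only [twist_apply, map_smul, smul_eq_mul]
    exact SqIntModCenter.mul_left hχ1 hsq

/-- Because `(χρ)(f) = ρ(χf)`, and `χf` is again locally constant with compact support, the operator
attached to `χf` serves for `f`. -/
theorem IsCharFn.twist [IsTopologicalGroup H] {χ : H →* ℂˣ} (hχ : IsSmoothChar χ)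
    {ρ : Representation ℂ H V} {A : V →ₗ[ℂ] V} {reg : Set H} {Θ : H → ℂ}
    (h : IsCharFn ρ A reg Θ) : IsCharFn (twist χ ρ) A reg fun x => χ x * Θ x := by
  obtain ⟨m, hm, μ, hμ, h1, h2, h3⟩ := h
  refine ⟨m, hm, μ, hμ, LocallyIntegrable.continuous_mul h1 hχ.isLocallyConstant.continuous,
    fun x hx => ?_, fun f hf hfc => ?_⟩
  · filter_upwards [h2 x hx, hχ.eventually x] with y hy hy'
    rw [hy, hy']
  · obtain ⟨T, hT1, hT2, hT3⟩ := h3 (fun x => χ x * f x) (hχ.isLocallyConstant.mul hf) hfc.mul_left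
    refine ⟨T, fun v ℓ => ?_, hT2, ?_⟩
    · rw [hT1]
      congr 1
      funext g
      rw [twist_apply, map_smul, smul_eq_mul]
      ring
    · rw [hT3]
      congr 1
      funext g
      ring

end Twist

/-! ### Twisting induced and tempered representations -/

section TwistField

variable {n : ℕ} [NeZero n] {F : Type*} [NontriviallyNormedField F] [LocallyCompactSpace F]
  [IsUltrametricDist F]
  {V : Type*} [AddCommGroup V] [Module ℂ V] {W : Type*} [AddCommGroup W] [Module ℂ W]

theorem isSmoothChar_coe (χ : G n F →ₜ* ℂˣ) : IsSmoothChar (χ : G n F →* ℂˣ) :=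
  exists_open_subgroup_le_ker χ

theorem isSmoothChar_resChar (b : Fin n → Fin n) (χ : G n F →ₜ* ℂˣ) :
    IsSmoothChar (resChar b χ) := by
  obtain ⟨U, hU, h⟩ := exists_open_subgroup_le_ker χ
  exact ⟨U.comap (levi F b).subtype, hU.preimage continuous_subtype_val, fun u hu => h _ hu⟩

theorem mulChar_mem_smoothPart {H : Type*} [Group H] [TopologicalSpace H] {χ : H →* ℂˣ}
    (hχ : IsSmoothChar χ) {f : H → W} (hf : f ∈ smoothPart (rightReg H W)) :
    mulChar W χ f ∈ smoothPart (rightReg H W) := by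
  obtain ⟨U, hU, h⟩ := hf
  obtain ⟨U', hU', h'⟩ := hχ
  refine ⟨U ⊓ U', hU.inter hU', fun u hu => ?_⟩
  funext x
  have h1 : f (x * u) = f x := congrFun (h u hu.1) x
  change (χ (x * u) : ℂ) • f (x * u) = (χ x : ℂ) • f x
  rw [h1, map_mul, h' u hu.2, mul_one]

variable {s : ℝ} {χ χ₀ : G n F →ₜ* ℂˣ}

/-- Multiplication by a character on induced representations. -/
def indTwist {b c : Fin n → Fin n} (hc : Monotone c) (α : Fin n → ℝ)
    (τ : Representation ℂ (levi F c) W) (hχ : IsUnitaryPart s χ χ₀) :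
    ind b c α τ ≃ₗ[ℂ] ind b c (fun k => α k + s) (twist (resChar c χ₀) τ) :=
  (mulChar W (resChar b χ)).ofSubmodules _ _ (by
    ext f
    rw [Submodule.mem_map]
    constructor
    · rintro ⟨f, hf, rfl⟩
      exact ⟨mulChar_mem_covFns hc hχ hf.1, mulChar_mem_smoothPart (isSmoothChar_resChar b χ) hf.2⟩
    · intro hf
      refine ⟨mulChar W (resChar b χ)⁻¹ f, ⟨?_, ?_⟩, mulChar_mulChar_inv _ _⟩
      · refine (mulChar_mem_covFns_iff hc hχ).1 ?_
        exact (mulChar_mulChar_inv (resChar b χ) f).symm ▸ hf.1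
      · exact mulChar_mem_smoothPart (isSmoothChar_resChar b χ).inv hf.2)

theorem indTwist_apply {b c : Fin n → Fin n} (hc : Monotone c) (α : Fin n → ℝ)
    (τ : Representation ℂ (levi F c) W) (hχ : IsUnitaryPart s χ χ₀) (f : ind b c α τ)
    (x : levi F b) : (indTwist hc α τ hχ f).1 x = (χ x : ℂ) • f.1 x := rfl

theorem indTwist_symm_apply {b c : Fin n → Fin n} (hc : Monotone c) (α : Fin n → ℝ)
    (τ : Representation ℂ (levi F c) W) (hχ : IsUnitaryPart s χ χ₀)
    (f : ind b c (fun k => α k + s) (twist (resChar c χ₀) τ))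
    (x : levi F b) : ((indTwist hc α τ hχ).symm f).1 x = ((χ x)⁻¹ : ℂˣ) • f.1 x := rfl

theorem IsTempered.twist {b : Fin n → Fin n} {τ : Representation ℂ (levi F b) V}
    (h : IsTempered b τ) (hχ : ∀ g, ‖(χ g : ℂ)‖ = 1) :
    IsTempered b (twist (resChar b χ) τ) := by
  obtain ⟨h1, c, hcb, W, _, _, δ, hδ, e, he⟩ := h
  -- A unitary character is its own unitary part with `s = 0`, so the exponent `0` of the induction
  -- from a square integrable representation is kept.
  have hup : IsUnitaryPart 0 χ χ := ⟨fun g => by simp, hχ⟩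
  have h0 : (fun k : Fin n => (0 : Fin n → ℝ) k + 0) = 0 := by ext; simp
  refine ⟨h1.twist (isSmoothChar_resChar b χ), c, hcb, W, inferInstance, inferInstance,
    Shintani.twist (resChar c χ) δ, hδ.twist (isSmoothChar_resChar c χ) (fun g => hχ g), ?_⟩
  rw [← h0]
  refine ⟨e.trans (indTwist hcb.1 0 δ hup), fun g v x => ?_⟩
  rw [LinearEquiv.trans_apply, LinearEquiv.trans_apply]
  refine (indTwist_apply hcb.1 0 δ hup _ x).trans
    (Eq.trans ?_ (indTwist_apply hcb.1 0 δ hup _ (x * g)).symm)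
  rw [twist_apply, map_smul]
  change (χ x : ℂ) • (_ : ℂ) • (e (τ g v) : levi F b → W) x = _
  rw [he, smul_smul]
  congr 1
  have : χ (((x * g : levi F b) : G n F)) = χ x * χ g := map_mul χ _ _
  rw [this, Units.val_mul]
  rfl

theorem IsQuotientMap.twist {b : Fin n → Fin n} (hb : Monotone b) {α : Fin n → ℝ}
    {τ : Representation ℂ (levi F b) W} {π : Representation ℂ (G n F) V} {p : ind 0 b α τ →ₗ[ℂ] V}
    (h : IsQuotientMap b α τ π p) (hχ : IsUnitaryPart s χ χ₀) :
    IsQuotientMap b (fun k => α k + s) (twist (resChar b χ₀) τ) (twist (χ : G n F →* ℂˣ) π)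
      (p ∘ₗ (indTwist hb α τ hχ).symm.toLinearMap) := by
  refine ⟨h.1.comp (indTwist hb α τ hχ).symm.surjective, fun g f f' hf => ?_⟩
  -- Division by `χ` turns the right translate by `g` into `χ(g)` times the translate of the
  -- quotient function; the factor `χ(g)⁻¹` corrects this.
  have h1 := h.2 g ((indTwist hb α τ hχ).symm f)
    (((χ g)⁻¹ : ℂˣ) • (indTwist hb α τ hχ).symm f') fun x => by
      change ((χ g)⁻¹ : ℂˣ) • ((indTwist hb α τ hχ).symm f').1 x = _
      rw [indTwist_symm_apply, indTwist_symm_apply, hf, smul_smul, ← mul_inv_rev]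
      congr 2
      rw [← map_mul]; rfl
  rw [twist_apply, LinearMap.comp_apply, LinearMap.comp_apply]
  refine Eq.trans ?_ (congrArg _ h1)
  rw [Units.smul_def, map_smul, smul_smul]
  have : (((χ : G n F →* ℂˣ) g : ℂˣ) : ℂ) * ((χ g)⁻¹ : ℂˣ) = 1 := Units.mul_inv _
  rw [this, one_smul]
  rfl

end TwistField

/-! ### Twisting operators, character identities and Shintani lifts -/

section TwistExt

variable {n : ℕ} [NeZero n] {F : Type*} [NontriviallyNormedField F] [LocallyCompactSpace F]
  [IsUltrametricDist F] {E : Type*} [NontriviallyNormedField E] [LocallyCompactSpace E]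
  [IsUltrametricDist E] [NormedAlgebra F E] [FiniteDimensional F E] [IsGalois F E]
  {σ : E ≃ₐ[F] E} {ψ : AddChar F Circle}
  {V : Type*} [AddCommGroup V] [Module ℂ V] {W : Type*} [AddCommGroup W] [Module ℂ W]
  {χ : G n F →ₜ* ℂˣ} {χE : G n E →ₜ* ℂˣ}

theorem isWhittaker_twist_iff {b : Fin n → Fin n} {ψ : AddChar E Circle}
    {τ : Representation ℂ (levi E b) W} {ℓ : Module.Dual ℂ W} (χ : G n E →ₜ* ℂˣ) :
    IsWhittaker b ψ (twist (resChar b χ) τ) ℓ ↔ IsWhittaker b ψ τ ℓ := by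
  refine forall_congr' fun u => forall_congr' fun hu => forall_congr' fun w => ?_
  have : resChar b χ u = 1 := map_eq_one_of_isUnip (χ : G n E →* ℂˣ) monotone_id hu
  rw [twist_apply, this, Units.val_one, one_smul]

/-- The same operator `I` works: the Whittaker functionals are unchanged, and the `σ`-invariance of
the character keeps the intertwining relation. -/
theorem IsGenericOp.twist {b : Fin n → Fin n} {τ : Representation ℂ (levi E b) W}
    {I : W →ₗ[ℂ] W} (h : IsGenericOp σ ψ b τ I)
    (hχ : ∀ g, χE (galGL σ g) = χE g) :
    IsGenericOp σ ψ b (twist (resChar b χE) τ) I := by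
  simp only [IsGenericOp, isWhittaker_twist_iff]
  refine ⟨h.1, h.2.1, fun g w => ?_, h.2.2.2⟩
  rw [twist_apply, twist_apply, map_smul, h.2.2.1]
  have : resChar b χE (galLevi σ b g) = resChar b χE g := hχ g
  rw [this]

theorem CharIdentity.twist {b : Fin n → Fin n} {π : Representation ℂ (levi F b) V}
    {P : Representation ℂ (levi E b) W} {I : W →ₗ[ℂ] W} (h : CharIdentity σ b π P I)
    (hχ : IsNormComp σ χ χE) :
    CharIdentity σ b (twist (resChar b χ) π) (twist (resChar b χE) P) I := by
  obtain ⟨Θ, Θ', h1, h2, h3⟩ := h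
  refine ⟨_, _, h1.twist (isSmoothChar_resChar b χ), h2.twist (isSmoothChar_resChar b χE),
    fun g y hgy hy => ?_⟩
  rw [h3 g y hgy hy]
  have : resChar b χE g = resChar b χ y := (hχ g).2 y hgy.zero
  rw [this]

/-- Multiplication of functions by the `σ`-invariant character `χ_E` commutes with `f ↦ I ∘ f ∘
σ⁻¹`, so the operator on the quotient remains `J`. -/
theorem IsNormalizedOp.twist (hσ : ∀ s : E ≃ₐ[F] E, s ∈ Subgroup.zpowers σ)
    {P : Representation ℂ (G n E) V} {J : V →ₗ[ℂ] V} (h : IsNormalizedOp σ ψ P J)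
    (hχ : IsNormComp σ χ χE) :
    IsNormalizedOp σ ψ (twist (χE : G n E →* ℂˣ) P) J := by
  obtain ⟨s, hs⟩ := exists_norm_eq_normAbs_rpow (χ := χ) exists_eq_normAbs_rpow
  obtain ⟨χ₀, χE₀, h0, hE0, hχ₀⟩ := hχ.exists_isUnitaryPart hσ hs
  obtain ⟨h1, b, α, hb, hα, W, _, _, τ, I, hτ, hI, p, hp, hpI⟩ := h
  refine ⟨h1.twist (isSmoothChar_coe χE), b, fun k => α k + s, hb,
    fun i j hij => by linarith [hα i j hij], W, inferInstance, inferInstance,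
    Shintani.twist (resChar b χE₀) τ, I, hτ.twist hE0.norm_eq, hI.twist (hχ₀.map_galGL hσ), _,
    hp.twist hb hE0, fun f => ?_⟩
  obtain ⟨f', hf', hpf⟩ := hpI ((indTwist hb α τ hE0).symm f)
  refine ⟨indTwist hb α τ hE0 f', fun x => ?_, ?_⟩
  · rw [indTwist_apply, hf', indTwist_symm_apply, Units.smul_def, map_smul, smul_smul]
    have : χE ((galLevi σ 0 x : levi E (0 : Fin n → Fin n)) : G n E) = χE x := hχ.map_galGL hσ x
    rw [this, Units.mul_inv, one_smul]
  · rw [LinearMap.comp_apply, LinearMap.comp_apply]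
    refine Eq.trans (congrArg p ?_) hpf
    exact (indTwist hb α τ hE0).symm_apply_apply f'

theorem IsShintaniLift.twist (hσ : ∀ s : E ≃ₐ[F] E, s ∈ Subgroup.zpowers σ)
    {π : Representation ℂ (G n F) V} {P : Representation ℂ (G n E) W}
    (h : IsShintaniLift σ ψ π P) (hχ : IsNormComp σ χ χE) :
    IsShintaniLift σ ψ (twist (χ : G n F →* ℂˣ) π) (twist (χE : G n E →* ℂˣ) P) := by
  obtain ⟨⟨h1, h2, b, α, hb, hα, U, _, _, τ, U', _, _, τ', hτ, hτ', ⟨I, hI, hId⟩, ⟨p, hp⟩, p', hp'⟩,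
    J, hJ, hJd⟩ := h
  obtain ⟨s, hs⟩ := exists_norm_eq_normAbs_rpow (χ := χ) exists_eq_normAbs_rpow
  obtain ⟨χ₀, χE₀, h0, hE0, hχ₀⟩ := hχ.exists_isUnitaryPart hσ hs
  exact ⟨⟨h1.twist (isSmoothChar_coe χ), h2.twist (isSmoothChar_coe χE), b, fun k => α k + s, hb,
    fun i j hij => by linarith [hα i j hij], U, inferInstance, inferInstance,
    Shintani.twist (resChar b χ₀) τ, U', inferInstance, inferInstance,
    Shintani.twist (resChar b χE₀) τ', hτ.twist h0.norm_eq, hτ'.twist hE0.norm_eq,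
    ⟨I, hI.twist (hχ₀.map_galGL hσ), hId.twist hχ₀⟩, ⟨_, hp.twist hb h0⟩, _, hp'.twist hb hE0⟩,
    J, hJ.twist hσ hχ, hJd.twist hχ⟩

end TwistExt

end Padic

end Shintani

namespace Shintani

set_option linter.unusedSectionVars false

/-! ### The diagonal torus and the trivial representation -/

theorem finTrace_eq_trace {V : Type*} [AddCommGroup V] [Module ℂ V] [FiniteDimensional ℂ V]
    (T : V →ₗ[ℂ] V) : finTrace T = LinearMap.trace ℂ V T := by
  rw [finTrace, LinearMap.trace_comp_comm']
  congr 1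

theorem finTrace_smul_id {V : Type*} [AddCommGroup V] [Module ℂ V]
    (hV : Module.finrank ℂ V = 1) (a : ℂ) : finTrace (a • LinearMap.id : V →ₗ[ℂ] V) = a := by
  have := FiniteDimensional.of_finrank_pos (hV ▸ one_pos)
  rw [finTrace_eq_trace, map_smul, LinearMap.trace_id, hV, Nat.cast_one, smul_eq_mul, mul_one]

section Torus

variable {n : ℕ} {F : Type*} [NontriviallyNormedField F]

theorem coe_torus (x : levi F (id : Fin n → Fin n)) : ((x : G n F) : Matrix (Fin n) (Fin n) F) =
    Matrix.diagonal fun i => ((x : G n F) : Matrix (Fin n) (Fin n) F) i i := by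
  ext i j
  by_cases h : i = j
  · subst h; simp
  · rw [Matrix.diagonal_apply_ne _ h]
    exact (x.2 i j h).1

theorem torus_mul_comm (x y : levi F (id : Fin n → Fin n)) : x * y = y * x := by
  apply Subtype.ext
  ext1
  rw [Subgroup.coe_mul, Subgroup.coe_mul, Units.val_mul, Units.val_mul, coe_torus x, coe_torus y,
    Matrix.diagonal_mul_diagonal, Matrix.diagonal_mul_diagonal]
  congr 1
  ext i
  exact mul_comm _ _

/-- The torus is commutative, so its quotient by the centre is a point. -/
theorem sqIntModCenter_const_torus [LocallyCompactSpace F] (z : ℂ) :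
    SqIntModCenter fun _ : levi F (id : Fin n → Fin n) => z := by
  have hc : Subgroup.center (levi F (id : Fin n → Fin n)) = ⊤ := by
    rw [eq_top_iff]
    intro x _
    rw [Subgroup.mem_center_iff]
    exact fun y => torus_mul_comm y x
  have : Subsingleton (levi F (id : Fin n → Fin n) ⧸ Subgroup.center (levi F (id : Fin n → Fin n))) := by
    rw [hc]
    exact QuotientGroup.subsingleton_quotient_top
  borelize (levi F (id : Fin n → Fin n) ⧸ Subgroup.center (levi F (id : Fin n → Fin n)))
  exact ⟨_, ‹_›, Measure.haar, fun _ => ‖z‖ ^ 2, inferInstance, fun _ => rfl, integrable_const _⟩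

theorem thetaChar_torus {ψ : AddChar F Circle} (x : levi F (id : Fin n → Fin n)) :
    thetaChar ψ (x : G n F) = 1 := by
  rw [thetaChar, Finset.sum_eq_zero]
  · simp
  · intro i _
    split_ifs with h
    · exact (x.2 i ⟨i + 1, h⟩ (fun hi => by
        have := congrArg Fin.val hi
        simp at this)).1
    · rfl

variable [LocallyCompactSpace F]

theorem blockSize_id (k : Fin n) : blockSize id k = 1 := by
  rw [blockSize, Fintype.card_eq_one_iff]
  exact ⟨⟨k, rfl⟩, fun x => Subtype.ext x.2⟩

theorem blockDet_id (k : Fin n) (g : G n F) :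
    blockDet id k g = (g : Matrix (Fin n) (Fin n) F) k k := by
  have : Unique {i : Fin n // id i = k} := ⟨⟨⟨k, rfl⟩⟩, fun x => Subtype.ext x.2⟩
  rw [blockDet, Matrix.det_unique]
  have h : ((default : {i : Fin n // id i = k}) : Fin n) = k :=
    (default : {i : Fin n // id i = k}).2
  rw [Matrix.toSquareBlock_def, Matrix.of_apply, h]

theorem indWeight_id_id (g : G n F) : indWeight id id 0 g = 1 := by
  rw [indWeight, Finset.prod_eq_one, Finset.prod_eq_one, one_mul]
  · intro k _
    exact Real.rpow_zero _
  · intro k _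
    refine Finset.prod_eq_one fun l _ => if_neg ?_
    rintro ⟨hkl, i, j, rfl, rfl, h⟩
    exact hkl.ne h

/-- The exponents of the trivial representation. -/
def halfSum (n : ℕ) (i : Fin n) : ℝ := ((n : ℝ) - 1) / 2 - i

/-- The factor `δ^(1/2)` contributes `(n-1-k)/2` from the indices above `k` and `-k/2` from those
below, and `halfSum` doubles the total to `n - 1 - 2k`. The normalised induction is thereby
covariant under the full modulus `δ`. -/
theorem indWeight_halfSum [NeZero n] {g : G n F}
    (hg : ∀ i, (g : Matrix (Fin n) (Fin n) F) i i ≠ 0) :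
    indWeight 0 id (halfSum n) g =
      ∏ i : Fin n, normAbs ((g : Matrix (Fin n) (Fin n) F) i i) ^ ((n : ℤ) - 1 - 2 * (i : ℤ)) := by
  set N : Fin n → ℝ := fun i => normAbs ((g : Matrix (Fin n) (Fin n) F) i i)
  have hN : ∀ i, 0 < N i := fun i => normAbs_pos (hg i)
  have h1 : ∀ k l : Fin n, (if k < l ∧ ∃ i j : Fin n, id i = k ∧ id j = l ∧
      (0 : Fin n → Fin n) i = (0 : Fin n → Fin n) j then
      normAbs (blockDet id k g) ^ ((blockSize (id : Fin n → Fin n) l : ℝ) / 2) *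
      normAbs (blockDet id l g) ^ (-(blockSize (id : Fin n → Fin n) k : ℝ) / 2) else 1) =
      (if k < l then N k ^ (1 / 2 : ℝ) else 1) * (if k < l then N l ^ (-1 / 2 : ℝ) else 1) := by
    intro k l
    by_cases h : k < l
    · rw [if_pos ⟨h, k, l, rfl, rfl, rfl⟩, if_pos h, if_pos h, blockDet_id, blockDet_id,
        blockSize_id, blockSize_id, Nat.cast_one]
    · rw [if_neg fun h' => h h'.1, if_neg h, if_neg h, one_mul]
  rw [indWeight]
  simp only [h1, Finset.prod_mul_distrib]
  rw [Finset.prod_comm (f := fun k l : Fin n => if k < l then N l ^ (-1 / 2 : ℝ) else 1),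
    ← Finset.prod_mul_distrib, ← Finset.prod_mul_distrib]
  refine Finset.prod_congr rfl fun k _ => ?_
  rw [Finset.prod_ite, Finset.prod_ite, Finset.prod_const_one, Finset.prod_const_one, mul_one,
    mul_one, Finset.prod_const, Finset.prod_const, Finset.filter_lt_eq_Ioi, Finset.filter_gt_eq_Iio,
    Fin.card_Ioi, Fin.card_Iio, blockDet_id]
  change (N k ^ _) ^ _ * (N k ^ _) ^ _ * N k ^ _ = N k ^ _
  rw [← Real.rpow_natCast, ← Real.rpow_natCast, ← Real.rpow_mul (hN k).le,
    ← Real.rpow_mul (hN k).le, ← Real.rpow_add (hN k), ← Real.rpow_add (hN k), ← Real.rpow_intCast]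
  congr 1
  have hk : (k : ℕ) + 1 ≤ n := k.2
  rw [halfSum, Nat.sub_sub, Nat.cast_sub (by omega)]
  push_cast
  ring

theorem strictlyDecreasing_halfSum : StrictlyDecreasing id (halfSum n) := by
  intro i j hij
  have h : (i : ℝ) < j := by exact_mod_cast (hij : i < j)
  rw [halfSum, halfSum]
  exact sub_lt_sub_left h _

variable [NeZero n]

/-- A function on `levi F 0` as a function on `GL_n(F)`. -/
def onGL {X : Type*} (f : levi F (0 : Fin n → Fin n) → X) (g : G n F) : X := f ⟨g, mem_levi_zero g⟩

theorem torus_mem_borel {m : G n F} (hm : m ∈ levi F (id : Fin n → Fin n)) :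
    m ∈ borelSubgroup n F :=
  fun i j hij => (hm i j hij.ne').1

theorem isUnip_mem_borel {u : G n F} (hu : IsUnip id u) : u ∈ borelSubgroup n F :=
  fun i j hij => (hu i j hij.le).trans (if_neg fun h => hij.ne' (congrArg id h))

theorem exists_torus_mul_unip (b : borelSubgroup n F) :
    ∃ m u : G n F, m ∈ levi F (id : Fin n → Fin n) ∧ IsUnip id u ∧ (b : G n F) = m * u ∧
      ∀ i, (m : Matrix (Fin n) (Fin n) F) i i = ((b : G n F) : Matrix (Fin n) (Fin n) F) i i := by
  let d : Fin n → F := fun i => ((b : G n F) : Matrix (Fin n) (Fin n) F) i i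
  have hd : ∀ i, d i ≠ 0 := borel_diag_ne_zero b
  let m : G n F := ⟨Matrix.diagonal d, Matrix.diagonal fun i => (d i)⁻¹, by
    rw [Matrix.diagonal_mul_diagonal, ← Matrix.diagonal_one]
    congr 1; ext i; exact mul_inv_cancel₀ (hd i), by
    rw [Matrix.diagonal_mul_diagonal, ← Matrix.diagonal_one]
    congr 1; ext i; exact inv_mul_cancel₀ (hd i)⟩
  refine ⟨m, m⁻¹ * b, fun i j hij => ⟨Matrix.diagonal_apply_ne _ hij,
    Matrix.diagonal_apply_ne _ hij⟩, fun i j hij => ?_, by rw [mul_inv_cancel_left],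
    fun i => Matrix.diagonal_apply_eq _ _⟩
  change (Matrix.diagonal (fun i => (d i)⁻¹) * ((b : G n F) : Matrix (Fin n) (Fin n) F)) i j = _
  rw [Matrix.diagonal_mul]
  have hij : j ≤ i := hij
  rcases hij.eq_or_lt with rfl | h
  · rw [if_pos rfl]; exact inv_mul_cancel₀ (hd _)
  · rw [borel_apply_eq_zero b h, mul_zero, if_neg h.ne']

theorem borelModulus_of_diag {b : borelSubgroup n F} {m : G n F}
    (h : ∀ i, (m : Matrix (Fin n) (Fin n) F) i i = ((b : G n F) : Matrix (Fin n) (Fin n) F) i i) :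
    indWeight 0 id (halfSum n) m = borelModulus n F b := by
  rw [indWeight_halfSum fun i => h i ▸ borel_diag_ne_zero b i, borelModulus, borelChar_apply]
  simp only [h]

/-- An upper triangular matrix is a diagonal one times a unipotent one, so the two conditions of
`covFns` combine into covariance under the Borel subgroup by `δ`, the condition under which
integration over `B\G` makes sense. -/
theorem mem_covFns_halfSum_iff {f : levi F (0 : Fin n → Fin n) → ℂ} :
    f ∈ covFns 0 id (halfSum n) (Representation.trivial ℂ (levi F (id : Fin n → Fin n)) ℂ) ↔
      IsBorelCovariant (onGL f) := by
  constructor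
  · rintro ⟨h1, h2⟩ b g
    obtain ⟨m, u, hm, hu, hb, hd⟩ := exists_torus_mul_unip b
    have h3 := h1 ⟨m, mem_levi_zero m⟩ ⟨u * g, mem_levi_zero _⟩ hm
    have h4 := h2 ⟨u, mem_levi_zero u⟩ ⟨g, mem_levi_zero g⟩ hu
    rw [borelModulus_of_diag hd] at h3
    change f ⟨(b : G n F) * g, _⟩ = _
    have h5 : (⟨(b : G n F) * g, mem_levi_zero _⟩ : levi F (0 : Fin n → Fin n)) =
        ⟨m, mem_levi_zero m⟩ * ⟨u * g, mem_levi_zero _⟩ := Subtype.ext (by rw [hb, mul_assoc]; rfl)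
    rw [h5, h3]
    change _ * f (⟨u, mem_levi_zero u⟩ * ⟨g, mem_levi_zero g⟩) = _
    rw [h4]
    rfl
  · intro h
    refine ⟨fun m g hm => ?_, fun u g hu => ?_⟩
    · have := h ⟨m, torus_mem_borel hm⟩ g
      rw [← borelModulus_of_diag (m := m) fun i => rfl] at this
      exact this
    · have := h ⟨u, isUnip_mem_borel hu⟩ g
      have h1 : borelModulus n F ⟨u, isUnip_mem_borel hu⟩ = 1 := by
        rw [borelModulus, borelChar_apply]
        refine Finset.prod_eq_one fun i _ => ?_
        rw [hu i i le_rfl, if_pos rfl, normAbs_one, one_zpow]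
      rw [h1, Complex.ofReal_one, one_mul] at this
      exact this

end Torus

/-! ### The Galois action -/

section Galois

variable {n : ℕ} {F E : Type*} [NontriviallyNormedField F] [NontriviallyNormedField E]
  [NormedAlgebra F E] [FiniteDimensional F E] [CompleteSpace F]

theorem continuous_algEquiv (σ : E ≃ₐ[F] E) : Continuous σ :=
  LinearMap.continuous_of_finiteDimensional σ.toLinearMap

theorem continuous_galGL (σ : E ≃ₐ[F] E) : Continuous (galGL σ : G n E → G n E) :=
  continuous_GL_iff.2 (continuous_matrix fun i j =>
    (continuous_algEquiv σ).comp (continuous_entry i j))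

/-- The Galois action as an automorphism of the topological group. -/
def galEquiv (n : ℕ) (σ : E ≃ₐ[F] E) : G n E ≃ₜ* G n E where
  toFun := galGL σ
  invFun := galGL σ⁻¹
  left_inv g := by
    rw [← MonoidHom.comp_apply]
    ext i j
    exact σ.symm_apply_apply _
  right_inv g := by
    ext i j
    exact σ.apply_symm_apply _
  map_mul' := map_mul _
  continuous_toFun := continuous_galGL σ
  continuous_invFun := continuous_galGL σ⁻¹

theorem iterate_galEquiv (σ : E ≃ₐ[F] E) (k : ℕ) (g : G n E) :
    (galEquiv n σ)^[k] g = galGL (σ ^ k) g := by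
  induction k with
  | zero => rw [pow_zero, galGL_one]; rfl
  | succ k ih => rw [Function.iterate_succ_apply', ih, pow_succ', galGL_mul]; rfl

theorem mem_borel_galEquiv (σ : E ≃ₐ[F] E) (g : G n E) :
    g ∈ borelSubgroup n E ↔ galEquiv n σ g ∈ borelSubgroup n E := by
  constructor
  · intro h i j hij
    change σ _ = 0
    rw [h hij, map_zero]
  · intro h i j hij
    have : σ ((g : Matrix (Fin n) (Fin n) E) i j) = 0 := h hij
    exact (map_eq_zero_iff σ σ.injective).1 this

variable [LocallyCompactSpace F] [LocallyCompactSpace E]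

theorem normAbs_algEquiv (σ : E ≃ₐ[F] E) (x : E) : normAbs (σ x) = normAbs x := by
  rw [normAbs_eq_normAbs_norm (F := F), Algebra.norm_eq_of_algEquiv,
    ← normAbs_eq_normAbs_norm (F := F)]

theorem borelModulus_galEquiv (σ : E ≃ₐ[F] E) (b : borelSubgroup n E) :
    borelModulus n E ⟨galEquiv n σ b, (mem_borel_galEquiv σ (b : G n E)).1 b.2⟩ = borelModulus n E b := by
  rw [borelModulus, borelChar_apply, borelChar_apply]
  refine Finset.prod_congr rfl fun i _ => ?_
  congr 1
  exact normAbs_algEquiv σ _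

theorem IsBorelCovariant.comp_galEquiv {f : G n E → ℂ} (hf : IsBorelCovariant f) (σ : E ≃ₐ[F] E) :
    IsBorelCovariant fun g => f (galEquiv n σ g) := by
  intro b g
  have := hf ⟨galEquiv n σ b, (mem_borel_galEquiv σ (b : G n E)).1 b.2⟩ (galEquiv n σ g)
  rw [borelModulus_galEquiv] at this
  rw [← this]
  exact congrArg f (map_mul (galEquiv n σ) (b : G n E) g)

theorem borelIntegral_galEquiv [NeZero n] [MeasurableSpace (G n E)] [BorelSpace (G n E)]
    {η : G n E → ℝ} (hη : IsBorelUnit η) (σ : E ≃ₐ[F] E)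
    {f₀ : G n E → ℝ} (hf₀ : Continuous f₀) (hf₀δ : IsBorelCovariant (fun g => (f₀ g : ℂ)))
    (hf₀pos : ∀ g, 0 < f₀ g) {f : G n E → ℂ} (hf : Continuous f) (hfδ : IsBorelCovariant f) :
    borelIntegral η (fun g => f (galEquiv n σ g)) = borelIntegral η f := by
  have hl : orderOf σ ≠ 0 := (orderOf_pos σ).ne'
  exact borelIntegral_comp hη (galEquiv n σ) (mem_borel_galEquiv σ) hl
    (fun g => by rw [iterate_galEquiv, pow_orderOf_eq_one, galGL_one])
    (borelModulus_galEquiv σ) hf₀ hf₀δ hf₀pos hf hfδ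

end Galois

end Shintani

namespace Shintani

set_option linter.unusedSectionVars false

namespace Padic

/-! ### The trivial representation in the `p`-adic case -/

section Trivial

variable {H : Type*} [Group H] [TopologicalSpace H]

theorem isSmoothIrred_trivial : IsSmoothIrred (Representation.trivial ℂ H ℂ) := by
  refine ⟨top_unique fun v _ => ⟨⊤, isOpen_univ, fun _ _ => rfl⟩, ?_⟩
  have h : IsSimpleOrder (Submodule ℂ ℂ) := (inferInstance : IsSimpleModule ℂ ℂ).toIsSimpleOrder
  let e : Submodule ℂ ℂ ≃o Subrepresentation (Representation.trivial ℂ H ℂ) :=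
    { toFun := fun S => ⟨S, fun _ _ hv => hv⟩
      invFun := fun S => S.toSubmodule
      left_inv := fun _ => rfl
      right_inv := fun _ => rfl
      map_rel_iff' := Iff.rfl }
  exact e.symm.isSimpleOrder

theorem isCharFn_trivial [IsTopologicalGroup H] [LocallyCompactSpace H] (reg : Set H) :
    IsCharFn (Representation.trivial ℂ H ℂ) LinearMap.id reg fun _ => 1 := by
  borelize H
  refine ⟨_, ‹_›, Measure.haar, inferInstance, locallyIntegrable_const _,
    fun _ _ => Eventually.of_forall fun _ => rfl, fun f hf hfc =>
    ⟨(∫ g, f g ∂Measure.haar) • LinearMap.id, fun v ℓ => ?_, inferInstance, ?_⟩⟩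
  · simp only [Representation.trivial_apply]
    rw [integral_mul_const, LinearMap.smul_apply, map_smul, smul_eq_mul, LinearMap.id_apply]
  · rw [LinearMap.comp_id, finTrace_smul_id (Module.finrank_self ℂ)]
    simp

end Trivial

/-! ### The trivial representation as a quotient of an induced one -/

section TrivialField

variable {n : ℕ} [NeZero n] {F : Type*} [NontriviallyNormedField F] [LocallyCompactSpace F]

theorem isSquareIntegrable_trivial_torus :
    IsSquareIntegrable (Representation.trivial ℂ (levi F (id : Fin n → Fin n)) ℂ) :=
  ⟨isSmoothIrred_trivial, ⟨InnerProductSpace.toCore, fun _ _ _ => rfl⟩, 1, LinearMap.id,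
    ⟨⊤, isOpen_univ, fun _ _ _ => rfl⟩, ⟨1, one_ne_zero⟩, sqIntModCenter_const_torus 1⟩

/-- No proper induction is involved: for `c = id` the inducing subgroup is the whole torus and the
weight is `1`, so the induced space consists of the constants. -/
theorem isTempered_trivial_torus :
    IsTempered id (Representation.trivial ℂ (levi F (id : Fin n → Fin n)) ℂ) := by
  refine ⟨isSmoothIrred_trivial, id, ⟨monotone_id, monotone_id, fun _ _ h => h⟩, ℂ, inferInstance,
    inferInstance, Representation.trivial ℂ _ ℂ, isSquareIntegrable_trivial_torus, ?_⟩
  let e : ℂ →ₗ[ℂ] ind id id 0 (Representation.trivial ℂ (levi F (id : Fin n → Fin n)) ℂ) :=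
    { toFun := fun v => ⟨fun _ => v, ⟨fun m g hm => by simp [indWeight_id_id], fun _ _ _ => rfl⟩,
        ⊤, isOpen_univ, fun _ _ => rfl⟩
      map_add' := fun _ _ => rfl
      map_smul' := fun _ _ => rfl }
  refine ⟨LinearEquiv.ofBijective e ⟨fun v w h => ?_, fun f => ⟨f.1 1, ?_⟩⟩, fun _ _ _ => rfl⟩
  · exact congrFun (congrArg Subtype.val h) 1
  · apply Subtype.ext
    funext x
    have := f.2.1.1 x 1 x.2
    rw [mul_one, indWeight_id_id] at this
    rw [this]
    change f.1 1 = _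
    simp

theorem continuous_of_mem_smoothPart {H W : Type*} [Group H] [TopologicalSpace H]
    [IsTopologicalGroup H] [AddCommGroup W] [Module ℂ W] [TopologicalSpace W] {f : H → W}
    (hf : f ∈ smoothPart (rightReg H W)) : Continuous f := by
  obtain ⟨U, hU, h⟩ := hf
  refine (IsLocallyConstant.iff_eventually_eq f).2 (fun x => ?_) |>.continuous
  have h1 : IsOpen ((fun y => x⁻¹ * y) ⁻¹' (U : Set H)) := hU.preimage (continuous_const_mul _)
  filter_upwards [h1.mem_nhds (by simp [one_mem] : x ∈ _)] with y hy
  have h2 : f (x * (x⁻¹ * y)) = f x := congrFun (h _ hy) x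
  rwa [mul_inv_cancel_left] at h2

theorem continuous_onGL {X : Type*} [TopologicalSpace X] {f : levi F (0 : Fin n → Fin n) → X}
    (hf : Continuous f) : Continuous (onGL f) :=
  hf.comp (continuous_id.subtype_mk _)

/-- The normalised induction whose Langlands quotient is the trivial representation. -/
abbrev indTrivial (n : ℕ) [NeZero n] (F : Type*) [NontriviallyNormedField F]
    [LocallyCompactSpace F] : Submodule ℂ (levi F (0 : Fin n → Fin n) → ℂ) :=
  ind 0 id (halfSum n) (Representation.trivial ℂ (levi F (id : Fin n → Fin n)) ℂ)

theorem indTrivial_covariant (f : indTrivial n F) : IsBorelCovariant (onGL f.1) :=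
  mem_covFns_halfSum_iff.1 f.2.1

theorem indTrivial_continuous (f : indTrivial n F) : Continuous (onGL f.1) :=
  continuous_onGL (continuous_of_mem_smoothPart f.2.2)

variable [MeasurableSpace (G n F)] [BorelSpace (G n F)]

/-- The invariant functional on the induced representation. -/
def trivialQuotient {η : G n F → ℝ} (hη : IsBorelUnit η) : indTrivial n F →ₗ[ℂ] ℂ where
  toFun f := borelIntegral η (onGL f.1)
  map_add' f f' := borelIntegral_add hη (indTrivial_continuous f) (indTrivial_continuous f')
  map_smul' a _ := borelIntegral_smul η a _

/-- Right invariance of the functional is the intertwining property. Surjectivity needs one function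
with non-zero integral, the positive `f₀`, whose invariance under an open subgroup makes it smooth.
-/
theorem isQuotientMap_trivialQuotient {η : G n F → ℝ} (hη : IsBorelUnit η) {f₀ : G n F → ℝ}
    (hf₀ : Continuous f₀) (hf₀δ : IsBorelCovariant (fun g => (f₀ g : ℂ))) (hf₀pos : ∀ g, 0 < f₀ g)
    {U : Subgroup (G n F)} (hU : IsOpen (U : Set (G n F))) (hf₀U : ∀ u ∈ U, ∀ g, f₀ (g * u) = f₀ g) :
    IsQuotientMap id (halfSum n) (Representation.trivial ℂ (levi F (id : Fin n → Fin n)) ℂ)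
      (Representation.trivial ℂ (G n F) ℂ) (trivialQuotient hη) := by
  refine ⟨fun z => ?_, fun g f f' h => ?_⟩
  · obtain ⟨a, ha, ha'⟩ := borelIntegral_pos hη hf₀ hf₀pos
    let f : indTrivial n F := ⟨fun x => f₀ x, mem_covFns_halfSum_iff.2 hf₀δ,
      U.comap (levi F (0 : Fin n → Fin n)).subtype, hU.preimage continuous_subtype_val,
      fun u hu => funext fun x => by
        change (f₀ ((x * u : levi F (0 : Fin n → Fin n)) : G n F) : ℂ) = f₀ x
        exact congrArg _ (hf₀U _ hu x)⟩
    refine ⟨(z / a) • f, ?_⟩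
    rw [map_smul]
    have : trivialQuotient hη f = a := ha'
    rw [this, smul_eq_mul, div_mul_cancel₀ _ (by exact_mod_cast ha.ne')]
  · have h1 := borelIntegral_mul_right hη (indTrivial_continuous f) (indTrivial_covariant f) g
    rw [Representation.trivial_apply]
    refine Eq.trans ?_ h1
    change borelIntegral η _ = _
    congr 1
    funext x
    exact h ⟨x, mem_levi_zero x⟩

end TrivialField

/-! ### Weights from integral matrices -/

section TrivialUltrametric

variable {n : ℕ} [NeZero n] {F : Type*} [NontriviallyNormedField F] [LocallyCompactSpace F]
  [IsUltrametricDist F]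

/-- The indicator function of the compact open subgroup of integral matrices works, as this subgroup
meets every coset of the Borel subgroup. -/
theorem exists_integral_weight (n : ℕ) (F : Type*) [NontriviallyNormedField F]
    [LocallyCompactSpace F] [IsUltrametricDist F] : ∃ φ : G n F → ℝ, Continuous φ ∧
    HasCompactSupport φ ∧ (∀ g, 0 ≤ φ g) ∧ (∀ g, ∃ b : borelSubgroup n F, 0 < φ (b * g)) ∧
    ∀ u ∈ integralSubgroup n F, ∀ g, φ (g * u) = φ g := by
  classical
  let U : Set (G n F) := integralSubgroup n F
  have hU : IsClopen U := ⟨Subgroup.isClosed_of_isOpen _ isOpen_integralSubgroup,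
    isOpen_integralSubgroup⟩
  refine ⟨U.indicator 1, ?_, ?_, fun g => Set.indicator_nonneg (fun _ _ => zero_le_one) g,
    fun g => ?_, fun u hu g => ?_⟩
  · exact continuous_one.indicator fun g hg => by simp [hU.frontier_eq] at hg
  · exact HasCompactSupport.intro isCompact_integralSubgroup
      fun g hg => Set.indicator_of_notMem hg _
  · obtain ⟨b, hb⟩ := exists_borel_mul_integral g
    refine ⟨b, ?_⟩
    rw [Set.indicator_of_mem hb]
    exact one_pos
  · by_cases hg : g ∈ integralSubgroup n F
    · rw [Set.indicator_of_mem (show g ∈ U from hg),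
        Set.indicator_of_mem (show g * u ∈ U from mul_mem hg hu)]
      rfl
    · rw [Set.indicator_of_notMem (show g ∉ U from hg), Set.indicator_of_notMem
        (show g * u ∉ U from fun h => hg ((Subgroup.mul_mem_cancel_right _ hu).1 h))]

theorem exists_trivialQuotient (n : ℕ) [NeZero n] (F : Type*) [NontriviallyNormedField F]
    [LocallyCompactSpace F] [IsUltrametricDist F] [MeasurableSpace (G n F)] [BorelSpace (G n F)] :
    ∃ (η : G n F → ℝ) (hη : IsBorelUnit η) (f₀ : G n F → ℝ), Continuous f₀ ∧
      IsBorelCovariant (fun g => (f₀ g : ℂ)) ∧ (∀ g, 0 < f₀ g) ∧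
      IsQuotientMap id (halfSum n) (Representation.trivial ℂ (levi F (id : Fin n → Fin n)) ℂ)
        (Representation.trivial ℂ (G n F) ℂ) (trivialQuotient hη) := by
  obtain ⟨φ, h1, h2, h3, h4, h5⟩ := exists_integral_weight n F
  obtain ⟨η, hη, -⟩ := exists_isBorelUnit h1 h2 h3 h4
  obtain ⟨f₀, k1, k2, k3, k4⟩ := exists_isBorelCovariant h1 h2 h3 h4
  exact ⟨η, hη, f₀, k1, k2, k3, isQuotientMap_trivialQuotient hη k1 k2 k3 isOpen_integralSubgroup
    fun u hu => k4 u (h5 u hu)⟩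

end TrivialUltrametric

/-! ### The trivial representation is a Shintani lift -/

section TrivialExt

variable {n : ℕ} [NeZero n] {F : Type*} [NontriviallyNormedField F] [LocallyCompactSpace F]
  [IsUltrametricDist F] {E : Type*} [NontriviallyNormedField E] [LocallyCompactSpace E]
  [IsUltrametricDist E] [NormedAlgebra F E] [FiniteDimensional F E] [IsGalois F E]
  {σ : E ≃ₐ[F] E} {ψ : AddChar F Circle}

/-- On diagonal matrices the character `Θ_ψ` is `1`, so every functional on `ℂ` is a Whittaker
functional, and the identity operator satisfies the normalisation. -/
theorem isGenericOp_trivial_torus : IsGenericOp σ ψ id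
    (Representation.trivial ℂ (levi E (id : Fin n → Fin n)) ℂ) LinearMap.id := by
  refine ⟨⟨LinearMap.id, fun h => ?_, fun u _ w => ?_, fun ℓ _ => ⟨ℓ 1, ?_⟩⟩,
    Function.bijective_id, fun _ _ => rfl, fun _ _ _ => rfl⟩
  · exact one_ne_zero (LinearMap.congr_fun h (1 : ℂ))
  · rw [thetaChar_torus, one_mul]; rfl
  · ext; simp

theorem charIdentity_trivial (b : Fin n → Fin n) :
    CharIdentity σ b (Representation.trivial ℂ (levi F b) ℂ) (Representation.trivial ℂ (levi E b) ℂ)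
      LinearMap.id :=
  ⟨_, _, isCharFn_trivial _, isCharFn_trivial _, fun _ _ _ _ => rfl⟩

/-- The function `f ∘ σ⁻¹` has the same integral over `B\G` as `f`, by `borelIntegral_galEquiv`, so
the operator induced on the quotient is the identity. -/
theorem isNormalizedOp_trivial :
    IsNormalizedOp σ ψ (Representation.trivial ℂ (G n E) ℂ) LinearMap.id := by
  have := ProperSpace.of_locallyCompactSpace F (E := F)
  borelize (G n E)
  obtain ⟨η, hη, f₀, h1, h2, h3, h4⟩ := exists_trivialQuotient n E
  refine ⟨isSmoothIrred_trivial, id, halfSum n, monotone_id, strictlyDecreasing_halfSum, ℂ,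
    inferInstance, inferInstance, Representation.trivial ℂ _ ℂ, LinearMap.id,
    isTempered_trivial_torus, isGenericOp_trivial_torus, trivialQuotient hη, h4, fun f => ?_⟩
  have hcov := (indTrivial_covariant f).comp_galEquiv σ⁻¹
  obtain ⟨U, hU, hfU⟩ := f.2.2
  let f' : indTrivial n E := ⟨fun x => onGL f.1 (galEquiv n σ⁻¹ x),
    mem_covFns_halfSum_iff.2 hcov, U.comap (galLevi σ⁻¹ 0), hU.preimage ?_, fun u hu => ?_⟩
  · refine ⟨f', fun x => ?_, borelIntegral_galEquiv hη σ⁻¹ h1 h2 h3 (indTrivial_continuous f)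
      (indTrivial_covariant f)⟩
    change f.1 _ = f.1 x
    refine congrArg f.1 (Subtype.ext ?_)
    exact (galEquiv n σ).symm_apply_apply x
  · exact ((continuous_galGL σ⁻¹).comp continuous_subtype_val).subtype_mk _
  · funext x
    have := congrFun (hfU _ hu) (galLevi σ⁻¹ 0 x)
    refine Eq.trans ?_ this
    change f.1 _ = f.1 _
    refine congrArg f.1 (Subtype.ext ?_)
    exact map_mul (galEquiv n σ⁻¹) (x : G n E) u

theorem isShintaniLift_trivial : IsShintaniLift σ ψ (Representation.trivial ℂ (G n F) ℂ)
    (Representation.trivial ℂ (G n E) ℂ) := by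
  borelize (G n E)
  borelize (G n F)
  obtain ⟨η, hη, f₀, h1, h2, h3, h4⟩ := exists_trivialQuotient n F
  obtain ⟨η', hη', f₀', h1', h2', h3', h4'⟩ := exists_trivialQuotient n E
  exact ⟨⟨isSmoothIrred_trivial, isSmoothIrred_trivial, id, halfSum n, monotone_id,
    strictlyDecreasing_halfSum, ℂ, inferInstance, inferInstance, Representation.trivial ℂ _ ℂ,
    ℂ, inferInstance, inferInstance, Representation.trivial ℂ _ ℂ, isTempered_trivial_torus,
    isTempered_trivial_torus, ⟨LinearMap.id, isGenericOp_trivial_torus, charIdentity_trivial id⟩,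
    ⟨_, h4⟩, _, h4'⟩, LinearMap.id, isNormalizedOp_trivial, charIdentity_trivial 0⟩

end TrivialExt

/-! ### Characters in the `p`-adic case -/

section Characters

variable {n : ℕ} [NeZero n] {F : Type*} [NontriviallyNormedField F] [LocallyCompactSpace F]
  [IsUltrametricDist F] {E : Type*} [NontriviallyNormedField E] [LocallyCompactSpace E]
  [IsUltrametricDist E] [NormedAlgebra F E] [FiniteDimensional F E] [IsGalois F E]
  {σ : E ≃ₐ[F] E} {ψ : AddChar F Circle} {χ : G n F →ₜ* ℂˣ} {χE : G n E →ₜ* ℂˣ}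

/-- By definition `charRep` is a twist of the trivial representation. -/
theorem isShintaniLift_charRep (hσ : ∀ s : E ≃ₐ[F] E, s ∈ Subgroup.zpowers σ)
    (h : IsNormComp σ χ χE) :
    IsShintaniLift σ ψ (charRep (χ : G n F →* ℂˣ)) (charRep (χE : G n E →* ℂˣ)) :=
  isShintaniLift_trivial.twist hσ h

theorem isNormalizedOp_charRep (hσ : ∀ s : E ≃ₐ[F] E, s ∈ Subgroup.zpowers σ)
    (h : IsNormComp σ χ χE) :
    IsNormalizedOp σ ψ (charRep (χE : G n E →* ℂˣ)) LinearMap.id :=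
  isNormalizedOp_trivial.twist hσ h

theorem absDet_mem_unramified (n : ℕ) (F : Type*) [NontriviallyNormedField F]
    [LocallyCompactSpace F] (z : ℂ) : absDet n F z ∈ unramified n F := by
  intro g hg
  ext
  rw [absDet_apply, hg]
  simp

theorem isNormComp_absDet (hσ : ∀ s : E ≃ₐ[F] E, s ∈ Subgroup.zpowers σ) (z : ℂ) :
    IsNormComp σ (absDet n F z) (absDet n E z) := by
  refine fun g => ⟨exists_isNorm hσ g, fun y hy => ?_⟩
  ext
  rw [absDet_apply, absDet_apply, normAbs_eq_normAbs_norm (F := F), det_of_isNorm hσ hy]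

/-- Up to units every element of `Fˣ` is a power of the uniformiser, so `χ` is determined by its
value `a` there, and `z` is chosen with `|ϖ|^z = a`. -/
theorem exists_eq_absDet {χ : G n F →ₜ* ℂˣ} (hχ : χ ∈ unramified n F) :
    ∃ z : ℂ, χ = absDet n F z := by
  have : Infinite F := NontriviallyNormedField.infinite F
  obtain ⟨ϖ, -, h2, h3⟩ := exists_uniformizer F
  have hϖ0 : 0 < normAbs (ϖ : F) := normAbs_pos ϖ.ne_zero
  have hlog : Real.log (normAbs (ϖ : F)) ≠ 0 := (Real.log_neg hϖ0 h2).ne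
  set a : ℂˣ := χ (dilation 0 ϖ)
  refine ⟨Complex.log a / Real.log (normAbs (ϖ : F)), ?_⟩
  set z : ℂ := Complex.log a / Real.log (normAbs (ϖ : F))
  have hdet : ∀ t : Fˣ, ((dilation 0 t : G n F) : Matrix (Fin n) (Fin n) F).det = t := fun t =>
    congrArg Units.val (det_dilation (0 : Fin n) t)
  have hz : absDet n F z (dilation 0 ϖ) = a := by
    ext
    rw [absDet_apply, hdet, Complex.cpow_def_of_ne_zero (by exact_mod_cast hϖ0.ne'),
      ← Complex.ofReal_log hϖ0.le, mul_div_cancel₀ _ (by exact_mod_cast hlog),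
      Complex.exp_log a.ne_zero]
  have key : ∀ t : Fˣ, χ (dilation 0 t) = absDet n F z (dilation 0 t) := by
    intro t
    obtain ⟨k, u, rfl, hu⟩ := h3 t
    have hu' : normAbs ((dilation 0 u : G n F) : Matrix (Fin n) (Fin n) F).det = 1 := by
      rw [hdet, normAbs_eq_one_of_norm_eq_one hu]
    rw [map_mul, map_mul, map_mul, hχ _ hu', absDet_mem_unramified n F z _ hu', map_zpow, map_zpow,
      map_zpow, hz]
  ext1 g
  have h4 := map_eq_map_dilation_det (χ : G n F →* ℂˣ) 0 g
  have h5 := map_eq_map_dilation_det (absDet n F z : G n F →* ℂˣ) 0 g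
  exact h4.trans ((key _).trans h5.symm)

theorem baseChangeChar_mem_unramified (hσ : ∀ s : E ≃ₐ[F] E, s ∈ Subgroup.zpowers σ)
    (hχ : χ ∈ unramified n F) : baseChangeChar n F E χ ∈ unramified n E := by
  intro g hg
  have h := isNormComp_baseChangeChar hσ χ g
  obtain ⟨y, hy⟩ := h.1
  rw [h.2 y hy]
  apply hχ
  rw [det_of_isNorm hσ hy, ← normAbs_eq_normAbs_norm, hg]

/-- An unramified character over `E` is `|det|_E^z` for some `z`, hence the image of `|det|_F^z`. -/
theorem exists_unramified_baseChange (hσ : ∀ s : E ≃ₐ[F] E, s ∈ Subgroup.zpowers σ) :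
    ∃ L : unramified n F →* unramified n E, Function.Surjective L ∧
      ∀ χ : unramified n F, IsNormComp σ (χ : G n F →ₜ* ℂˣ) (L χ : G n E →ₜ* ℂˣ) := by
  refine ⟨((baseChangeChar n F E).comp (unramified n F).subtype).codRestrict _
    fun χ => baseChangeChar_mem_unramified hσ χ.2, fun χ' => ?_,
    fun χ => isNormComp_baseChangeChar hσ _⟩
  obtain ⟨z, hz⟩ := exists_eq_absDet χ'.2
  refine ⟨⟨absDet n F z, absDet_mem_unramified n F z⟩, Subtype.ext ?_⟩
  rw [hz]
  exact (isNormComp_baseChangeChar hσ (absDet n F z)).ext (isNormComp_absDet hσ z)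

end Characters

end Padic

end Shintani

namespace Shintani

set_option linter.unusedSectionVars false

namespace Arch

/-! ### Twisting in the Archimedean case -/

/-- Integrating the functional equation over `[0, ε]` gives `c(t) Φ(ε) = Φ(t + ε) - Φ(t)` for the
primitive `Φ` of `c`, which is differentiable; some `Φ(ε)` is non-zero because `Φ'(0) = 1`. -/
theorem exists_hasDerivAt_of_map_add {c : ℝ → ℂ} (hc : Continuous c) (h0 : c 0 = 1)
    (hadd : ∀ s t, c (s + t) = c s * c t) : ∃ a, HasDerivAt c a 0 := by
  let Φ : ℝ → ℂ := fun x => ∫ t in (0 : ℝ)..x, c t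
  have hΦ : ∀ x, HasDerivAt Φ (c x) x := fun x =>
    intervalIntegral.integral_hasDerivAt_right (hc.intervalIntegrable _ _)
      (hc.stronglyMeasurableAtFilter _ _) hc.continuousAt
  have hne : ∃ ε, Φ ε ≠ 0 := by
    by_contra! h
    have h1 : HasDerivAt Φ 0 0 := by
      have : Φ = fun _ => 0 := funext h
      rw [this]
      exact hasDerivAt_const _ _
    have := (hΦ 0).unique h1
    rw [h0] at this
    exact one_ne_zero this
  obtain ⟨ε, hε⟩ := hne
  have hform : ∀ t, c t = (Φ (t + ε) - Φ t) * (Φ ε)⁻¹ := by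
    intro t
    rw [eq_mul_inv_iff_mul_eq₀ hε]
    have h1 : Φ (t + ε) - Φ t = ∫ s in t..t + ε, c s :=
      intervalIntegral.integral_interval_sub_left (hc.intervalIntegrable _ _)
        (hc.intervalIntegrable _ _)
    have h2 := intervalIntegral.integral_comp_add_left (a := 0) (b := ε) c t
    rw [add_zero] at h2
    rw [h1, ← h2]
    simp only [hadd]
    rw [intervalIntegral.integral_const_mul]
  refine ⟨(c (0 + ε) - c 0) * (Φ ε)⁻¹, ?_⟩
  have h3 : HasDerivAt (fun t => Φ (t + ε)) (c (0 + ε)) 0 :=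
    HasDerivAt.comp_add_const 0 ε (hΦ (0 + ε))
  exact ((h3.sub (hΦ 0)).mul_const (Φ ε)⁻¹).congr_of_eventuallyEq (Eventually.of_forall hform)

/-! ### Twists: `K`-finite vectors, derivatives, smooth vectors, characters -/

section Twist

variable {H : Type*} [Group H] [TopologicalSpace H]

theorem exists_hasDerivAt_char {χ : H →* ℂˣ} (hχ : Continuous fun g => (χ g : ℂ)) (γ : OnePar H) :
    ∃ a : ℂ, HasDerivAt (fun t : ℝ => (χ (γ (Multiplicative.ofAdd t)) : ℂ)) a 0 := by
  refine exists_hasDerivAt_of_map_add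
    (hχ.comp (γ.continuous_toFun.comp continuous_ofAdd)) (by simp) fun s t => ?_
  rw [ofAdd_add, map_mul, map_mul, Units.val_mul]

theorem continuous_inv_char {χ : H →* ℂˣ} (hχ : Continuous fun g => (χ g : ℂ)) :
    Continuous fun g => (χ⁻¹ g : ℂ) := by
  simp only [MonoidHom.inv_apply, Units.val_inv_eq_inv_val]
  exact hχ.inv₀ fun g => (χ g).ne_zero

theorem mem_kFin_iff {V : Type*} [AddCommGroup V] [Module ℂ V] {K : Subgroup H}
    {ρ : Representation ℂ H V} {v : V} :
    v ∈ kFin K ρ ↔ ∃ S : Submodule ℂ V, FiniteDimensional ℂ S ∧ (∀ k ∈ K, ∀ v ∈ S, ρ k v ∈ S) ∧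
      v ∈ S := by
  rw [kFin, Submodule.mem_sSup_of_directed]
  · simp only [Set.mem_ofPred_eq, and_assoc]
  · exact ⟨⊥, inferInstance, fun k _ v hv => by
      rw [(Submodule.mem_bot ℂ).1 hv, map_zero]; exact zero_mem _⟩
  · rintro S ⟨hS, hS'⟩ T ⟨hT, hT'⟩
    refine ⟨S ⊔ T, ⟨Submodule.finiteDimensional_sup S T, fun k hk v hv => ?_⟩, le_sup_left,
      le_sup_right⟩
    obtain ⟨s, hs, t, ht, rfl⟩ := Submodule.mem_sup.1 hv
    rw [map_add]
    exact Submodule.add_mem_sup (hS' k hk s hs) (hT' k hk t ht)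

theorem mulChar_mem_kFin {W : Type*} [AddCommGroup W] [Module ℂ W] {K : Subgroup H} (χ : H →* ℂˣ)
    {f : H → W} (hf : f ∈ kFin K (rightReg H W)) : mulChar W χ f ∈ kFin K (rightReg H W) := by
  obtain ⟨S, hS, hS', hfS⟩ := mem_kFin_iff.1 hf
  refine mem_kFin_iff.2 ⟨S.map (mulChar W χ).toLinearMap, inferInstance, ?_,
    Submodule.mem_map_of_mem hfS⟩
  rintro k hk _ ⟨f, hf, rfl⟩
  refine ⟨(χ k : ℂ) • rightReg H W k f, S.smul_mem _ (hS' k hk f hf), ?_⟩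
  funext x
  change (χ x : ℂ) • (χ k : ℂ) • f (x * k) = (χ (x * k) : ℂ) • f (x * k)
  rw [smul_smul, map_mul, Units.val_mul]

/-- `ρ' = χρ` -/
def IsTwist {V : Type*} [AddCommGroup V] [Module ℂ V] (χ : H →* ℂˣ)
    (ρ ρ' : Representation ℂ H V) : Prop :=
  ∀ g v, ρ' g v = (χ g : ℂ) • ρ g v

theorem isTwist_twist {V : Type*} [AddCommGroup V] [Module ℂ V] (χ : H →* ℂˣ)
    (ρ : Representation ℂ H V) : IsTwist χ ρ (twist χ ρ) := fun _ _ => rfl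

/-- A twist expressed as a relation can be inverted, so each inclusion or implication proved for
twists has its converse. -/
theorem IsTwist.symm {V : Type*} [AddCommGroup V] [Module ℂ V] {χ : H →* ℂˣ}
    {ρ ρ' : Representation ℂ H V} (h : IsTwist χ ρ ρ') : IsTwist χ⁻¹ ρ' ρ := fun g v => by
  rw [h, smul_smul, MonoidHom.inv_apply, Units.inv_mul, one_smul]

theorem IsTwist.kFin_le {V : Type*} [AddCommGroup V] [Module ℂ V] {χ : H →* ℂˣ}
    {ρ ρ' : Representation ℂ H V} (h : IsTwist χ ρ ρ') (K : Subgroup H) : kFin K ρ ≤ kFin K ρ' := by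
  intro v hv
  obtain ⟨S, hS, hS', hvS⟩ := mem_kFin_iff.1 hv
  exact mem_kFin_iff.2 ⟨S, hS, fun k hk v hv => by
    rw [h]; exact S.smul_mem _ (hS' k hk v hv), hvS⟩

theorem IsTwist.kFin_eq {V : Type*} [AddCommGroup V] [Module ℂ V] {χ : H →* ℂˣ}
    {ρ ρ' : Representation ℂ H V} (h : IsTwist χ ρ ρ') (K : Subgroup H) : kFin K ρ = kFin K ρ' :=
  le_antisymm (h.kFin_le K) (h.symm.kFin_le K)

/-- The `K`-finite vectors of a representation and of its twist are equal submodules but different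
types, so operators are carried across by `LinearEquiv.ofEq`. -/
theorem finTrace_conj_ofEq {V : Type*} [AddCommGroup V] [Module ℂ V] {S S' : Submodule ℂ V}
    (h : S = S') (T : S →ₗ[ℂ] S) : finTrace ((LinearEquiv.ofEq S S' h).conj T) = finTrace T := by
  subst h
  rfl

theorem finiteDimensional_range_conj_ofEq {V : Type*} [AddCommGroup V] [Module ℂ V]
    {S S' : Submodule ℂ V} (h : S = S') (T : S →ₗ[ℂ] S)
    (hT : FiniteDimensional ℂ (LinearMap.range T)) :
    FiniteDimensional ℂ (LinearMap.range ((LinearEquiv.ofEq S S' h).conj T)) := by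
  subst h
  exact hT

theorem coe_conj_ofEq {V : Type*} [AddCommGroup V] [Module ℂ V] {S S' : Submodule ℂ V}
    (h : S = S') (T : S →ₗ[ℂ] S) (v : S) (v' : S') (hv : (v : V) = v') :
    ((LinearEquiv.ofEq S S' h).conj T v' : V) = T v := by
  subst h
  have : v = v' := Subtype.ext hv
  rw [this]
  rfl

variable {V : Type*} [NormedAddCommGroup V] [InnerProductSpace ℂ V] {ρ ρ' : Representation ℂ H V}
  {χ : H →* ℂˣ}

theorem IsTwist.isDeriv (h : IsTwist χ ρ ρ') {γ : OnePar H} {a : ℂ}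
    (ha : HasDerivAt (fun t : ℝ => (χ (γ (Multiplicative.ofAdd t)) : ℂ)) a 0) {v w : V}
    (hvw : IsDeriv ρ γ v w) : IsDeriv ρ' γ v (w + a • v) := by
  have h1 := ha.smul hvw
  simp only [ofAdd_zero, map_one, Units.val_one, one_smul, Module.End.one_apply] at h1
  rw [IsDeriv]
  simp only [h _ _]
  exact h1

theorem isFunDeriv_mulChar {W : Type*} [NormedAddCommGroup W] [InnerProductSpace ℂ W]
    {γ : OnePar H} {a : ℂ}
    (ha : HasDerivAt (fun t : ℝ => (χ (γ (Multiplicative.ofAdd t)) : ℂ)) a 0) {f f' : H → W}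
    (hf : IsFunDeriv γ f f') :
    IsFunDeriv γ (mulChar W χ f) (mulChar W χ (f' + a • f)) := by
  intro x
  have h1 := (ha.smul (hf x)).const_smul (χ x : ℂ)
  simp only [ofAdd_zero, map_one, Units.val_one, one_smul, mul_one] at h1
  refine HasDerivAt.congr_deriv (h1.congr_of_eventuallyEq (Eventually.of_forall fun t => ?_)) rfl
  change (χ (x * _) : ℂ) • f _ = (χ x : ℂ) • (χ _ : ℂ) • f _
  rw [map_mul, Units.val_mul, smul_smul]

/-- A version of `isFunDeriv_mulChar` for a given derivative of the product. -/
theorem isFunDeriv_mulChar_of_sub {W : Type*} [NormedAddCommGroup W] [InnerProductSpace ℂ W]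
    {γ : OnePar H} {a : ℂ}
    (ha : HasDerivAt (fun t : ℝ => (χ (γ (Multiplicative.ofAdd t)) : ℂ)) a 0) {f f' : H → W}
    (hf : IsFunDeriv γ f (f' - a • f)) : IsFunDeriv γ (mulChar W χ f) (mulChar W χ f') := by
  have := isFunDeriv_mulChar ha hf
  rwa [sub_add_cancel] at this

theorem IsTwist.isDeriv_sub (h : IsTwist χ ρ ρ') {γ : OnePar H} {a : ℂ}
    (ha : HasDerivAt (fun t : ℝ => (χ (γ (Multiplicative.ofAdd t)) : ℂ)) a 0) {v w : V}
    (hvw : IsDeriv ρ' γ v w) : IsDeriv ρ γ v (w - a • v) := by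
  have hb : HasDerivAt (fun t : ℝ => (χ⁻¹ (γ (Multiplicative.ofAdd t)) : ℂ)) (-a) 0 := by
    have := ha.inv (by simp)
    simp only [ofAdd_zero, map_one, Units.val_one, one_pow, div_one] at this
    refine this.congr_of_eventuallyEq (Eventually.of_forall fun t => ?_)
    simp
  have := h.symm.isDeriv hb hvw
  rwa [neg_smul, ← sub_eq_add_neg] at this

theorem IsIterDeriv.unique {L : List (OnePar H)} :
    ∀ {v w w' : V}, IsIterDeriv ρ L v w → IsIterDeriv ρ L v w' → w = w' := by
  induction L with
  | nil => intro v w w' h h'; exact Eq.trans h (Eq.symm h')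
  | cons γ L ih =>
    rintro v w w' ⟨u, hu, h⟩ ⟨u', hu', h'⟩
    rw [ih hu hu'] at h
    exact HasDerivAt.unique h h'

/-- By the Leibniz rule `dρ'(X) = dρ(X) + a` with a constant `a`, so a product of such operators
expands over the sublists of `L`. The coefficients do not depend on the vector, so the lemma
compares the smooth vectors as well as their seminorms. -/
theorem IsTwist.exists_isIterDeriv (h : IsTwist χ ρ ρ') (hχ : Continuous fun g => (χ g : ℂ))
    (L : List (OnePar H)) : ∃ c : List (OnePar H) →₀ ℂ, ∀ (v : V) (w : List (OnePar H) → V),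
      (∀ M, M.Sublist L → IsIterDeriv ρ M v (w M)) →
      IsIterDeriv ρ' L v (c.sum fun M z => z • w M) ∧ ∀ M ∈ c.support, M.Sublist L := by
  induction L with
  | nil =>
    refine ⟨Finsupp.single [] 1, fun v w hw => ⟨?_, fun M hM => ?_⟩⟩
    · have h1 : (Finsupp.single [] 1 : List (OnePar H) →₀ ℂ).sum (fun M z => z • w M) =
          (1 : ℂ) • w [] := Finsupp.sum_single_index (zero_smul ℂ _)
      rw [h1, one_smul]
      exact hw [] (List.Sublist.refl _)
    · have := Finsupp.support_single_subset hM
      rw [Finset.mem_singleton] at this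
      rw [this]
  | cons γ L ih =>
    obtain ⟨c, hc⟩ := ih
    obtain ⟨a, ha⟩ := exists_hasDerivAt_char hχ γ
    refine ⟨c.mapDomain (List.cons γ) + a • c, fun v w hw => ?_⟩
    obtain ⟨h1, h2⟩ := hc v w fun M hM => hw M (hM.cons γ)
    have h3 : IsDeriv ρ γ (c.sum fun M z => z • w M) (c.sum fun M z => z • w (γ :: M)) := by
      rw [IsDeriv, Finsupp.sum, Finsupp.sum]
      simp only [map_sum, map_smul]
      refine HasDerivAt.fun_sum fun M hM => HasDerivAt.fun_const_smul _ ?_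
      obtain ⟨u, hu, hu'⟩ := hw (γ :: M) ((h2 M hM).cons_cons γ)
      rw [hu.unique (hw M ((h2 M hM).cons γ))] at hu'
      exact hu'
    refine ⟨⟨_, h1, ?_⟩, fun M hM => ?_⟩
    · have h4 := h.isDeriv ha h3
      have h5 : (c.mapDomain (List.cons γ) + a • c).sum (fun M z => z • w M) =
          (c.sum fun M z => z • w (γ :: M)) + a • c.sum fun M z => z • w M := by
        rw [Finsupp.sum_add_index' (h := fun M z => z • w M) (fun _ => zero_smul ℂ _)
            fun _ _ _ => add_smul _ _ _,
          Finsupp.sum_mapDomain_index (h := fun M z => z • w M) (fun _ => zero_smul ℂ _)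
            fun _ _ _ => add_smul _ _ _,
          Finsupp.sum_smul_index (h := fun M z => z • w M) fun _ => zero_smul ℂ _,
          Finsupp.smul_sum]
        simp only [mul_smul]
      rw [h5]
      exact h4
    · classical
      rcases Finset.mem_union.1 (Finsupp.support_add hM) with hM | hM
      · obtain ⟨M', hM', rfl⟩ := Finset.mem_image.1 (Finsupp.mapDomain_support hM)
        exact (h2 M' hM').cons_cons γ
      · exact (h2 M (Finsupp.support_smul hM)).cons γ

theorem IsTwist.smoothVec_le (h : IsTwist χ ρ ρ') (hχ : Continuous fun g => (χ g : ℂ)) :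
    smoothVec ρ ≤ smoothVec ρ' := by
  intro v hv L
  choose w hw using hv
  obtain ⟨c, hc⟩ := h.exists_isIterDeriv hχ L
  exact ⟨_, (hc v w fun M _ => hw M).1⟩

theorem IsTwist.smoothVec_eq (h : IsTwist χ ρ ρ') (hχ : Continuous fun g => (χ g : ℂ)) :
    smoothVec ρ = smoothVec ρ' :=
  le_antisymm (h.smoothVec_le hχ) (h.symm.smoothVec_le (continuous_inv_char hχ))

/-- The transport of a functional on smooth vectors to a twist. -/
def IsTwist.dual (h : IsTwist χ ρ ρ') (hχ : Continuous fun g => (χ g : ℂ))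
    (ℓ : Module.Dual ℂ (smoothVec ρ)) : Module.Dual ℂ (smoothVec ρ') :=
  ℓ ∘ₗ (LinearEquiv.ofEq _ _ (h.smoothVec_eq hχ)).symm.toLinearMap

/-- Each seminorm of `ρ` is bounded by a combination of the seminorms of `ρ'` attached to sublists.
-/
theorem IsTwist.isContFunctional (h : IsTwist χ ρ ρ') (hχ : Continuous fun g => (χ g : ℂ))
    {ℓ : Module.Dual ℂ (smoothVec ρ)} (hℓ : IsContFunctional ρ ℓ) :
    IsContFunctional ρ' (h.dual hχ ℓ) := by
  classical
  obtain ⟨S, C, hS⟩ := hℓ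
  choose c hc using h.symm.exists_isIterDeriv (continuous_inv_char hχ)
  let S' : Finset (List (OnePar H)) := S.biUnion fun L => L.sublists.toFinset
  have hS' : ∀ L ∈ S, ∀ M, M.Sublist L → M ∈ S' := fun L hL M hM =>
    Finset.mem_biUnion.2 ⟨L, hL, by simpa using hM⟩
  refine ⟨S', |C| * ∑ L ∈ S, ∑ M ∈ (c L).support, ‖c L M‖, fun v w hw => ?_⟩
  have h1 : ∀ L ∈ S, IsIterDeriv ρ L v ((c L).sum fun M z => z • w M) ∧
      ∀ M ∈ (c L).support, M.Sublist L :=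
    fun L hL => hc L v w fun M hM => hw M (hS' L hL M hM)
  have h2 := hS ((LinearEquiv.ofEq _ _ (h.smoothVec_eq hχ)).symm v)
    (fun L => (c L).sum fun M z => z • w M) fun L hL => (h1 L hL).1
  have h3 : ∀ L ∈ S, ‖(c L).sum fun M z => z • w M‖ ≤
      (∑ M ∈ (c L).support, ‖c L M‖) * ∑ M ∈ S', ‖w M‖ := by
    intro L hL
    rw [Finsupp.sum, Finset.sum_mul]
    refine (norm_sum_le _ _).trans (Finset.sum_le_sum fun M hM => ?_)
    rw [norm_smul]
    exact mul_le_mul_of_nonneg_left (Finset.single_le_sum (f := fun M => ‖w M‖)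
      (fun _ _ => norm_nonneg _) (hS' L hL M ((h1 L hL).2 M hM))) (norm_nonneg _)
  refine h2.trans ?_
  have h4 : (0 : ℝ) ≤ ∑ L ∈ S, ‖(c L).sum fun M z => z • w M‖ :=
    Finset.sum_nonneg fun _ _ => norm_nonneg _
  refine (mul_le_mul_of_nonneg_right (le_abs_self C) h4).trans ?_
  rw [mul_assoc, Finset.sum_mul]
  exact mul_le_mul_of_nonneg_left (Finset.sum_le_sum h3) (abs_nonneg C)

theorem IsTwist.isIrredAdm (h : IsTwist χ ρ ρ') (hχ : Continuous fun g => (χ g : ℂ))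
    {K : Subgroup H} (hρ : IsIrredAdm K ρ) : IsIrredAdm K ρ' := by
  obtain ⟨h1, h2, h3, h4⟩ := hρ
  refine ⟨?_, h2, fun S hS hS' => h3 S hS fun g v hv => ?_, fun m κ => ?_⟩
  · simp only [h _ _]
    exact (hχ.comp continuous_fst).smul h1
  · rw [h.symm g v]
    exact S.smul_mem _ (hS' g v hv)
  · have h5 := h4 m (twist ((χ⁻¹).comp K.subtype) κ)
    have h6 : Representation.linHom κ (ρ'.comp K.subtype) =
        Representation.linHom (twist ((χ⁻¹).comp K.subtype) κ) (ρ.comp K.subtype) := by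
      refine MonoidHom.ext fun k => LinearMap.ext fun f => LinearMap.ext fun v => ?_
      change ρ' k (f (κ k⁻¹ v)) = ρ k (f ((((χ ((k⁻¹ : K) : H))⁻¹ : ℂˣ) : ℂ) • κ k⁻¹ v))
      have h7 : (χ ((k⁻¹ : K) : H))⁻¹ = χ k := by rw [Subgroup.coe_inv, map_inv χ, inv_inv]
      rw [map_smul, map_smul, h, h7]
    rw [h6]
    exact h5

theorem IsTwist.isUnitary (h : IsTwist χ ρ ρ') (hχ : ∀ g, ‖(χ g : ℂ)‖ = 1) (hρ : IsUnitary ρ) :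
    IsUnitary ρ' := by
  intro g v w
  rw [h, h, inner_smul_left, inner_smul_right, hρ, ← mul_assoc, mul_comm ((starRingEnd ℂ) _),
    Complex.mul_conj, Complex.normSq_eq_norm_sq, hχ]
  simp

theorem IsTwist.isSquareIntegrable (h : IsTwist χ ρ ρ') (hχ : Continuous fun g => (χ g : ℂ))
    (hχ1 : ∀ g, ‖(χ g : ℂ)‖ = 1) {K : Subgroup H} (hρ : IsSquareIntegrable K ρ) :
    IsSquareIntegrable K ρ' := by
  obtain ⟨h1, h2, v, w, ⟨g, hg⟩, h3⟩ := hρ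
  refine ⟨h.isIrredAdm hχ h1, h.isUnitary hχ1 h2, v, w, ⟨g, ?_⟩, ?_⟩
  · rw [h, inner_smul_right]
    exact mul_ne_zero (Units.ne_zero _) hg
  · simp only [h _ _, inner_smul_right]
    exact Padic.SqIntModCenter.mul_left hχ1 h3

theorem IsSmoothFn.mulChar (hχ : Continuous fun g => (χ g : ℂ)) {f : H → ℂ} (hf : IsSmoothFn f) :
    IsSmoothFn (Shintani.mulChar ℂ χ f) := by
  obtain ⟨S, hfS, hS⟩ := hf
  -- The derivative of `χh` is `χ(h' + a h)`, so the family `S` is enlarged to its linear span.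
  have h1 : ∀ h ∈ Submodule.span ℂ S, Continuous h ∧
      ∀ γ : OnePar H, ∃ h' ∈ Submodule.span ℂ S, IsFunDeriv γ h h' := by
    intro h hh
    induction hh using Submodule.span_induction with
    | mem h hh =>
      refine ⟨(hS h hh).1, fun γ => ?_⟩
      obtain ⟨h', hh', hd⟩ := (hS h hh).2 γ
      exact ⟨h', Submodule.subset_span hh', hd⟩
    | zero => exact ⟨continuous_zero, fun γ => ⟨0, zero_mem _, fun x => hasDerivAt_const _ _⟩⟩
    | add f g _ _ hf hg =>
      refine ⟨hf.1.add hg.1, fun γ => ?_⟩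
      obtain ⟨f', hf', hfd⟩ := hf.2 γ
      obtain ⟨g', hg', hgd⟩ := hg.2 γ
      exact ⟨f' + g', add_mem hf' hg', fun x => (hfd x).fun_add (hgd x)⟩
    | smul a f _ hf =>
      refine ⟨hf.1.const_smul a, fun γ => ?_⟩
      obtain ⟨f', hf', hfd⟩ := hf.2 γ
      exact ⟨a • f', Submodule.smul_mem _ a hf', fun x => (hfd x).fun_const_smul a⟩
  refine ⟨Shintani.mulChar ℂ χ '' (Submodule.span ℂ S : Set (H → ℂ)),
    ⟨f, Submodule.subset_span hfS, rfl⟩, ?_⟩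
  rintro _ ⟨h, hh, rfl⟩
  refine ⟨hχ.smul (h1 h hh).1, fun γ => ?_⟩
  obtain ⟨h', hh', hd⟩ := (h1 h hh).2 γ
  obtain ⟨a, ha⟩ := exists_hasDerivAt_char hχ γ
  exact ⟨_, ⟨_, add_mem hh' (Submodule.smul_mem _ a hh), rfl⟩, isFunDeriv_mulChar ha hd⟩

theorem IsHecke.mulChar (hχ : Continuous fun g => (χ g : ℂ)) {K : Subgroup H} {f : H → ℂ}
    (hf : IsHecke K f) : IsHecke K (Shintani.mulChar ℂ χ f) := by
  refine ⟨IsSmoothFn.mulChar hχ hf.1, hf.2.1.smul_left, mulChar_mem_kFin χ hf.2.2.1, ?_⟩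
  have := mulChar_mem_kFin χ⁻¹ hf.2.2.2
  refine (congrArg (· ∈ kFin K (rightReg H ℂ)) (funext fun x => ?_)).mp this
  rw [mulChar_apply, mulChar_apply, map_inv, MonoidHom.inv_apply]

theorem IsTwist.isCharFn (h : IsTwist χ ρ ρ') (hχ : Continuous fun g => (χ g : ℂ))
    {K : Subgroup H} {A : kFin K ρ →ₗ[ℂ] kFin K ρ} {reg : Set H} {Θ : H → ℂ}
    (hρ : IsCharFn K ρ A reg Θ) :
    IsCharFn K ρ' ((LinearEquiv.ofEq _ _ (h.kFin_eq K)).conj A) reg fun x => χ x * Θ x := by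
  obtain ⟨m, hm, μ, hμ, h1, h2, h3⟩ := hρ
  refine ⟨m, hm, μ, hμ, LocallyIntegrable.continuous_mul h1 hχ, hχ.continuousOn.mul h2,
    fun f hf => ?_⟩
  obtain ⟨T, hT1, hT2, hT3⟩ := h3 _ (IsHecke.mulChar hχ hf)
  refine ⟨(LinearEquiv.ofEq _ _ (h.kFin_eq K)).conj T, fun v w => ?_,
    finiteDimensional_range_conj_ofEq _ _ hT2, ?_⟩
  · have h4 := hT1 ((LinearEquiv.ofEq _ _ (h.kFin_eq K)).symm v) w
    refine (h4.trans ?_)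
    congr 1
    funext g
    rw [h, inner_smul_right, mulChar_apply, smul_eq_mul]
    change _ = f g * ((χ g : ℂ) * inner ℂ w (ρ g (v : V)))
    rw [← mul_assoc, mul_comm (f g)]
    rfl
  · have h5 := LinearEquiv.conj_comp (LinearEquiv.ofEq _ _ (h.kFin_eq K)) A T
    refine (congrArg finTrace h5.symm).trans ?_
    rw [finTrace_conj_ofEq, hT3]
    congr 1
    funext g
    rw [mulChar_apply, smul_eq_mul]
    ring

end Twist

end Arch

end Shintani

namespace Shintani

set_option linter.unusedSectionVars false

namespace Arch

/-! ### Twisting induced `(𝔤, K)`-modules and tempered representations -/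

section TwistField

variable {n : ℕ} {F : Type*} [RCLike F]
  {V : Type*} [NormedAddCommGroup V] [InnerProductSpace ℂ V]
  {W : Type*} [NormedAddCommGroup W] [InnerProductSpace ℂ W]

theorem continuous_char (χ : G n F →ₜ* ℂˣ) : Continuous fun g => (χ g : ℂ) :=
  Units.continuous_val.comp χ.continuous_toFun

theorem continuous_resChar (b : Fin n → Fin n) (χ : G n F →ₜ* ℂˣ) :
    Continuous fun g => (resChar b χ g : ℂ) :=
  (continuous_char χ).comp continuous_subtype_val

variable [NeZero n] {s : ℝ} {χ χ₀ : G n F →ₜ* ℂˣ}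

/-- Multiplication by a character on induced representations. -/
def indTwist {b c : Fin n → Fin n} (hc : Monotone c) (α : Fin n → ℝ)
    (τ : Representation ℂ (levi F c) W) (hχ : IsUnitaryPart s χ χ₀) :
    ind b c α τ ≃ₗ[ℂ] ind (F := F) b c (fun k => α k + s) (twist (resChar c χ₀) τ) :=
  (mulChar W (resChar b χ)).ofSubmodules _ _ (by
    ext f
    rw [Submodule.mem_map]
    constructor
    · rintro ⟨f, hf, rfl⟩
      exact ⟨⟨mulChar_mem_covFns hc hχ hf.1.1, (continuous_resChar b χ).smul hf.1.2⟩,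
        mulChar_mem_kFin _ hf.2⟩
    · intro hf
      refine ⟨mulChar W (resChar b χ)⁻¹ f, ⟨⟨?_, ?_⟩, ?_⟩, mulChar_mulChar_inv _ _⟩
      · refine (mulChar_mem_covFns_iff hc hχ).1 ?_
        exact (mulChar_mulChar_inv (resChar b χ) f).symm ▸ hf.1.1
      · exact (continuous_inv_char (continuous_resChar b χ)).smul hf.1.2
      · exact mulChar_mem_kFin _ hf.2)

theorem indTwist_apply {b c : Fin n → Fin n} (hc : Monotone c) (α : Fin n → ℝ)
    (τ : Representation ℂ (levi F c) W) (hχ : IsUnitaryPart s χ χ₀) (f : ind b c α τ)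
    (x : levi F b) : (indTwist hc α τ hχ f).1 x = (χ x : ℂ) • f.1 x := rfl

theorem indTwist_symm_apply {b c : Fin n → Fin n} (hc : Monotone c) (α : Fin n → ℝ)
    (τ : Representation ℂ (levi F c) W) (hχ : IsUnitaryPart s χ χ₀)
    (f : ind (F := F) b c (fun k => α k + s) (twist (resChar c χ₀) τ))
    (x : levi F b) : ((indTwist hc α τ hχ).symm f).1 x = ((χ x)⁻¹ : ℂˣ) • f.1 x := rfl

theorem IsTempered.twist {b : Fin n → Fin n} {τ : Representation ℂ (levi F b) V}
    (h : IsTempered b τ) (hχ : ∀ g, ‖(χ g : ℂ)‖ = 1) :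
    IsTempered (F := F) b (twist (resChar b χ) τ) := by
  obtain ⟨h1, h2, c, hcb, W, _, _, _, δ, hδ, e, he, he'⟩ := h
  have hup : IsUnitaryPart 0 χ χ := ⟨fun g => by simp, hχ⟩
  have h0 : (fun k : Fin n => (0 : Fin n → ℝ) k + 0) = 0 := by ext; simp
  have ht := isTwist_twist (resChar b χ) τ
  have hcont := continuous_resChar b χ
  let q := LinearEquiv.ofEq _ _ (ht.kFin_eq (maxCompact F b)).symm
  refine ⟨ht.isIrredAdm hcont h1, ht.isUnitary (fun g => hχ g) h2, c, hcb, W, inferInstance,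
    inferInstance, inferInstance, Shintani.twist (resChar c χ) δ,
    (isTwist_twist (resChar c χ) δ).isSquareIntegrable (continuous_resChar c χ)
      (fun g => hχ g) hδ, ?_⟩
  rw [← h0]
  refine ⟨q.trans (e.trans (indTwist hcb.1 0 δ hup)), fun k hk v v' hv x => ?_,
    fun γ v v' hv => ?_⟩
  · have h3 := he k hk (q v) (((resChar b χ k)⁻¹ : ℂˣ) • q v') (by
      change ((resChar b χ k)⁻¹ : ℂˣ) • (v' : V) = τ k (v : V)
      rw [hv, twist_apply, Units.smul_def, smul_smul, Units.inv_mul, one_smul]) x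
    rw [Units.smul_def, map_smul] at h3
    change (χ x : ℂ) • (e (q v')).1 x = (χ ((x * k : levi F b) : G n F) : ℂ) • (e (q v)).1 (x * k)
    rw [← h3]
    change _ = _ • (((resChar b χ k)⁻¹ : ℂˣ) : ℂ) • (e (q v')).1 x
    have : (χ ((x * k : levi F b) : G n F) : ℂ) = χ x * resChar b χ k := by
      rw [← Units.val_mul]
      exact congrArg Units.val (map_mul χ (x : G n F) (k : G n F))
    rw [smul_smul, this, mul_assoc, Units.mul_inv, mul_one]
  · obtain ⟨a, ha⟩ := exists_hasDerivAt_char hcont γ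
    have h3 := he' γ (q v) (q v' - a • q v) (ht.isDeriv_sub ha hv)
    rw [map_sub, map_smul] at h3
    exact isFunDeriv_mulChar_of_sub ha h3

theorem isTwist_resLevi (b : Fin n → Fin n) (χ : G n F →ₜ* ℂˣ) (π : Representation ℂ (G n F) V) :
    IsTwist (resChar b χ) (resLevi b π) (resLevi b (twist (χ : G n F →* ℂˣ) π)) :=
  fun _ _ => rfl

/-- The space of `K`-finite vectors of a twist. -/
def kVecTwist (χ : G n F →ₜ* ℂˣ) (π : Representation ℂ (G n F) V) :
    kVec π ≃ₗ[ℂ] kVec (twist (χ : G n F →* ℂˣ) π) :=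
  LinearEquiv.ofEq _ _ ((isTwist_resLevi 0 χ π).kFin_eq _)

theorem IsQuotientMap.twist {b : Fin n → Fin n} (hb : Monotone b) {α : Fin n → ℝ}
    {τ : Representation ℂ (levi F b) W} {π : Representation ℂ (G n F) V}
    {p : ind 0 b α τ →ₗ[ℂ] kVec π} (h : IsQuotientMap b α τ π p) (hχ : IsUnitaryPart s χ χ₀) :
    IsQuotientMap (F := F) b (fun k => α k + s) (twist (resChar b χ₀) τ) (twist (χ : G n F →* ℂˣ) π)
      ((kVecTwist χ π).toLinearMap ∘ₗ p ∘ₗ (indTwist hb α τ hχ).symm.toLinearMap) := by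
  refine ⟨(kVecTwist χ π).surjective.comp (h.1.comp (indTwist hb α τ hχ).symm.surjective),
    fun k hk f f' hf => ?_, fun γ f f' hf => ?_⟩
  · have h1 := h.2.1 k hk ((indTwist hb α τ hχ).symm f)
      (((χ k)⁻¹ : ℂˣ) • (indTwist hb α τ hχ).symm f') fun x => by
        change ((χ k)⁻¹ : ℂˣ) • ((indTwist hb α τ hχ).symm f').1 x = _
        rw [indTwist_symm_apply, indTwist_symm_apply, hf, smul_smul, ← mul_inv_rev]
        congr 2
        exact (map_mul χ (x : G n F) (k : G n F)).symm
    rw [Units.smul_def, map_smul] at h1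
    change ((p ((indTwist hb α τ hχ).symm f') : kVec π) : V) =
      (χ k : ℂ) • π k (p ((indTwist hb α τ hχ).symm f) : V)
    rw [← h1]
    change _ = (χ k : ℂ) • (((χ k)⁻¹ : ℂˣ) : ℂ) • (p ((indTwist hb α τ hχ).symm f') : V)
    rw [smul_smul, Units.mul_inv, one_smul]
  · have hcont := continuous_inv_char (continuous_resChar (0 : Fin n → Fin n) χ)
    obtain ⟨a, ha⟩ := exists_hasDerivAt_char hcont γ
    have h1 := h.2.2 γ ((indTwist hb α τ hχ).symm f)
      ((indTwist hb α τ hχ).symm f' + a • (indTwist hb α τ hχ).symm f) (by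
        have h2 := isFunDeriv_mulChar ha hf
        rw [map_add, map_smul] at h2
        exact h2)
    -- The derivative `a` of `χ⁻¹` enters once through the functions and once, with the opposite
    -- sign, through the representation, and the two terms cancel.
    have h2 := (isTwist_resLevi 0 χ π).symm.isDeriv_sub ha h1
    rw [map_add, map_smul] at h2
    change IsDeriv _ γ _ ((p _ : V) + a • (p _ : V) - a • (p _ : V)) at h2
    rw [add_sub_cancel_right] at h2
    exact h2

end TwistField

/-! ### Twisting operators and Shintani lifts -/

section TwistExt

variable {n : ℕ} [NeZero n] {F : Type*} [RCLike F] {E : Type*} [RCLike E] [NormedAlgebra F E]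
  [FiniteDimensional F E] [IsGalois F E] {σ : E ≃ₐ[F] E} {ψ : AddChar F Circle}
  {V : Type*} [NormedAddCommGroup V] [InnerProductSpace ℂ V]
  {W : Type*} [NormedAddCommGroup W] [InnerProductSpace ℂ W]
  {χ : G n F →ₜ* ℂˣ} {χE : G n E →ₜ* ℂˣ}

theorem IsWhittaker.dual {b : Fin n → Fin n} {ψ : AddChar E Circle} {χ : G n E →* ℂˣ}
    {τ τ' : Representation ℂ (levi E b) W}
    (h : IsTwist (χ.comp (levi E b).subtype) τ τ')
    (hχ : Continuous fun g => (χ.comp (levi E b).subtype g : ℂ))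
    {ℓ : Module.Dual ℂ (smoothVec τ)} (hℓ : IsWhittaker b ψ τ ℓ) :
    IsWhittaker b ψ τ' (h.dual hχ ℓ) := by
  refine ⟨h.isContFunctional hχ hℓ.1, fun u hu w w' hw => ?_⟩
  refine hℓ.2 u hu _ _ (hw.trans ?_)
  have : χ.comp (levi E b).subtype u = 1 := map_eq_one_of_isUnip χ monotone_id hu
  rw [h, this, Units.val_one, one_smul]
  rfl

theorem IsGenericOp.twist {b : Fin n → Fin n} {τ : Representation ℂ (levi E b) W}
    {I : W →L[ℂ] W} (h : IsGenericOp σ ψ b τ I)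
    (hχ : ∀ g, χE (galGL σ g) = χE g) :
    IsGenericOp (F := F) (E := E) σ ψ b (twist (resChar b χE) τ) I := by
  have ht := isTwist_twist (resChar b χE) τ
  have hcont := continuous_resChar b χE
  have hcont' := continuous_inv_char hcont
  have hsymm : ∀ {ℓ : Module.Dual ℂ (smoothVec (Shintani.twist (resChar b χE) τ))},
      IsWhittaker b (psiE E ψ) (Shintani.twist (resChar b χE) τ) ℓ →
      IsWhittaker b (psiE E ψ) τ (ht.symm.dual hcont' ℓ) := fun hℓ =>
    IsWhittaker.dual (χ := (χE : G n E →* ℂˣ)⁻¹) ht.symm hcont' hℓ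
  obtain ⟨⟨ℓ, hℓ, hℓW, hℓu⟩, h1, h2, h3⟩ := h
  refine ⟨⟨ht.dual hcont ℓ, fun h0 => hℓ ?_,
    IsWhittaker.dual (χ := (χE : G n E →* ℂˣ)) ht hcont hℓW, fun ℓ' hℓ' => ?_⟩, h1,
    fun g w => ?_, fun ℓ' hℓ' w w' hw => ?_⟩
  · exact LinearMap.ext fun w => LinearMap.congr_fun h0 (LinearEquiv.ofEq _ _
      (ht.smoothVec_eq hcont) w)
  · obtain ⟨a, ha⟩ := hℓu _ (hsymm hℓ')
    exact ⟨a, LinearMap.ext fun w => LinearMap.congr_fun ha (LinearEquiv.ofEq _ _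
      (ht.smoothVec_eq hcont).symm w)⟩
  · rw [twist_apply, twist_apply, map_smul, h2]
    have : resChar b χE (galLevi σ b g) = resChar b χE g := hχ g
    rw [this]
  · exact h3 _ (hsymm hℓ') (LinearEquiv.ofEq _ _ (ht.smoothVec_eq hcont).symm w)
      (LinearEquiv.ofEq _ _ (ht.smoothVec_eq hcont).symm w') hw

theorem CharIdentity.twist {b : Fin n → Fin n} {π π' : Representation ℂ (levi F b) V}
    {P P' : Representation ℂ (levi E b) W}
    {J : kFin (maxCompact E b) P →ₗ[ℂ] kFin (maxCompact E b) P} (h : CharIdentity σ b π P J)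
    (hχ : IsNormComp σ χ χE) (hπ : IsTwist (resChar b χ) π π') (hP : IsTwist (resChar b χE) P P') :
    CharIdentity σ b π' P' ((LinearEquiv.ofEq _ _ (hP.kFin_eq _)).conj J) := by
  obtain ⟨Θ, Θ', h1, h2, h3⟩ := h
  have h4 := hπ.isCharFn (continuous_resChar b χ) h1
  rw [LinearEquiv.conj_id] at h4
  refine ⟨_, _, h4, hP.isCharFn (continuous_resChar b χE) h2, fun g y hgy hy => ?_⟩
  rw [h3 g y hgy hy]
  have : resChar b χE g = resChar b χ y := (hχ g).2 y hgy.zero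
  rw [this]

theorem IsNormalizedOp.twist (hσ : ∀ s : E ≃ₐ[F] E, s ∈ Subgroup.zpowers σ)
    (hF : ∀ ω : Fˣ →* ℝ, Continuous ω → (∀ x, 0 < ω x) →
      ∃ s : ℝ, ∀ x : Fˣ, ω x = normAbs (x : F) ^ s)
    {P : Representation ℂ (G n E) V} {J : kVec P →ₗ[ℂ] kVec P} (h : IsNormalizedOp σ ψ P J)
    (hχ : IsNormComp σ χ χE) :
    IsNormalizedOp σ ψ (twist (χE : G n E →* ℂˣ) P) ((kVecTwist χE P).conj J) := by
  obtain ⟨s, hs⟩ := exists_norm_eq_normAbs_rpow (χ := χ) hF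
  obtain ⟨χ₀, χE₀, h0, hE0, hχ₀⟩ := hχ.exists_isUnitaryPart hσ hs
  obtain ⟨h1, b, α, hb, hα, W, _, _, _, τ, I, hτ, hI, p, hp, hpI⟩ := h
  refine ⟨(isTwist_resLevi 0 χE P).isIrredAdm (continuous_resChar 0 χE) h1, b,
    fun k => α k + s, hb, fun i j hij => by linarith [hα i j hij], W, inferInstance,
    inferInstance, inferInstance, Shintani.twist (resChar b χE₀) τ, I, hτ.twist hE0.norm_eq,
    hI.twist (hχ₀.map_galGL hσ), _, hp.twist hb hE0, fun f => ?_⟩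
  obtain ⟨f', hf', hpf⟩ := hpI ((indTwist hb α τ hE0).symm f)
  refine ⟨indTwist hb α τ hE0 f', fun x => ?_, ?_⟩
  · rw [indTwist_apply, hf', indTwist_symm_apply, Units.smul_def, map_smul, smul_smul]
    have : χE ((galLevi σ 0 x : levi E (0 : Fin n → Fin n)) : G n E) = χE x := hχ.map_galGL hσ x
    rw [this, Units.mul_inv, one_smul]
  · rw [LinearMap.comp_apply, LinearMap.comp_apply, LinearMap.comp_apply, LinearMap.comp_apply,
      LinearEquiv.conj_apply_apply]
    refine congrArg (kVecTwist χE P) ?_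
    refine Eq.trans (congrArg p ?_) (hpf.trans (congrArg J ?_))
    · exact (indTwist hb α τ hE0).symm_apply_apply f'
    · exact ((kVecTwist χE P).symm_apply_apply _).symm

theorem IsShintaniLift.twist (hσ : ∀ s : E ≃ₐ[F] E, s ∈ Subgroup.zpowers σ)
    (hF : ∀ ω : Fˣ →* ℝ, Continuous ω → (∀ x, 0 < ω x) →
      ∃ s : ℝ, ∀ x : Fˣ, ω x = normAbs (x : F) ^ s)
    {π : Representation ℂ (G n F) V} {P : Representation ℂ (G n E) W}
    (h : IsShintaniLift σ ψ π P) (hχ : IsNormComp σ χ χE) :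
    IsShintaniLift σ ψ (twist (χ : G n F →* ℂˣ) π) (twist (χE : G n E →* ℂˣ) P) := by
  obtain ⟨⟨h1, h2, b, α, hb, hα, U, _, _, _, τ, U', _, _, _, τ', hτ, hτ',
    ⟨I, J₀, hI, hIJ, hId⟩, ⟨p, hp⟩, p', hp'⟩, J, hJ, hJd⟩ := h
  obtain ⟨s, hs⟩ := exists_norm_eq_normAbs_rpow (χ := χ) hF
  obtain ⟨χ₀, χE₀, h0, hE0, hχ₀⟩ := hχ.exists_isUnitaryPart hσ hs
  exact ⟨⟨(isTwist_resLevi 0 χ π).isIrredAdm (continuous_resChar 0 χ) h1,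
    (isTwist_resLevi 0 χE P).isIrredAdm (continuous_resChar 0 χE) h2, b, fun k => α k + s, hb,
    fun i j hij => by linarith [hα i j hij], U, inferInstance, inferInstance, inferInstance,
    Shintani.twist (resChar b χ₀) τ, U', inferInstance, inferInstance, inferInstance,
    Shintani.twist (resChar b χE₀) τ', hτ.twist h0.norm_eq, hτ'.twist hE0.norm_eq,
    ⟨I, _, hI.twist (hχ₀.map_galGL hσ), fun v => (coe_conj_ofEq _ J₀
      (LinearEquiv.ofEq _ _ ((isTwist_twist _ τ').kFin_eq _).symm v) v rfl).trans (hIJ _),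
      hId.twist hχ₀ (isTwist_twist _ _) (isTwist_twist _ _)⟩, ⟨_, hp.twist hb h0⟩, _,
      hp'.twist hb hE0⟩,
    _, hJ.twist hσ hF hχ, hJd.twist hχ (isTwist_resLevi 0 χ π) (isTwist_resLevi 0 χE P)⟩

end TwistExt

/-! ### Positive characters of the multiplicative group of `ℝ` -/

section Real

theorem normAbs_real (x : ℝ) : normAbs x = |x| := by
  by_cases hx : x = 0
  · rw [hx, normAbs, dif_pos rfl, abs_zero]
  have h1 := normAbs_mul_measure (volume : Measure ℝ) hx (Metric.closedBall 0 1)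
  rw [Measure.addHaar_smul, Module.finrank_self, pow_one] at h1
  have h2 : volume (Metric.closedBall (0 : ℝ) 1) ≠ 0 := by simp
  have h3 : volume (Metric.closedBall (0 : ℝ) 1) ≠ ⊤ := by simp
  exact (ENNReal.ofReal_eq_ofReal_iff (normAbs_nonneg x) (abs_nonneg x)).1
    ((ENNReal.mul_left_inj h2 h3).1 h1)

/-- On positive reals `log ∘ ω ∘ exp` is continuous and additive, hence linear. Signs play no role,
as `x² = |x|²` and `ω` is positive. -/
theorem exists_eq_normAbs_rpow (ω : ℝˣ →* ℝ) (hω : Continuous ω) (hpos : ∀ x, 0 < ω x) :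
    ∃ s : ℝ, ∀ x : ℝˣ, ω x = normAbs (x : ℝ) ^ s := by
  let e : ℝ → ℝˣ := fun t => Units.mk0 (Real.exp t) (Real.exp_pos t).ne'
  have he : Continuous e := by
    rw [Units.continuous_iff]
    exact ⟨Real.continuous_exp, Real.continuous_exp.inv₀ fun t => (Real.exp_pos t).ne'⟩
  let L : ℝ →+ ℝ :=
    { toFun := fun t => Real.log (ω (e t))
      map_zero' := by
        have : e 0 = 1 := Units.ext Real.exp_zero
        rw [this, map_one, Real.log_one]
      map_add' := fun s t => by
        have : e (s + t) = e s * e t := Units.ext (Real.exp_add s t)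
        rw [this, map_mul, Real.log_mul (hpos _).ne' (hpos _).ne'] }
  have hL : Continuous L := (hω.comp he).log fun t => (hpos _).ne'
  have h1 : ∀ t, L t = t * L 1 := fun t => by
    have := (L.toRealLinearMap hL).map_smul t 1
    rwa [smul_eq_mul, mul_one] at this
  have h2 : ∀ t, ω (e t) = Real.exp t ^ L 1 := fun t => by
    rw [← Real.exp_mul, ← h1, AddMonoidHom.coe_mk, ZeroHom.coe_mk, Real.exp_log (hpos _)]
  refine ⟨L 1, fun x => ?_⟩
  have hx : 0 < |(x : ℝ)| := abs_pos.2 x.ne_zero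
  have h3 : x * x = e (Real.log |(x : ℝ)|) * e (Real.log |(x : ℝ)|) := by
    refine Units.ext ?_
    change (x : ℝ) * x = Real.exp _ * Real.exp _
    rw [Real.exp_log hx, abs_mul_abs_self]
  have h4 := congrArg ω h3
  rw [map_mul, map_mul, mul_self_inj (hpos _).le (hpos _).le, h2, Real.exp_log hx] at h4
  rw [h4, normAbs_real]

end Real

end Arch

end Shintani

namespace Shintani

set_option linter.unusedSectionVars false

namespace Arch

/-! ### The trivial representation in the Archimedean case -/

section Trivial

variable {H : Type*} [Group H] [TopologicalSpace H]

theorem mem_kFin_of_mul_right {W : Type*} [AddCommGroup W] [Module ℂ W] {K : Subgroup H}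
    {f : H → W} (hf : ∀ k ∈ K, ∀ x, f (x * k) = f x) : f ∈ kFin K (rightReg H W) := by
  refine mem_kFin_iff.2 ⟨Submodule.span ℂ {f}, inferInstance, fun k hk v hv => ?_,
    Submodule.mem_span_singleton_self f⟩
  obtain ⟨a, rfl⟩ := Submodule.mem_span_singleton.1 hv
  rw [map_smul]
  exact Submodule.smul_mem _ a (Submodule.mem_span_singleton.2
    ⟨1, (one_smul ℂ f).trans (funext fun x => (hf k hk x).symm)⟩)

theorem mem_kFin_trivial (K : Subgroup H) (v : ℂ) :
    v ∈ kFin K (Representation.trivial ℂ H ℂ) :=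
  mem_kFin_iff.2 ⟨⊤, inferInstance, fun _ _ _ _ => trivial, trivial⟩

theorem kFin_trivial (K : Subgroup H) : kFin K (Representation.trivial ℂ H ℂ) = ⊤ :=
  top_unique fun v _ => mem_kFin_trivial K v

theorem isIrredAdm_trivial (K : Subgroup H) : IsIrredAdm K (Representation.trivial ℂ H ℂ) := by
  have h : IsSimpleOrder (Submodule ℂ ℂ) := (inferInstance : IsSimpleModule ℂ ℂ).toIsSimpleOrder
  exact ⟨continuous_snd, inferInstance, fun S _ _ => eq_bot_or_eq_top S, fun _ _ => inferInstance⟩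

theorem isUnitary_trivial : IsUnitary (Representation.trivial ℂ H ℂ) := fun _ _ _ => rfl

theorem isDeriv_trivial_iff {γ : OnePar H} {v w : ℂ} :
    IsDeriv (Representation.trivial ℂ H ℂ) γ v w ↔ w = 0 := by
  have h : IsDeriv (Representation.trivial ℂ H ℂ) γ v 0 := hasDerivAt_const _ _
  exact ⟨fun h' => HasDerivAt.unique h' h, fun h' => h' ▸ h⟩

theorem mem_smoothVec_trivial (v : ℂ) : v ∈ smoothVec (Representation.trivial ℂ H ℂ) := by
  intro L
  induction L with
  | nil => exact ⟨v, rfl⟩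
  | cons γ L ih =>
    obtain ⟨u, hu⟩ := ih
    exact ⟨0, u, hu, isDeriv_trivial_iff.2 rfl⟩

theorem isCharFn_trivial [IsTopologicalGroup H] [LocallyCompactSpace H] (K : Subgroup H)
    (reg : Set H) :
    IsCharFn K (Representation.trivial ℂ H ℂ) LinearMap.id reg fun _ => 1 := by
  borelize H
  have hK : Module.finrank ℂ (kFin K (Representation.trivial ℂ H ℂ)) = 1 := by
    rw [kFin_trivial, finrank_top, Module.finrank_self]
  have := FiniteDimensional.of_finrank_pos (hK ▸ one_pos)
  refine ⟨_, ‹_›, Measure.haar, inferInstance, locallyIntegrable_const _, continuousOn_const,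
    fun f hf => ⟨(∫ g, f g ∂Measure.haar) • LinearMap.id, fun v w => ?_, inferInstance, ?_⟩⟩
  · simp only [Representation.trivial_apply]
    rw [integral_mul_const, LinearMap.smul_apply, Submodule.coe_smul, inner_smul_right,
      LinearMap.id_apply]
  · rw [LinearMap.comp_id, finTrace_smul_id hK]
    simp

end Trivial

/-! ### The trivial representation as a quotient of an induced `(𝔤, K)`-module -/

section TrivialField

variable {n : ℕ} [NeZero n] {F : Type*} [RCLike F]

theorem isSquareIntegrable_trivial_torus (K : Subgroup (levi F (id : Fin n → Fin n))) :
    IsSquareIntegrable K (Representation.trivial ℂ (levi F (id : Fin n → Fin n)) ℂ) :=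
  ⟨isIrredAdm_trivial K, isUnitary_trivial, 1, 1, ⟨1, by simp⟩, by
    simpa using sqIntModCenter_const_torus 1⟩

theorem isTempered_trivial_torus :
    IsTempered id (Representation.trivial ℂ (levi F (id : Fin n → Fin n)) ℂ) := by
  refine ⟨isIrredAdm_trivial _, isUnitary_trivial, id, ⟨monotone_id, monotone_id, fun _ _ h => h⟩,
    ℂ, inferInstance, inferInstance, inferInstance, Representation.trivial ℂ _ ℂ,
    isSquareIntegrable_trivial_torus _, ?_⟩
  let e : kFin (maxCompact F id) (Representation.trivial ℂ (levi F (id : Fin n → Fin n)) ℂ) →ₗ[ℂ]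
      ind (F := F) id id 0 (Representation.trivial ℂ (levi F (id : Fin n → Fin n)) ℂ) :=
    { toFun := fun v => ⟨fun _ => v, ⟨⟨fun m g hm => by simp [indWeight_id_id],
        fun _ _ _ => rfl⟩, continuous_const⟩, mem_kFin_of_mul_right fun _ _ _ => rfl⟩
      map_add' := fun _ _ => rfl
      map_smul' := fun _ _ => rfl }
  refine ⟨LinearEquiv.ofBijective e ⟨fun v w h => ?_, fun f =>
    ⟨⟨f.1 1, mem_kFin_trivial _ _⟩, ?_⟩⟩, fun k _ v v' h x => h, fun γ v v' h x => ?_⟩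
  · exact Subtype.ext (congrFun (congrArg Subtype.val h) 1)
  · apply Subtype.ext
    funext x
    have := f.2.1.1.1 x 1 x.2
    rw [mul_one, indWeight_id_id] at this
    rw [this]
    change f.1 1 = _
    simp
  · rw [isDeriv_trivial_iff] at h
    change HasDerivAt (fun _ => (v : ℂ)) (v' : ℂ) 0
    rw [h]
    exact hasDerivAt_const _ _

/-- The `(𝔤, K)`-module whose Langlands quotient is the trivial representation. -/
abbrev indTrivial (n : ℕ) [NeZero n] (F : Type*) [RCLike F] :
    Submodule ℂ (levi F (0 : Fin n → Fin n) → ℂ) :=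
  ind (F := F) 0 id (halfSum n) (Representation.trivial ℂ (levi F (id : Fin n → Fin n)) ℂ)

theorem indTrivial_covariant (f : indTrivial n F) : IsBorelCovariant (onGL f.1) :=
  mem_covFns_halfSum_iff.1 f.2.1.1

theorem indTrivial_continuous (f : indTrivial n F) : Continuous (onGL f.1) :=
  Padic.continuous_onGL f.2.1.2

variable [MeasurableSpace (G n F)] [BorelSpace (G n F)]

/-- The integral of `η(g) f(g γ(t))` does not depend on `t`, by right invariance, and is
differentiated under the integral sign at `t = 0`; the dominating function comes from a bound on the
compact product of the support of `η` with `[-1, 1]`. It shows that the quotient map is compatible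
with the zero action of the Lie algebra. -/
theorem borelIntegral_isFunDeriv {η : G n F → ℝ} (hη : IsBorelUnit η) {f f' : G n F → ℂ}
    (hf : Continuous f) (hfδ : IsBorelCovariant f) (hf' : Continuous f') {γ : OnePar (G n F)}
    (h : IsFunDeriv γ f f') : borelIntegral η f' = 0 := by
  let c : ℝ → G n F := fun t => γ (Multiplicative.ofAdd t)
  have hc : Continuous c := γ.continuous_toFun.comp continuous_ofAdd
  have h0 : c 0 = 1 := by simp [c]
  have hderiv : ∀ g t, HasDerivAt (fun t => f (g * c t)) (f' (g * c t)) t := by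
    intro g t
    have h1 := h (g * c t)
    rw [← sub_self t] at h1
    refine (h1.comp_sub_const t t).congr_of_eventuallyEq (Eventually.of_forall fun s => ?_)
    change f (g * c s) = f (g * c t * c (s - t))
    have : c s = c t * c (s - t) := by
      simp only [c]
      rw [← map_mul, ← ofAdd_add, add_sub_cancel]
    rw [this, mul_assoc]
  obtain ⟨_, _, hη'⟩ := id hη
  have hint : ∀ f : G n F → ℂ, Continuous f →
      Integrable (fun g => (η g : ℂ) * f g) (Measure.haar : Measure (G n F)) := fun f hf => by
    refine Continuous.integrable_of_hasCompactSupport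
      ((Complex.continuous_ofReal.comp hη'.continuous).mul hf) ?_
    exact (hη'.hasCompactSupport.comp_left (g := Complex.ofReal) rfl).mul_right
  obtain ⟨M, hM⟩ := (hη'.hasCompactSupport.isCompact.prod (isCompact_Icc (a := (-1 : ℝ))
    (b := 1))).exists_bound_of_continuousOn (f := fun x : G n F × ℝ => f' (x.1 * c x.2))
    (hf'.comp (continuous_fst.mul (hc.comp continuous_snd))).continuousOn
  have hbound : Integrable (fun g => η g * M) (Measure.haar : Measure (G n F)) :=
    (hη'.continuous.integrable_of_hasCompactSupport hη'.hasCompactSupport).mul_const M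
  have key := hasDerivAt_integral_of_dominated_loc_of_deriv_le
    (μ := (Measure.haar : Measure (G n F))) (F := fun t g => (η g : ℂ) * f (g * c t))
    (F' := fun t g => (η g : ℂ) * f' (g * c t)) (x₀ := (0 : ℝ)) (s := Metric.ball 0 1)
    (bound := fun g => η g * M) (Metric.ball_mem_nhds 0 one_pos)
    (Eventually.of_forall fun t =>
      (hint (fun g => f (g * c t)) (hf.comp (continuous_mul_const _))).aestronglyMeasurable)
    (hint (fun g => f (g * c 0)) (hf.comp (continuous_mul_const _)))
    (hint (fun g => f' (g * c 0)) (hf'.comp (continuous_mul_const _))).aestronglyMeasurable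
    (Eventually.of_forall fun g t ht => by
      rw [norm_mul, Complex.norm_real, Real.norm_of_nonneg (hη'.nonneg g)]
      by_cases hg : η g = 0
      · rw [hg, zero_mul, zero_mul]
      · refine mul_le_mul_of_nonneg_left (hM (g, t) ⟨subset_tsupport η hg, ?_⟩) (hη'.nonneg g)
        rw [Real.ball_eq_Ioo, zero_sub, zero_add] at ht
        exact ⟨ht.1.le, ht.2.le⟩) hbound
    (Eventually.of_forall fun g t _ => (hderiv g t).const_mul _)
  have h2 : (fun t => ∫ g, (η g : ℂ) * f (g * c t) ∂(Measure.haar : Measure (G n F))) =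
      fun _ => borelIntegral η f := funext fun t => borelIntegral_mul_right hη hf hfδ (c t)
  have h3 := key.2
  rw [h2] at h3
  have h4 := h3.unique (hasDerivAt_const _ _)
  simp only [h0, mul_one] at h4
  exact h4

/-- The invariant functional on the induced `(𝔤, K)`-module. -/
def trivialQuotient {η : G n F → ℝ} (hη : IsBorelUnit η) :
    indTrivial n F →ₗ[ℂ] kVec (Representation.trivial ℂ (G n F) ℂ) where
  toFun f := ⟨borelIntegral η (onGL f.1), mem_kFin_trivial _ _⟩
  map_add' f f' := Subtype.ext
    (borelIntegral_add hη (indTrivial_continuous f) (indTrivial_continuous f'))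
  map_smul' a _ := Subtype.ext (borelIntegral_smul η a _)

theorem isQuotientMap_trivialQuotient {η : G n F → ℝ} (hη : IsBorelUnit η) {f₀ : G n F → ℝ}
    (hf₀ : Continuous f₀) (hf₀δ : IsBorelCovariant (fun g => (f₀ g : ℂ))) (hf₀pos : ∀ g, 0 < f₀ g)
    (hf₀K : ∀ k ∈ maxCompact F (0 : Fin n → Fin n), ∀ g, f₀ (g * k) = f₀ g) :
    IsQuotientMap id (halfSum n) (Representation.trivial ℂ (levi F (id : Fin n → Fin n)) ℂ)
      (Representation.trivial ℂ (G n F) ℂ) (trivialQuotient hη) := by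
  refine ⟨fun z => ?_, fun k _ f f' h => ?_, fun γ f f' h => ?_⟩
  · obtain ⟨a, ha, ha'⟩ := borelIntegral_pos hη hf₀ hf₀pos
    let f : indTrivial n F := ⟨fun x => f₀ x, ⟨mem_covFns_halfSum_iff.2 hf₀δ,
      Complex.continuous_ofReal.comp (hf₀.comp continuous_subtype_val)⟩,
      mem_kFin_of_mul_right fun k hk x => by
        change (f₀ ((x * k : levi F (0 : Fin n → Fin n)) : G n F) : ℂ) = f₀ x
        exact congrArg _ (hf₀K k hk x)⟩
    refine ⟨((z : ℂ) / a) • f, ?_⟩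
    rw [map_smul]
    refine Subtype.ext ?_
    change ((z : ℂ) / a) * borelIntegral η (fun g => (f₀ g : ℂ)) = z
    rw [ha', div_mul_cancel₀ _ (by exact_mod_cast ha.ne')]
  · have h1 := borelIntegral_mul_right hη (indTrivial_continuous f) (indTrivial_covariant f) k
    refine Eq.trans ?_ h1
    change borelIntegral η _ = _
    congr 1
    funext x
    exact h ⟨x, mem_levi_zero x⟩
  · refine isDeriv_trivial_iff.2 ?_
    let γ' : OnePar (G n F) := ⟨(levi F 0).subtype.comp γ.toMonoidHom,
      continuous_subtype_val.comp γ.continuous_toFun⟩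
    exact borelIntegral_isFunDeriv hη (indTrivial_continuous f) (indTrivial_covariant f)
      (indTrivial_continuous f') (γ := γ') fun x => h ⟨x, mem_levi_zero x⟩

end TrivialField

end Arch

end Shintani

namespace Shintani

set_option linter.unusedSectionVars false

namespace Arch

/-! ### Unitarily invariant weights -/

section Frobenius

variable {n : ℕ} {F : Type*} [RCLike F]

/-- The square of the Frobenius norm. -/
def frobSq (M : Matrix (Fin n) (Fin n) F) : ℝ := ∑ i, ∑ j, ‖M i j‖ ^ 2

theorem coe_frobSq (M : Matrix (Fin n) (Fin n) F) : (frobSq M : F) = (M * star M).trace := by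
  simp only [frobSq, Matrix.trace, Matrix.diag_apply, Matrix.mul_apply, Matrix.star_apply]
  push_cast
  simp only [← RCLike.mul_conj]
  rfl

theorem frobSq_mul_unitary (M : Matrix (Fin n) (Fin n) F) {u : Matrix (Fin n) (Fin n) F}
    (hu : u ∈ Matrix.unitaryGroup (Fin n) F) : frobSq (M * u) = frobSq M := by
  refine RCLike.ofReal_injective (K := F) ?_
  rw [coe_frobSq, coe_frobSq, star_mul, mul_assoc, ← mul_assoc u, Unitary.mul_star_self_of_mem hu,
    one_mul]

theorem frobSq_unitary_mul (M : Matrix (Fin n) (Fin n) F) {u : Matrix (Fin n) (Fin n) F}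
    (hu : u ∈ Matrix.unitaryGroup (Fin n) F) : frobSq (u * M) = frobSq M := by
  refine RCLike.ofReal_injective (K := F) ?_
  rw [coe_frobSq, coe_frobSq, star_mul, mul_assoc, Matrix.trace_mul_comm, mul_assoc, mul_assoc,
    Unitary.star_mul_self_of_mem hu, mul_one]

theorem norm_sq_le_frobSq (M : Matrix (Fin n) (Fin n) F) (i j : Fin n) : ‖M i j‖ ^ 2 ≤ frobSq M :=
  (Finset.single_le_sum (f := fun j => ‖M i j‖ ^ 2) (fun _ _ => sq_nonneg _)
    (Finset.mem_univ j)).trans (Finset.single_le_sum (f := fun i => ∑ j, ‖M i j‖ ^ 2)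
      (fun _ _ => Finset.sum_nonneg fun _ _ => sq_nonneg _) (Finset.mem_univ i))

theorem frobSq_le {M : Matrix (Fin n) (Fin n) F} {C : ℝ} (h : ∀ i j, ‖M i j‖ ≤ C) :
    frobSq M ≤ n * (n * C ^ 2) := by
  have h1 : ∀ i j, ‖M i j‖ ^ 2 ≤ C ^ 2 := fun i j => pow_le_pow_left₀ (norm_nonneg _) (h i j) 2
  refine (Finset.sum_le_sum fun i _ => Finset.sum_le_sum fun j _ => h1 i j).trans (le_of_eq ?_)
  simp

/-- A continuous bump function. -/
def unitaryWeight (R : ℝ) (g : G n F) : ℝ :=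
  max 0 (R - frobSq (g : Matrix (Fin n) (Fin n) F)) *
    max 0 (R - frobSq ((g⁻¹ : G n F) : Matrix (Fin n) (Fin n) F))

/-- The Frobenius norms of `g` and of `g⁻¹` are invariant under unitary matrices, so a cutoff
depending only on them is invariant under the maximal compact subgroup. -/
theorem exists_unitary_weight (n : ℕ) [NeZero n] (F : Type*) [RCLike F] : ∃ φ : G n F → ℝ, Continuous φ ∧
    HasCompactSupport φ ∧ (∀ g, 0 ≤ φ g) ∧ (∀ g, ∃ b : borelSubgroup n F, 0 < φ (b * g)) ∧
    ∀ k ∈ maxCompact F (0 : Fin n → Fin n), ∀ g, φ (g * k) = φ g := by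
  obtain ⟨C, hC, hadj⟩ := exists_norm_adjugate_le n F
  -- A matrix with entries of norm at most `C` has squared Frobenius norm at most `n · n · C²`; the
  -- added `1` makes the weight strictly positive there.
  let R : ℝ := n * (n * C ^ 2) + 1
  have hR : 0 ≤ R := by positivity
  refine ⟨unitaryWeight R, ?_, ?_, fun g => mul_nonneg (le_max_left _ _) (le_max_left _ _),
    fun g => ?_, fun k hk g => ?_⟩
  · have h1 : Continuous fun g : G n F => frobSq (g : Matrix (Fin n) (Fin n) F) :=
      continuous_finsetSum _ fun i _ => continuous_finsetSum _ fun j _ =>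
        (continuous_entry i j).norm.pow 2
    have h2 : Continuous fun g : G n F => frobSq ((g⁻¹ : G n F) : Matrix (Fin n) (Fin n) F) :=
      continuous_finsetSum _ fun i _ => continuous_finsetSum _ fun j _ =>
        (continuous_entry_inv i j).norm.pow 2
    exact (continuous_const.max (continuous_const.sub h1)).mul
      (continuous_const.max (continuous_const.sub h2))
  · have h1 : ∀ M : Matrix (Fin n) (Fin n) F, max 0 (R - frobSq M) ≠ 0 →
        ∀ i j, ‖M i j‖ ≤ R + 1 := fun M hM i j => by
      have h2 : frobSq M < R := by
        by_contra! h
        exact hM (max_eq_left (by linarith))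
      have h3 := norm_sq_le_frobSq M i j
      nlinarith [norm_nonneg (M i j)]
    refine HasCompactSupport.intro (isCompact_bounded (R + 1)) fun g hg => ?_
    by_contra h
    obtain ⟨h2, h3⟩ := mul_ne_zero_iff.1 h
    exact hg ⟨h1 _ h2, h1 _ h3⟩
  · obtain ⟨b, hb, hdet⟩ := exists_borel_mul_bounded g
    obtain ⟨h1, h2⟩ := mem_boundedSet_of_det hC hadj hb hdet
    have h3 := frobSq_le h1
    have h4 := frobSq_le h2
    exact ⟨b, mul_pos (lt_max_of_lt_right (by linarith)) (lt_max_of_lt_right (by linarith))⟩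
  · have hk' : (((k : G n F)⁻¹ : G n F) : Matrix (Fin n) (Fin n) F) ∈
        Matrix.unitaryGroup (Fin n) F := inv_mem hk
    rw [unitaryWeight, unitaryWeight, mul_inv_rev, Units.val_mul, Units.val_mul,
      frobSq_mul_unitary _ hk, frobSq_unitary_mul _ hk']

theorem exists_trivialQuotient (n : ℕ) [NeZero n] (F : Type*) [RCLike F]
    [MeasurableSpace (G n F)] [BorelSpace (G n F)] :
    ∃ (η : G n F → ℝ) (hη : IsBorelUnit η) (f₀ : G n F → ℝ), Continuous f₀ ∧
      IsBorelCovariant (fun g => (f₀ g : ℂ)) ∧ (∀ g, 0 < f₀ g) ∧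
      IsQuotientMap id (halfSum n) (Representation.trivial ℂ (levi F (id : Fin n → Fin n)) ℂ)
        (Representation.trivial ℂ (G n F) ℂ) (trivialQuotient hη) := by
  obtain ⟨φ, h1, h2, h3, h4, h5⟩ := exists_unitary_weight n F
  obtain ⟨η, hη, -⟩ := exists_isBorelUnit h1 h2 h3 h4
  obtain ⟨f₀, k1, k2, k3, k4⟩ := exists_isBorelCovariant h1 h2 h3 h4
  exact ⟨η, hη, f₀, k1, k2, k3, isQuotientMap_trivialQuotient hη k1 k2 k3
    fun k hk => k4 k (h5 k hk)⟩

end Frobenius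

/-! ### The trivial representation is a Shintani lift -/

section TrivialExt

variable {n : ℕ} [NeZero n] {F : Type*} [RCLike F] {E : Type*} [RCLike E] [NormedAlgebra F E]
  [FiniteDimensional F E] [IsGalois F E] {σ : E ≃ₐ[F] E} {ψ : AddChar F Circle}

theorem isGenericOp_trivial_torus : IsGenericOp (F := F) (E := E) σ ψ id
    (Representation.trivial ℂ (levi E (id : Fin n → Fin n)) ℂ) (ContinuousLinearMap.id ℂ ℂ) := by
  refine ⟨⟨(smoothVec _).subtype, fun h => ?_, ⟨⟨{[]}, 1, fun v w hw => ?_⟩, fun u _ w w' hw => ?_⟩,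
    fun ℓ _ => ⟨ℓ ⟨1, mem_smoothVec_trivial 1⟩, ?_⟩⟩,
    Function.bijective_id, fun _ _ => rfl, fun ℓ _ w w' hw => congrArg ℓ (Subtype.ext hw)⟩
  · exact one_ne_zero (LinearMap.congr_fun h ⟨1, mem_smoothVec_trivial 1⟩)
  · have : w [] = v := hw [] (Finset.mem_singleton_self _)
    rw [Finset.sum_singleton, one_mul, this]
    rfl
  · rw [thetaChar_torus, one_mul]
    exact hw
  · refine LinearMap.ext fun w => ?_
    have : w = (w : ℂ) • ⟨1, mem_smoothVec_trivial 1⟩ := Subtype.ext (mul_one (w : ℂ)).symm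
    conv_lhs => rw [this, map_smul]
    exact mul_comm _ _

theorem charIdentity_trivial (b : Fin n → Fin n) :
    CharIdentity (F := F) (E := E) σ b (Representation.trivial ℂ (levi F b) ℂ)
      (Representation.trivial ℂ (levi E b) ℂ) LinearMap.id :=
  ⟨_, _, isCharFn_trivial _ _, isCharFn_trivial _ _, fun _ _ _ _ => rfl⟩

/-- A field automorphism commuting with conjugation preserves the equation `k k* = 1`. Consequently
composition with `σ⁻¹` preserves `K`-finiteness. -/
theorem galLevi_mem_maxCompact (hstar : ∀ (s : E ≃ₐ[F] E) z, s (star z) = star (s z))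
    (s : E ≃ₐ[F] E) {b : Fin n → Fin n} {k : levi E b} (hk : k ∈ maxCompact E b) :
    galLevi s b k ∈ maxCompact E b := by
  have h1 : ((k : G n E) : Matrix (Fin n) (Fin n) E) * star ((k : G n E) : Matrix _ _ E) = 1 :=
    Unitary.mul_star_self_of_mem hk
  refine Matrix.mem_unitaryGroup_iff.2 ?_
  have h2 := congrArg (fun M : Matrix (Fin n) (Fin n) E => M.map s) h1
  ext i j
  have h3 := congrFun (congrFun h2 i) j
  simp only [Matrix.map_apply, Matrix.mul_apply, Matrix.star_apply, map_sum, map_mul, hstar] at h3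
  rw [Matrix.mul_apply]
  simp only [Matrix.star_apply]
  refine h3.trans ?_
  by_cases h : i = j
  · subst h; simp
  · simp [Matrix.one_apply_ne h]

theorem isNormalizedOp_trivial (hstar : ∀ (s : E ≃ₐ[F] E) z, s (star z) = star (s z)) :
    IsNormalizedOp σ ψ (Representation.trivial ℂ (G n E) ℂ) LinearMap.id := by
  borelize (G n E)
  obtain ⟨η, hη, f₀, h1, h2, h3, h4⟩ := exists_trivialQuotient n E
  refine ⟨isIrredAdm_trivial _, id, halfSum n, monotone_id, strictlyDecreasing_halfSum, ℂ,
    inferInstance, inferInstance, inferInstance, Representation.trivial ℂ _ ℂ,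
    ContinuousLinearMap.id ℂ ℂ, isTempered_trivial_torus, isGenericOp_trivial_torus,
    trivialQuotient hη, h4, fun f => ?_⟩
  have hcov := (indTrivial_covariant f).comp_galEquiv σ⁻¹
  obtain ⟨S, hS, hSK, hfS⟩ := mem_kFin_iff.1 f.2.2
  let θ := LinearMap.funLeft ℂ ℂ (galLevi σ⁻¹ (0 : Fin n → Fin n))
  let f' : indTrivial n E := ⟨fun x => onGL f.1 (galEquiv n σ⁻¹ x),
    ⟨mem_covFns_halfSum_iff.2 hcov, (indTrivial_continuous f).comp
      ((continuous_galGL σ⁻¹).comp continuous_subtype_val)⟩,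
    mem_kFin_iff.2 ⟨S.map θ, inferInstance, ?_, ⟨f.1, hfS, rfl⟩⟩⟩
  · refine ⟨f', fun x => ?_, Subtype.ext (borelIntegral_galEquiv hη σ⁻¹ h1 h2 h3
      (indTrivial_continuous f) (indTrivial_covariant f))⟩
    change f.1 _ = f.1 x
    refine congrArg f.1 (Subtype.ext ?_)
    exact (galEquiv n σ).symm_apply_apply x
  · rintro k hk _ ⟨h, hh, rfl⟩
    refine ⟨_, hSK _ (galLevi_mem_maxCompact hstar σ⁻¹ hk) h hh, funext fun x => ?_⟩
    change h _ = h _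
    rw [map_mul]

theorem isShintaniLift_trivial (hstar : ∀ (s : E ≃ₐ[F] E) z, s (star z) = star (s z)) :
    IsShintaniLift σ ψ (Representation.trivial ℂ (G n F) ℂ)
      (Representation.trivial ℂ (G n E) ℂ) := by
  borelize (G n E)
  borelize (G n F)
  obtain ⟨η, hη, f₀, h1, h2, h3, h4⟩ := exists_trivialQuotient n F
  obtain ⟨η', hη', f₀', h1', h2', h3', h4'⟩ := exists_trivialQuotient n E
  exact ⟨⟨isIrredAdm_trivial _, isIrredAdm_trivial _, id, halfSum n, monotone_id,
    strictlyDecreasing_halfSum, ℂ, inferInstance, inferInstance, inferInstance,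
    Representation.trivial ℂ _ ℂ, ℂ, inferInstance, inferInstance, inferInstance,
    Representation.trivial ℂ _ ℂ, isTempered_trivial_torus,
    isTempered_trivial_torus, ⟨ContinuousLinearMap.id ℂ ℂ, LinearMap.id,
      isGenericOp_trivial_torus, fun _ => rfl, charIdentity_trivial id⟩,
    ⟨_, h4⟩, _, h4'⟩, LinearMap.id, isNormalizedOp_trivial hstar, charIdentity_trivial 0⟩

end TrivialExt

/-! ### The extension `ℂ/ℝ` -/

section Complex

theorem mem_zpowers_conjAe (s : ℂ ≃ₐ[ℝ] ℂ) : s ∈ Subgroup.zpowers Complex.conjAe := by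
  rcases Complex.real_algHom_eq_id_or_conj (s : ℂ →ₐ[ℝ] ℂ) with h | h
  · have : s = 1 := AlgEquiv.ext fun z => AlgHom.congr_fun h z
    exact this ▸ one_mem _
  · have : s = Complex.conjAe := AlgEquiv.ext fun z => AlgHom.congr_fun h z
    exact this ▸ Subgroup.mem_zpowers _

theorem real_algEquiv_star (s : ℂ ≃ₐ[ℝ] ℂ) (z : ℂ) : s (star z) = star (s z) := by
  rcases Complex.real_algHom_eq_id_or_conj (s : ℂ →ₐ[ℝ] ℂ) with h | h
  · have h : ∀ z, s z = z := AlgHom.congr_fun h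
    rw [h, h]
  · have h : ∀ z, s z = star z := AlgHom.congr_fun h
    rw [h, h]

instance isGalois_complex : IsGalois ℝ ℂ :=
  have : IsAlgClosure ℝ ℂ := ⟨inferInstance, inferInstance⟩
  { to_isSeparable := inferInstance
    to_normal := IsAlgClosure.normal ℝ ℂ }

variable {n : ℕ} [NeZero n] {ψ : AddChar ℝ Circle} {χ : G n ℝ →ₜ* ℂˣ} {χE : G n ℂ →ₜ* ℂˣ}

theorem isShintaniLift_charRep (h : IsNormComp Complex.conjAe χ χE) :
    IsShintaniLift Complex.conjAe ψ (charRep (χ : G n ℝ →* ℂˣ)) (charRep (χE : G n ℂ →* ℂˣ)) :=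
  (isShintaniLift_trivial real_algEquiv_star).twist mem_zpowers_conjAe exists_eq_normAbs_rpow h

theorem isNormalizedOp_charRep (h : IsNormComp Complex.conjAe χ χE) :
    IsNormalizedOp Complex.conjAe ψ (charRep (χE : G n ℂ →* ℂˣ)) LinearMap.id := by
  have := (isNormalizedOp_trivial (σ := Complex.conjAe) (ψ := ψ) real_algEquiv_star).twist
    mem_zpowers_conjAe exists_eq_normAbs_rpow h
  rwa [LinearEquiv.conj_id] at this

end Complex

end Arch

end Shintani

end

/-! ### The proposition for `p`-adic fields and for `ℂ/ℝ` -/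

theorem mainTheorem9 :
    -- the `p`-adic case
    (∀ (F : Type*) [NontriviallyNormedField F] [LocallyCompactSpace F] [IsUltrametricDist F]
      [CharZero F]
      (E : Type*) [NontriviallyNormedField E] [LocallyCompactSpace E] [IsUltrametricDist E]
      [NormedAlgebra F E] [FiniteDimensional F E] [IsGalois F E]
      (σ : E ≃ₐ[F] E) (_ : ∀ s : E ≃ₐ[F] E, s ∈ Subgroup.zpowers σ)
      (ψ : AddChar F Circle) (_ : Continuous ψ) (_ : ψ ≠ 1) (n : ℕ) [NeZero n],
      -- (a)
      (∀ χ : Shintani.G n F →ₜ* ℂˣ, ∃ χE : Shintani.G n E →ₜ* ℂˣ,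
        Shintani.IsNormComp σ χ χE ∧
        Shintani.Padic.IsShintaniLift σ ψ (Shintani.charRep (χ : Shintani.G n F →* ℂˣ))
          (Shintani.charRep (χE : Shintani.G n E →* ℂˣ)) ∧
        Shintani.Padic.IsNormalizedOp σ ψ (Shintani.charRep (χE : Shintani.G n E →* ℂˣ))
          LinearMap.id) ∧
      -- (b)
      (∀ z : ℂ, ∃ χ ∈ Shintani.unramified n F, ∃ χ' ∈ Shintani.unramified n E,
        (∀ g : Shintani.G n F, (χ g : ℂ) =
          (Shintani.normAbs (g : Matrix (Fin n) (Fin n) F).det : ℂ) ^ z) ∧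
        (∀ g : Shintani.G n E, (χ' g : ℂ) =
          (Shintani.normAbs (g : Matrix (Fin n) (Fin n) E).det : ℂ) ^ z) ∧
        Shintani.Padic.IsShintaniLift σ ψ (Shintani.charRep (χ : Shintani.G n F →* ℂˣ))
          (Shintani.charRep (χ' : Shintani.G n E →* ℂˣ))) ∧
      (∃ L : Shintani.unramified n F →* Shintani.unramified n E, Function.Surjective L ∧
        ∀ χ : Shintani.unramified n F, Shintani.IsNormComp σ (χ : Shintani.G n F →ₜ* ℂˣ) (L χ : Shintani.G n E →ₜ* ℂˣ) ∧
          Shintani.Padic.IsShintaniLift σ ψ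
            (Shintani.charRep ((χ : Shintani.G n F →ₜ* ℂˣ) : Shintani.G n F →* ℂˣ))
            (Shintani.charRep ((L χ : Shintani.G n E →ₜ* ℂˣ) : Shintani.G n E →* ℂˣ))) ∧
      -- (c)
      (∀ (χ : Shintani.G n F →ₜ* ℂˣ) (χE : Shintani.G n E →ₜ* ℂˣ),
        Shintani.IsNormComp σ χ χE →
        ∀ (V : Type*) [AddCommGroup V] [Module ℂ V] (π : Representation ℂ (Shintani.G n F) V)
          (W : Type*) [AddCommGroup W] [Module ℂ W] (P : Representation ℂ (Shintani.G n E) W),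
          Shintani.Padic.IsShintaniLift σ ψ π P →
          Shintani.Padic.IsShintaniLift σ ψ (Shintani.twist (χ : Shintani.G n F →* ℂˣ) π)
            (Shintani.twist (χE : Shintani.G n E →* ℂˣ) P))) ∧
    -- the Archimedean case
    (∀ (ψ : AddChar ℝ Circle) (_ : Continuous ψ) (_ : ψ ≠ 1) (n : ℕ) [NeZero n],
      -- (a)
      (∀ χ : Shintani.G n ℝ →ₜ* ℂˣ, ∃ χE : Shintani.G n ℂ →ₜ* ℂˣ,
        Shintani.IsNormComp Complex.conjAe χ χE ∧
        Shintani.Arch.IsShintaniLift Complex.conjAe ψ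
          (Shintani.charRep (χ : Shintani.G n ℝ →* ℂˣ))
          (Shintani.charRep (χE : Shintani.G n ℂ →* ℂˣ)) ∧
        Shintani.Arch.IsNormalizedOp Complex.conjAe ψ
          (Shintani.charRep (χE : Shintani.G n ℂ →* ℂˣ)) LinearMap.id) ∧
      -- (c)
      (∀ (χ : Shintani.G n ℝ →ₜ* ℂˣ) (χE : Shintani.G n ℂ →ₜ* ℂˣ),
        Shintani.IsNormComp Complex.conjAe χ χE →
        ∀ (V : Type*) [NormedAddCommGroup V] [InnerProductSpace ℂ V] [CompleteSpace V]
          (π : Representation ℂ (Shintani.G n ℝ) V)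
          (W : Type*) [NormedAddCommGroup W] [InnerProductSpace ℂ W] [CompleteSpace W]
          (P : Representation ℂ (Shintani.G n ℂ) W),
          Shintani.Arch.IsShintaniLift Complex.conjAe ψ π P →
          Shintani.Arch.IsShintaniLift Complex.conjAe ψ
            (Shintani.twist (χ : Shintani.G n ℝ →* ℂˣ) π)
            (Shintani.twist (χE : Shintani.G n ℂ →* ℂˣ) P))) := by
  refine ⟨?_, ?_⟩
  · intro F _ _ _ _ E _ _ _ _ _ _ σ hσ ψ _ _ n _
    refine ⟨fun χ => ?_, fun z => ?_, ?_, fun χ χE h V _ _ π W _ _ P hP => hP.twist hσ h⟩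
    · have h := Shintani.isNormComp_baseChangeChar hσ χ
      exact ⟨_, h, Shintani.Padic.isShintaniLift_charRep hσ h,
        Shintani.Padic.isNormalizedOp_charRep hσ h⟩
    · exact ⟨_, Shintani.Padic.absDet_mem_unramified n F z, _,
        Shintani.Padic.absDet_mem_unramified n E z, Shintani.absDet_apply z,
        Shintani.absDet_apply z,
        Shintani.Padic.isShintaniLift_charRep hσ (Shintani.Padic.isNormComp_absDet hσ z)⟩
    · obtain ⟨L, hL, h⟩ := Shintani.Padic.exists_unramified_baseChange (n := n) hσ
      exact ⟨L, hL, fun χ => ⟨h χ, Shintani.Padic.isShintaniLift_charRep hσ (h χ)⟩⟩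
  · intro ψ _ _ n _
    refine ⟨fun χ => ?_, fun χ χE h V _ _ _ π W _ _ _ P hP =>
      hP.twist Shintani.Arch.mem_zpowers_conjAe Shintani.Arch.exists_eq_normAbs_rpow h⟩
    have h := Shintani.isNormComp_baseChangeChar Shintani.Arch.mem_zpowers_conjAe χ
    exact ⟨_, h, Shintani.Arch.isShintaniLift_charRep h, Shintani.Arch.isNormalizedOp_charRep h⟩
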